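/- Let $K$ be a number field and $G$ a finite group. Write $\mathrm{ge}(G)=\min_S \operatorname{lcm}\{\operatorname{ord}(x) : x\in S\}$, where $S$ runs over the generating subsets of $G$. A $K$-regular $G$-extension $N/K(t)$ is a finite Galois extension with group $G$ in which $K$ is algebraically closed. For $p\in\overline K\cup\{\infty\}$ the ramification index of $N/K(t)$ at $p$ is the least $e\ge 1$ such that $N$ embeds over $K(t)$ into $\overline K(((t-p)^{1/e}))$ (with $1/t$ in place of $t-p$ if $p=\infty$). The branch points are the finitely many $p_1,\dots,p_r$ with ramification index greater than $1$. Fix primitive $e$-th roots of unity $\zeta_e\in\overline K$. The ramification type of $N/K(t)$ is the tuple $(C_1,\dots,C_r)$, where $C_i$ is the conjugacy class of $G$ given by restricting to $N$ the automorphism $(t-p_i)^{1/e}\mapsto\zeta_e(t-p_i)^{1/e}$, with $e$ the ramification index at $p_i$. For $a\in K$ not a branch point, the specialization $N_a/K$ is the residue field extension at a place of $N$ extending $t\mapsto a$. Let $U(N/K(t))$ be the set of finite primes of $K$ that ramify in $N_a/K$ for every $a\in K$ that is not a branch point (the universally ramified primes). **Theorem.** Let $N/K(t)$ be a $K$-regular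 $G$-extension with ramification type $(C_1,\dots,C_r)$. For $i=1,\dots,r$ let $I_i\le G$ be the cyclic group generated by an element of $C_i$, and let $e_i=|I_i|$. Assume that $r\ge 2$ and that $i=1$ and $i=2$ are exactly the indices $i\in\{1,\dots,r\}$ for which $e_i$ does not divide $\mathrm{ge}(G)$. Assume moreover that $\gcd(e_1,e_2)=1$ and that $C_G(I_1)=I_1$ and $C_G(I_2)=I_2$. Then there is a $K$-regular $G$-extension $N'/K(t)$ all of whose inertia groups (the cyclic groups generated by elements of the classes in its ramification type) have order dividing $\mathrm{ge}(G)$ and for which $U(N'/K(t))=\emptyset$. -/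

import Mathlib

open scoped NumberField

universe u v w

/-- The generator exponent of `G`: the minimum, over the (finite) generating subsets `S` of `G`, of
the least common multiple of the orders of the elements of `S`. -/
noncomputable def generatorExponent (G : Type v) [Group G] : ℕ :=
  sInf {n : ℕ | ∃ S : Finset G, Subgroup.closure (S : Set G) = ⊤ ∧ S.lcm orderOf = n}

/-- A `K`-regular `G`-extension `N/K(t)`: a finite Galois extension of `K(t) = RatFunc K` in which
`K` is algebraically closed, with an identification of its Galois group with `G`. -/
structure RegularGExtension (K : Type u) [Field K] (G : Type v) [Group G] where
  /-- The field `N`. -/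
  carrier : Type w
  [field : Field carrier]
  [algebraBase : Algebra K carrier]
  [algebraRatFunc : Algebra (RatFunc K) carrier]
  [tower : IsScalarTower K (RatFunc K) carrier]
  finite : FiniteDimensional (RatFunc K) carrier
  galois : IsGalois (RatFunc K) carrier
  regular : algebraicClosure K carrier = ⊥
  /-- The identification of the Galois group with `G`. -/
  gal : (carrier ≃ₐ[RatFunc K] carrier) ≃* G

namespace RegularGExtension

attribute [instance] field algebraBase algebraRatFunc tower

variable {K : Type u} [Field K] {G : Type v} [Group G]

/-- The image of `t` in `K̄((s))` under `s = (t - p) ^ (1 / e)`, that is `t = p + s ^ e`, for a point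
`p ≠ ∞`, and under `s = (1 / t) ^ (1 / e)`, that is `t = s ^ (-e)`, for `p = ∞`. -/
noncomputable def puiseuxParameter (p : OnePoint (AlgebraicClosure K)) (e : ℕ) :
    LaurentSeries (AlgebraicClosure K) :=
  p.elim (HahnSeries.single (-(e : ℤ)) 1)
    (fun a => HahnSeries.C a + HahnSeries.single (e : ℤ) 1)

variable (N : RegularGExtension.{u, v, w} K G)

/-- The element `t` of `N`. -/
noncomputable def t : N.carrier := algebraMap (RatFunc K) N.carrier RatFunc.X

/-- The embeddings of `N` into `K̄(((t - p) ^ (1 / e)))` over `K(t)`. -/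
def PuiseuxEmbedding (p : OnePoint (AlgebraicClosure K)) (e : ℕ) :=
  {φ : N.carrier →+* LaurentSeries (AlgebraicClosure K) //
    (∀ c : K, φ (algebraMap K N.carrier c) =
      HahnSeries.C (algebraMap K (AlgebraicClosure K) c)) ∧
    φ N.t = puiseuxParameter p e}

/-- The ramification index of `N/K(t)` at `p`: the minimal `e ≥ 1` such that `N` embeds into
`K̄(((t - p) ^ (1 / e)))`. -/
noncomputable def ramificationIndex (p : OnePoint (AlgebraicClosure K)) : ℕ :=
  sInf {e : ℕ | 0 < e ∧ Nonempty (N.PuiseuxEmbedding p e)}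

/-- The branch points of `N/K(t)`, in `K̄ ∪ {∞}`. -/
def branchPoints : Set (OnePoint (AlgebraicClosure K)) :=
  {p | N.ramificationIndex p ≠ 1}

/-- The elements of `G` that correspond to the automorphism
`(t - p) ^ (1 / e) ↦ ζ (t - p) ^ (1 / e)` of `K̄(((t - p) ^ (1 / e)))`, restricted to `N` along some
embedding, where `e` is the ramification index at `p` and `ζ = ζ e`. They form one conjugacy class,
because any two embeddings differ by an element of the Galois group. On coefficients the
automorphism is `∑ aₙ sⁿ ↦ ∑ ζⁿ aₙ sⁿ`. -/
def inertiaClass (ζ : ℕ → AlgebraicClosure K) (p : OnePoint (AlgebraicClosure K)) : Set G :=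
  {g | ∃ (φ : N.PuiseuxEmbedding p (N.ramificationIndex p)),
    ∀ (x : N.carrier) (n : ℤ),
      (φ.1 (N.gal.symm g x)).coeff n = ζ (N.ramificationIndex p) ^ n * (φ.1 x).coeff n}

/-- `N/K(t)` has ramification type `(C₁, …, Cᵣ)`: its branch points are `p₁, …, pᵣ` (without
repetition), and `Cᵢ` is the class of `N/K(t)` at `pᵢ`. -/
def HasRamificationType (ζ : ℕ → AlgebraicClosure K) {r : ℕ} (C : Fin r → ConjClasses G) : Prop :=
  ∃ p : Fin r → OnePoint (AlgebraicClosure K),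
    Function.Injective p ∧ Set.range p = N.branchPoints ∧
      ∀ i, (C i).carrier = N.inertiaClass ζ (p i)

/-- A place of `N` extending the place `t ↦ a` of `K(t)`, given by its valuation ring: it contains
`K`, and `t - a` lies in its maximal ideal. -/
structure PlaceOver (a : K) where
  /-- The valuation ring. -/
  ring : ValuationSubring N.carrier
  const_mem : ∀ c : K, algebraMap K N.carrier c ∈ ring
  sub_mem : N.t - algebraMap K N.carrier a ∈ ring.nonunits

namespace PlaceOver

variable {N} {a : K} (P : N.PlaceOver a)

/-- The residue field of a place. For a place over `t ↦ a`, where `a` is not a branch point, it is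
the specialization `N_a` of `N/K(t)` at `t ↦ a`. -/
def ResidueField : Type w := IsLocalRing.ResidueField P.ring

noncomputable instance : Field P.ResidueField :=
  inferInstanceAs (Field (IsLocalRing.ResidueField P.ring))

/-- The residue field is an extension of `K` through the constants `K ⊆ P.ring`. -/
noncomputable instance : Algebra K P.ResidueField :=
  ((IsLocalRing.residue P.ring).comp
    ((algebraMap K N.carrier).codRestrict P.ring.toSubring P.const_mem)).toAlgebra

end PlaceOver

/-- The finite prime `𝔭` of `K` ramifies in the specialization `N_a/K`, that is in the residue field
extension of the places over `t ↦ a`. -/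
def RamifiesInSpecialization (a : K) (𝔭 : IsDedekindDomain.HeightOneSpectrum (𝓞 K)) : Prop :=
  ∀ P : N.PlaceOver a, ¬ Algebra.IsUnramifiedIn (𝓞 P.ResidueField) 𝔭.asIdeal

/-- The set `U(N/K(t))` of universally ramified primes: the finite primes of `K` that ramify in
every specialization `N_a/K`, where `a ∈ K` is not a branch point. -/
def universallyRamifiedPrimes : Set (IsDedekindDomain.HeightOneSpectrum (𝓞 K)) :=
  {𝔭 | ∀ a : K, ((algebraMap K (AlgebraicClosure K) a : AlgebraicClosure K) :
      OnePoint (AlgebraicClosure K)) ∉ N.branchPoints → N.RamifiesInSpecialization a 𝔭}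

end RegularGExtension

/-!
The extension `N'` is a pullback of `N`. The two exceptional inertia orders `e₁`, `e₂` are coprime
and greater than `1`, and no other branch point has one of them as its ramification index. Galois
conjugation preserves ramification indices, so both exceptional branch points are `K`-rational
(`RegularGExtension.eq_algebraMap_of_ramificationIndex`) and a Möbius transformation moves them to
`0` and `∞` (`RegularGExtension.exists_moebius_pullback`). Then `t` is replaced by

`f(s) = ν s ^ e₁ (s - 1) ^ (e₁ (e₂ - 1)) / (s - μ) ^ e₂`  (`powerQuotient`).

*Ramification.* All zeros of `f` have multiplicity divisible by `e₁`, and its poles `μ` and `∞` have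
multiplicities `e₂` and `e₂ (e₁ - 1)`. By Abhyankar's lemma
(`RegularGExtension.IsPullback.nonempty_puiseuxEmbedding`) nothing ramifies over `0` and `∞` any
more, and elsewhere the indices of `N'` divide those of `N`, hence `ge(G)`.

*Group and regularity.* The Galois group remains `G` and the extension remains regular if `N` is
linearly disjoint from `K̄(s)` over `K(t)`
(`RegularGExtension.mem_range_of_powerQuotient`). An element of `N ∩ K̄(s)` integral over `K[t]` is a
polynomial divided by a power of `s - μ`. If the critical values of `f` other than `0`, `∞` are not
branch points, it is locally a power series in `f` at every critical point outside the zeros and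
poles, so the Euler operator `f d/df` creates no new poles and acts on a finite-dimensional space of
such functions. It has no Jordan blocks there, and its eigenvectors are powers of `f` because `e₁`
and `e₂` are coprime (`EulerOperator.mem_span_monomial`). The condition on the critical values is
met by choosing `ν = k ^ (e₁ e₂)` with a suitable integer `k`.

*Specializations.* Assume that the inertia group at `0`, of order `e`, is its own centralizer.
Automorphisms of `K̄` over `K(ζ_e)` commute with inertia, so they act on the coefficients of a Puiseux
embedding through a Kummer character, and after a rescaling of the parameter the embedding is defined
over `K(ζ_e)` (`RegularGExtension.PuiseuxEmbedding.Rotates.exists_rational`). By Krasner's lemma, a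
specialization at `u` close to `0` is unramified at `𝔭 ∤ e` as soon as `v_𝔭(u)` lies in a certain class
modulo `e`, which is trivial for almost all `𝔭` (`exists_bound_of_expansion`,
`RegularGExtension.exists_unramified_splitting`). With `1 / t` in place of `t` the same holds at `∞`.
For `𝔭 ∤ e₁` one specializes near the zeros `0` or `1` of `f`, and for `𝔭 ∣ e₁`, hence `𝔭 ∤ e₂`, near the
pole `μ`. The factor `ν` does not change valuations modulo `e₁` or `e₂`, and prescribing `v_𝔭(μ)` at
finitely many primes puts `v_𝔭(f(s))` into the right class (`RegularGExtension.exists_powerQuotient`).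
Hensel's lemma turns the split fibre into a place of `N'` whose residue field is unramified at `𝔭`
(`RegularGExtension.IsPullback.not_ramifiesInSpecialization`).
-/

/-! ### Ring homomorphisms between fields of Laurent series -/

namespace LaurentSeries

variable {k l : Type*} [Field k] [Field l]

/-- The ring homomorphism `∑ aₙ sⁿ ↦ ∑ zⁿ σ(aₙ) sⁿ` of fields of Laurent series. It covers both the
action of a homomorphism of the constants (`z = 1`) and the rotation `s ↦ z s` (`σ = id`). -/
noncomputable def twist (σ : k →+* l) (z : lˣ) : LaurentSeries k →+* LaurentSeries l where
  toFun x :=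
    { coeff := fun n => ((z ^ n : lˣ) : l) * σ (x.coeff n)
      isPWO_support' := x.isPWO_support.mono fun n hn => by
        rw [HahnSeries.mem_support]
        rintro h0
        simp [h0] at hn }
  map_one' := by
    ext n
    by_cases h : n = 0 <;> simp [HahnSeries.coeff_one, h]
  map_zero' := by ext n; simp
  map_add' x y := by ext n; simp [mul_add]
  map_mul' x y := by
    ext n
    rw [HahnSeries.coeff_mul]
    simp only [HahnSeries.coeff_mul, map_sum, Finset.mul_sum]
    refine Finset.sum_congr ?_ ?_
    · ext ij
      have h1 : (z : l) ^ ij.1 ≠ 0 := zpow_ne_zero _ z.ne_zero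
      have h2 : (z : l) ^ ij.2 ≠ 0 := zpow_ne_zero _ z.ne_zero
      simp [h1, h2]
    · intro ij hij
      rw [← (Finset.mem_antidiagonal.1 hij).2.2, zpow_add, map_mul]
      push_cast
      ring

@[simp]
theorem twist_coeff (σ : k →+* l) (z : lˣ) (x : LaurentSeries k) (n : ℤ) :
    (twist σ z x).coeff n = ((z : l) ^ n) * σ (x.coeff n) := by
  simp [twist]

@[simp]
theorem twist_C (σ : k →+* l) (z : lˣ) (a : k) :
    twist σ z (HahnSeries.C a) = HahnSeries.C (σ a) := by
  ext n
  by_cases h : n = 0 <;> simp [h]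

theorem twist_single (σ : k →+* l) (z : lˣ) (m : ℤ) (a : k) :
    twist σ z (HahnSeries.single m a) = HahnSeries.single m ((z : l) ^ m * σ a) := by
  ext n
  by_cases h : n = m <;> simp [h]

theorem twist_injective (σ : k →+* l) (z : lˣ) : Function.Injective (twist σ z) :=
  (twist σ z).injective

/-- The substitution `s ↦ s ^ m` in Laurent series. -/
noncomputable def expand (m : ℕ) (hm : 0 < m) : LaurentSeries k →+* LaurentSeries k :=
  HahnSeries.embDomainRingHom (AddMonoidHom.mulLeft (m : ℤ))
    (fun a b h => by simpa [hm.ne'] using h)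
    (fun a b => by simp [hm])

theorem expand_coeff_mul (m : ℕ) (hm : 0 < m) (x : LaurentSeries k) (n : ℤ) :
    (expand m hm x).coeff (m * n) = x.coeff n :=
  HahnSeries.embDomain_coeff (f := ⟨⟨AddMonoidHom.mulLeft (m : ℤ), _⟩, _⟩)

theorem expand_coeff_of_not_dvd (m : ℕ) (hm : 0 < m) (x : LaurentSeries k) (n : ℤ)
    (hn : ¬ (m : ℤ) ∣ n) : (expand m hm x).coeff n = 0 := by
  refine HahnSeries.embDomain_of_notMem_range ?_
  rintro ⟨a, rfl⟩
  exact hn ⟨a, rfl⟩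

@[simp]
theorem expand_C (m : ℕ) (hm : 0 < m) (a : k) :
    expand m hm (HahnSeries.C a) = HahnSeries.C a :=
  HahnSeries.embDomainRingHom_C

theorem expand_single (m : ℕ) (hm : 0 < m) (n : ℤ) (a : k) :
    expand m hm (HahnSeries.single n a) = HahnSeries.single (m * n) a :=
  HahnSeries.embDomain_single

theorem mem_range_expand (m : ℕ) (hm : 0 < m) (x : LaurentSeries k) :
    x ∈ (expand (k := k) m hm).range ↔ ∀ n : ℤ, x.coeff n ≠ 0 → (m : ℤ) ∣ n := by
  have hm' : (m : ℤ) ≠ 0 := by exact_mod_cast hm.ne'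
  constructor
  · rintro ⟨y, rfl⟩ n hn
    by_contra h
    exact hn (expand_coeff_of_not_dvd m hm y n h)
  · intro h
    have hpwo : (Function.support fun n : ℤ => x.coeff (m * n)).IsPWO := by
      rw [Set.isPWO_iff_isWF, Set.isWF_iff_no_descending_seq]
      intro f hf hmem
      have h2 := x.isPWO_support
      rw [Set.isPWO_iff_isWF, Set.isWF_iff_no_descending_seq] at h2
      exact h2 (fun i => m * f i)
        (fun a b hab => mul_lt_mul_of_pos_left (hf hab) (by exact_mod_cast hm))
        fun i => hmem i
    refine ⟨⟨fun n => x.coeff (m * n), hpwo⟩, ?_⟩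
    ext n
    by_cases hn : (m : ℤ) ∣ n
    · obtain ⟨c, rfl⟩ := hn
      rw [expand_coeff_mul]
    · rw [expand_coeff_of_not_dvd _ _ _ _ hn]
      by_contra h0
      exact hn (h n (Ne.symm h0))

/-- Homomorphisms from a field of Laurent series are determined by their values on power series. -/
theorem ringHom_ext {L : Type*} [Field L] {f g : LaurentSeries k →+* L}
    (h : ∀ p : PowerSeries k, f (HahnSeries.ofPowerSeries ℤ k p) =
      g (HahnSeries.ofPowerSeries ℤ k p)) : f = g :=
  IsLocalization.ringHom_ext (nonZeroDivisors (PowerSeries k)) (RingHom.ext h)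

theorem subst_injective {h : PowerSeries k} (h0 : PowerSeries.constantCoeff h = 0)
    (hne : h ≠ 0) : Function.Injective
      (PowerSeries.substAlgHom (PowerSeries.HasSubst.of_constantCoeff_zero' h0) :
        PowerSeries k →ₐ[k] PowerSeries k) := by
  rw [injective_iff_map_eq_zero]
  intro f hf
  by_contra hfne
  obtain ⟨g, hg⟩ := PowerSeries.X_pow_order_dvd (φ := f)
  have hg0 : PowerSeries.constantCoeff g ≠ 0 := by
    have := PowerSeries.coeff_order hfne
    rw [hg, PowerSeries.coeff_X_pow_mul'] at this
    simpa [← hg] using this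
  have hX : PowerSeries.substAlgHom (PowerSeries.HasSubst.of_constantCoeff_zero' h0)
      (PowerSeries.X : PowerSeries k) = h := PowerSeries.substAlgHom_X _
  rw [hg, map_mul, map_pow, hX] at hf
  rcases mul_eq_zero.1 hf with h1 | h1
  · exact hne (eq_zero_of_pow_eq_zero h1)
  · have h2 := PowerSeries.constantCoeff_subst_eq_zero h0 (g - PowerSeries.C (PowerSeries.constantCoeff g)) (by simp)
    rw [PowerSeries.subst_sub (PowerSeries.HasSubst.of_constantCoeff_zero' h0),
      ← PowerSeries.coe_substAlgHom (PowerSeries.HasSubst.of_constantCoeff_zero' h0), h1,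
      PowerSeries.coe_substAlgHom, PowerSeries.subst_C] at h2
    apply hg0
    simpa using h2

/-- The substitution `s ↦ h` in Laurent series, for a power series `h ≠ 0` without constant
coefficient. -/
noncomputable def subst (h : PowerSeries k) (h0 : PowerSeries.constantCoeff h = 0)
    (hne : h ≠ 0) : LaurentSeries k →+* LaurentSeries k :=
  IsFractionRing.lift (A := PowerSeries k)
    (g := (HahnSeries.ofPowerSeries ℤ k).comp
      (PowerSeries.substAlgHom (PowerSeries.HasSubst.of_constantCoeff_zero' h0) :
        PowerSeries k →ₐ[k] PowerSeries k).toRingHom)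
    (HahnSeries.ofPowerSeries_injective.comp (subst_injective h0 hne))

theorem subst_ofPowerSeries (h : PowerSeries k) (h0 : PowerSeries.constantCoeff h = 0)
    (hne : h ≠ 0) (p : PowerSeries k) :
    subst h h0 hne (HahnSeries.ofPowerSeries ℤ k p) =
      HahnSeries.ofPowerSeries ℤ k (p.subst h) := by
  have := IsFractionRing.lift_algebraMap (A := PowerSeries k) (K := LaurentSeries k)
    (g := (HahnSeries.ofPowerSeries ℤ k).comp
      (PowerSeries.substAlgHom (PowerSeries.HasSubst.of_constantCoeff_zero' h0) :
        PowerSeries k →ₐ[k] PowerSeries k).toRingHom)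
    (HahnSeries.ofPowerSeries_injective.comp (subst_injective h0 hne)) p
  rw [subst]
  refine this.trans ?_
  simp [PowerSeries.coe_substAlgHom]

@[simp]
theorem subst_C (h : PowerSeries k) (h0 : PowerSeries.constantCoeff h = 0)
    (hne : h ≠ 0) (a : k) : subst h h0 hne (HahnSeries.C a) = HahnSeries.C a := by
  rw [← HahnSeries.ofPowerSeries_C, subst_ofPowerSeries, PowerSeries.subst_C]
  rfl

theorem subst_X (h : PowerSeries k) (h0 : PowerSeries.constantCoeff h = 0)
    (hne : h ≠ 0) : subst h h0 hne (HahnSeries.single 1 1) = HahnSeries.ofPowerSeries ℤ k h := by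
  rw [← HahnSeries.ofPowerSeries_X, subst_ofPowerSeries,
    PowerSeries.subst_X (PowerSeries.HasSubst.of_constantCoeff_zero' h0)]

theorem twist_id_ofPowerSeries (z : kˣ) (p : PowerSeries k) :
    twist (RingHom.id k) z (HahnSeries.ofPowerSeries ℤ k p) =
      HahnSeries.ofPowerSeries ℤ k (PowerSeries.rescale (z : k) p) := by
  ext n
  rw [twist_coeff, PowerSeries.coeff_coe, PowerSeries.coeff_coe]
  split_ifs with h
  · simp
  · obtain ⟨m, rfl⟩ := Int.eq_ofNat_of_zero_le (not_lt.1 h)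
    simp

/-- Rotations commute with a substitution `s ↦ h` that commutes with them. -/
theorem twist_subst (z : kˣ) (h : PowerSeries k) (h0 : PowerSeries.constantCoeff h = 0)
    (hne : h ≠ 0) (hz : PowerSeries.rescale (z : k) h = (z : k) • h) (x : LaurentSeries k) :
    twist (RingHom.id k) z (subst h h0 hne x) = subst h h0 hne (twist (RingHom.id k) z x) := by
  have hs := PowerSeries.HasSubst.of_constantCoeff_zero' h0
  have : (twist (RingHom.id k) z).comp (subst h h0 hne) =
      (subst h h0 hne).comp (twist (RingHom.id k) z) := by
    refine ringHom_ext fun p => ?_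
    simp only [RingHom.comp_apply, subst_ofPowerSeries, twist_id_ofPowerSeries]
    congr 1
    rw [PowerSeries.rescale_eq_subst, PowerSeries.rescale_eq_subst,
      PowerSeries.subst_comp_subst_apply hs (PowerSeries.HasSubst.smul_X' _),
      PowerSeries.subst_comp_subst_apply (PowerSeries.HasSubst.smul_X' _) hs,
      ← PowerSeries.rescale_eq_subst, hz, PowerSeries.subst_smul hs, PowerSeries.subst_X hs]
  exact RingHom.congr_fun this x

theorem exists_eq_single_mul {x : LaurentSeries k} (hx : x ≠ 0) :
    ∃ (n : ℤ) (p : PowerSeries k), PowerSeries.constantCoeff p ≠ 0 ∧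
      x = HahnSeries.single n 1 * HahnSeries.ofPowerSeries ℤ k p := by
  refine ⟨x.order, x.powerSeriesPart, ?_, (single_order_mul_powerSeriesPart x).symm⟩
  rw [← PowerSeries.coeff_zero_eq_constantCoeff_apply, powerSeriesPart_coeff]
  simpa using HahnSeries.coeff_order_eq_zero.not.2 hx

theorem ofPowerSeries_X_pow (m : ℕ) :
    HahnSeries.ofPowerSeries ℤ k (PowerSeries.X ^ m) = HahnSeries.single (m : ℤ) 1 := by
  simp

theorem single_one_zpow (n : ℤ) :
    (HahnSeries.single (1 : ℤ) (1 : k)) ^ n = HahnSeries.single n 1 := by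
  exact (RatFunc.single_zpow n).symm

theorem ofPowerSeries_inv {p : PowerSeries k} (hp : PowerSeries.constantCoeff p ≠ 0) :
    HahnSeries.ofPowerSeries ℤ k p⁻¹ = (HahnSeries.ofPowerSeries ℤ k p)⁻¹ := by
  refine eq_inv_of_mul_eq_one_left ?_
  rw [← map_mul, PowerSeries.inv_mul_cancel p hp, map_one]

theorem algebraMap_eq_C (a : k) : algebraMap k (LaurentSeries k) a = HahnSeries.C a := by
  simp [RingHom.algebraMap_toAlgebra]

/-- An algebraic nonconstant series would, up to inversion, have positive order; but a polynomial
relation with nonzero constant term has no such root. -/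
theorem mem_range_C_of_isAlgebraic {x : LaurentSeries k} (hx : IsAlgebraic k x) :
    x ∈ (HahnSeries.C : k →+* LaurentSeries k).range := by
  have key : ∀ p : PowerSeries k, PowerSeries.constantCoeff p = 0 →
      IsAlgebraic k (HahnSeries.ofPowerSeries ℤ k p) → p = 0 := by
    intro p hp halg
    by_contra hne
    have halg' : IsAlgebraic k (HahnSeries.ofPowerSeries ℤ k p) := halg
    have hint := halg'.isIntegral
    set m := minpoly k (HahnSeries.ofPowerSeries ℤ k p) with hm
    have h1 : Polynomial.aeval (HahnSeries.ofPowerSeries ℤ k p) m = 0 := minpoly.aeval _ _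
    have h2 : m.coeff 0 ≠ 0 := minpoly.coeff_zero_ne_zero hint fun h0 => hne
      (HahnSeries.ofPowerSeries_injective (Γ := ℤ) (by rw [h0, map_zero]))
    apply h2
    have h3 : HahnSeries.ofPowerSeries ℤ k (Polynomial.aeval p m) = 0 := by
      rw [← h1, Polynomial.aeval_def, Polynomial.aeval_def, Polynomial.hom_eval₂]
      congr 1
    have h4 : Polynomial.aeval p m = 0 := HahnSeries.ofPowerSeries_injective (by rw [h3, map_zero])
    have h5 := congrArg (PowerSeries.constantCoeff (R := k)) h4
    rw [Polynomial.aeval_def, Polynomial.hom_eval₂, hp, map_zero,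
      Polynomial.eval₂_at_zero] at h5
    simpa using h5
  have key2 : ∀ y : LaurentSeries k, IsAlgebraic k y → y.coeff 0 = 0 → y = 0 := by
    intro y hy h0
    by_contra hne
    obtain ⟨n, p, hp, hyp⟩ := exists_eq_single_mul hne
    rcases lt_trichotomy n 0 with hn | rfl | hn
    · obtain ⟨m, rfl⟩ : ∃ m : ℕ, n = -(m : ℤ) := ⟨n.natAbs, by omega⟩
      have h1 : y⁻¹ = HahnSeries.ofPowerSeries ℤ k (PowerSeries.X ^ m * p⁻¹) := by
        rw [map_mul, ofPowerSeries_X_pow, ofPowerSeries_inv hp, hyp, mul_inv,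
          ← single_one_zpow (-(m : ℤ)), ← zpow_neg, neg_neg, single_one_zpow]
      have h2 := key _ (by simp [show m ≠ 0 by omega]) (h1 ▸ hy.inv)
      rw [h2, map_zero, inv_eq_zero] at h1
      exact hne h1
    · apply hp
      have h1 : y = HahnSeries.ofPowerSeries ℤ k p := by
        rw [hyp]; simp
      rw [h1, show (0 : ℤ) = ((0 : ℕ) : ℤ) from rfl, coeff_coe_powerSeries] at h0
      simpa using h0
    · obtain ⟨m, rfl⟩ : ∃ m : ℕ, n = (m : ℤ) := ⟨n.natAbs, by omega⟩
      have h1 : y = HahnSeries.ofPowerSeries ℤ k (PowerSeries.X ^ m * p) := by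
        rw [map_mul, ofPowerSeries_X_pow, hyp]
      have h2 := key _ (by simp [show m ≠ 0 by omega]) (h1 ▸ hy)
      rw [h2, map_zero] at h1
      exact hne h1
  refine ⟨x.coeff 0, ?_⟩
  have hC : IsAlgebraic k (HahnSeries.C (x.coeff 0) : LaurentSeries k) := by
    have h1 := isAlgebraic_algebraMap (R := k) (A := LaurentSeries k) (x.coeff 0)
    rwa [algebraMap_eq_C] at h1
  have := key2 (x - HahnSeries.C (x.coeff 0))
    (hx.sub hC) (by simp)
  exact (sub_eq_zero.1 this).symm

/-- In characteristic zero a power series with constant coefficient `1` has roots of all orders. -/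
theorem exists_pow_eq_of_constantCoeff_eq_one [CharZero k] {e : ℕ} (he : 0 < e) (p : PowerSeries k)
    (hp : PowerSeries.constantCoeff p = 1) : ∃ v : PowerSeries k, v ^ e = p := by
  have hs : PowerSeries.HasSubst (p - 1) :=
    PowerSeries.HasSubst.of_constantCoeff_zero' (by simp [hp])
  refine ⟨(PowerSeries.binomialSeries k (1 / (e : ℚ))).subst (p - 1), ?_⟩
  have hpow : ∀ n : ℕ, PowerSeries.binomialSeries k (1 / (e : ℚ)) ^ n =
      PowerSeries.binomialSeries k (n / (e : ℚ)) := by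
    intro n
    induction n with
    | zero => simp
    | succ n ih =>
      rw [pow_succ, ih, ← PowerSeries.binomialSeries_add]
      congr 1
      push_cast
      ring
  rw [← PowerSeries.subst_pow hs, hpow, div_self (by exact_mod_cast he.ne')]
  have h1 := PowerSeries.binomialSeries_nat (R := ℚ) (A := k) 1
  rw [Nat.cast_one, pow_one] at h1
  rw [h1, PowerSeries.subst_add hs, PowerSeries.subst_X hs, ← PowerSeries.coe_substAlgHom hs,
    map_one]
  ring

theorem exists_pow_eq [CharZero k] [IsAlgClosed k] {e : ℕ} (he : 0 < e) (p : PowerSeries k)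
    (hp : PowerSeries.constantCoeff p ≠ 0) :
    ∃ v : PowerSeries k, PowerSeries.constantCoeff v ≠ 0 ∧ v ^ e = p := by
  obtain ⟨b, hb⟩ := IsAlgClosed.exists_pow_nat_eq (PowerSeries.constantCoeff p) he
  obtain ⟨v, hv⟩ := exists_pow_eq_of_constantCoeff_eq_one he
    (PowerSeries.C (PowerSeries.constantCoeff p)⁻¹ * p) (by simp [hp])
  have h : (PowerSeries.C b * v) ^ e = p := by
    rw [mul_pow, hv, ← map_pow, hb, ← mul_assoc, ← map_mul, mul_inv_cancel₀ hp, map_one, one_mul]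
  refine ⟨PowerSeries.C b * v, fun h0 => hp ?_, h⟩
  rw [← h, map_pow, h0, zero_pow he.ne']

theorem expand_ofPowerSeries {d : ℕ} (hd : 0 < d) (q : PowerSeries k) :
    expand d hd (HahnSeries.ofPowerSeries ℤ k q) =
      HahnSeries.ofPowerSeries ℤ k (q.subst (PowerSeries.X ^ d : PowerSeries k)) := by
  ext i
  by_cases hi : (d : ℤ) ∣ i
  · obtain ⟨j, rfl⟩ := hi
    rw [expand_coeff_mul, PowerSeries.coeff_coe, PowerSeries.coeff_coe]
    by_cases hj : j < 0
    · rw [if_pos hj, if_pos (mul_neg_of_pos_of_neg (by exact_mod_cast hd) hj)]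
    · obtain ⟨m, rfl⟩ := Int.eq_ofNat_of_zero_le (not_lt.1 hj)
      rw [if_neg hj, if_neg (not_lt.2 (by positivity)), PowerSeries.coeff_subst_X_pow hd.ne']
      simp [Int.natAbs_mul, hd]
  · rw [expand_coeff_of_not_dvd _ _ _ _ hi, PowerSeries.coeff_coe]
    split_ifs with h
    · rfl
    · obtain ⟨m, rfl⟩ := Int.eq_ofNat_of_zero_le (not_lt.1 h)
      rw [PowerSeries.coeff_subst_X_pow hd.ne', if_neg]
      exact fun hm => hi (by exact_mod_cast hm)

/-- If `w` has order `n > 0`, then `w(s ^ d) = h ^ e` for a power series `h` in `s`, as soon as `e`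
divides `n d`. When `d = e` and `n = 1` the series `h` is `s` times a series in `s ^ e`. -/
theorem exists_pow_eq_expand [CharZero k] [IsAlgClosed k] {n d e m : ℕ} (hm : 0 < m) (hd : 0 < d)
    (he : 0 < e) (hnd : n * d = e * m) (p : PowerSeries k) (hp : PowerSeries.constantCoeff p ≠ 0) :
    ∃ h v : PowerSeries k, PowerSeries.constantCoeff h = 0 ∧ h ≠ 0 ∧
      (HahnSeries.ofPowerSeries ℤ k h) ^ e =
        expand d hd (HahnSeries.single (n : ℤ) 1 * HahnSeries.ofPowerSeries ℤ k p) ∧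
      h = PowerSeries.X ^ m * v.subst (PowerSeries.X ^ d : PowerSeries k) := by
  obtain ⟨v, hv0, hv⟩ := exists_pow_eq he p hp
  have hs : PowerSeries.HasSubst (PowerSeries.X ^ d : PowerSeries k) :=
    PowerSeries.HasSubst.X_pow hd.ne'
  refine ⟨PowerSeries.X ^ m * v.subst (PowerSeries.X ^ d : PowerSeries k), v, ?_, ?_, ?_, rfl⟩
  · rw [map_mul, map_pow, PowerSeries.constantCoeff_X, zero_pow hm.ne', zero_mul]
  · refine mul_ne_zero (pow_ne_zero _ PowerSeries.X_ne_zero) fun h0 => hv0 ?_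
    have := congrArg PowerSeries.constantCoeff h0
    rwa [PowerSeries.constantCoeff_subst_X_pow hd.ne', map_zero] at this
  · rw [← map_pow, mul_pow, ← PowerSeries.subst_pow hs, hv, ← pow_mul, map_mul, map_mul,
      expand_ofPowerSeries, expand_single, ofPowerSeries_X_pow]
    rw [show ((m * e : ℕ) : ℤ) = d * n by rw [mul_comm m e, ← hnd]; push_cast; ring]

end LaurentSeries

/-! ### Homomorphisms from Galois extensions -/

section GaloisHom

variable {F N L : Type*} [Field F] [Field N] [Field L] [Algebra F N]

/-- Two homomorphisms from a Galois extension of `F` that agree on `F` differ by an element of the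
Galois group. -/
theorem exists_algEquiv_comp_eq [FiniteDimensional F N] [IsGalois F N] (φ ψ : N →+* L)
    (h : ∀ a : F, φ (algebraMap F N a) = ψ (algebraMap F N a)) :
    ∃ σ : N ≃ₐ[F] N, ∀ x, ψ x = φ (σ x) := by
  let : Algebra F L := (φ.comp (algebraMap F N)).toAlgebra
  let φ' : N →ₐ[F] L := { φ with commutes' := fun a => rfl }
  let ψ' : N →ₐ[F] L := { ψ with commutes' := fun a => (h a).symm }
  let e : N ≃ₐ[F] φ'.fieldRange := AlgEquiv.ofInjectiveField φ'
  have : Normal F φ'.fieldRange := Normal.of_algEquiv e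
  have hr : (ψ'.comp e.symm.toAlgHom).fieldRange = φ'.fieldRange := AlgHom.fieldRange_of_normal _
  have hmem : ∀ x, ψ' x ∈ φ'.fieldRange := fun x => by
    rw [← hr]
    exact ⟨e x, by simp⟩
  let θ : N →ₐ[F] N := e.symm.toAlgHom.comp (ψ'.codRestrict φ'.fieldRange.toSubalgebra hmem)
  refine ⟨AlgEquiv.ofBijective θ (Algebra.IsAlgebraic.algHom_bijective θ), fun x => ?_⟩
  have h1 : e (θ x) = ⟨ψ' x, hmem x⟩ := e.apply_symm_apply _
  exact (congrArg Subtype.val h1).symm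

/-- A homomorphism of the base field extends to an extension generated by a root of `P`, as soon as
the image of `P` splits. -/
theorem exists_ringHom_extending {y : N} (hy : IntermediateField.adjoin F {y} = ⊤)
    (E : F →+* L) {P : Polynomial F} (hP : P ≠ 0) (hPy : Polynomial.aeval y P = 0)
    (hs : (P.map E).Splits) : ∃ ψ : N →+* L, ∀ a, ψ (algebraMap F N a) = E a := by
  let : Algebra F L := E.toAlgebra
  have hint : IsIntegral F y := IsAlgebraic.isIntegral ⟨P, hP, hPy⟩
  have : Nonempty (N →ₐ[F] L) := by
    refine IntermediateField.nonempty_algHom_of_adjoin_splits (S := {y}) ?_ hy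
    rintro s rfl
    refine ⟨hint, hs.of_dvd (Polynomial.map_ne_zero hP) (Polynomial.map_dvd _ (minpoly.dvd F _ hPy))⟩
  obtain ⟨ψ⟩ := this
  exact ⟨ψ, ψ.commutes⟩

/-- A homomorphism of the base field extends to a Galois extension `N'` generated by the image of a
Galois extension `N`, as soon as its restriction extends to `N`. -/
theorem exists_ringHom_extending_of_generated {F' N' : Type*} [Field F'] [Field N'] [Algebra F' N']
    [FiniteDimensional F N] [IsGalois F N] (θ : F →+* F') (j : N →+* N')
    (hj : ∀ a, j (algebraMap F N a) = algebraMap F' N' (θ a))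
    (hgen : IntermediateField.adjoin F' (Set.range j) = ⊤) (E : F' →+* L) (φ : N →+* L)
    (hφ : ∀ a, φ (algebraMap F N a) = E (θ a)) :
    ∃ ψ : N' →+* L, ∀ a, ψ (algebraMap F' N' a) = E a := by
  obtain ⟨y, hy⟩ := Field.exists_primitive_element F N
  have hP : minpoly F y ≠ 0 := minpoly.ne_zero (Algebra.IsIntegral.isIntegral y)
  have hcomp : (algebraMap F' N').comp θ = j.comp (algebraMap F N) := RingHom.ext fun a => (hj a).symm
  have hcomp' : E.comp θ = φ.comp (algebraMap F N) := RingHom.ext fun a => (hφ a).symm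
  refine exists_ringHom_extending (y := j y) (P := (minpoly F y).map θ) ?_ E
    (Polynomial.map_ne_zero hP) ?_ ?_
  · rw [eq_top_iff, ← hgen, IntermediateField.adjoin_le_iff]
    rintro _ ⟨x, rfl⟩
    have hx : x ∈ IntermediateField.adjoin F {y} := hy ▸ IntermediateField.mem_top
    induction hx using IntermediateField.adjoin_induction with
    | mem x hx => rw [Set.mem_singleton_iff.1 hx]; exact IntermediateField.mem_adjoin_simple_self _ _
    | algebraMap a => rw [hj]; exact IntermediateField.algebraMap_mem _ _
    | add x y _ _ hx hy => rw [map_add]; exact add_mem hx hy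
    | inv x _ hx => rw [map_inv₀]; exact inv_mem hx
    | mul x y _ _ hx hy => rw [map_mul]; exact mul_mem hx hy
  · rw [Polynomial.aeval_def, Polynomial.eval₂_map, hcomp, ← Polynomial.hom_eval₂,
      ← Polynomial.aeval_def, minpoly.aeval, map_zero]
  · rw [Polynomial.map_map, hcomp', ← Polynomial.map_map]
    exact (Normal.splits inferInstance y).map φ

end GaloisHom

/-! ### Base change of a Galois extension -/

section BaseChange

variable {F N F' Ω : Type*} [Field F] [Field N] [Field F'] [Field Ω] [Algebra F N]
  [Algebra F' Ω]

/-- Base change along `θ : F → F'` of a Galois extension `N / F` that meets `F'` only in `F`: the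
compositum in an algebraically closed field has the same Galois group. -/
theorem exists_compositum [FiniteDimensional F N] [IsGalois F N] [IsAlgClosed Ω] [CharZero F']
    (θ : F →+* F') (ι : N →+* Ω) (hι : ∀ a, ι (algebraMap F N a) = algebraMap F' Ω (θ a))
    (hdisj : ∀ y, ι y ∈ (algebraMap F' Ω).range → y ∈ (algebraMap F N).range) :
    ∃ (N' : IntermediateField F' Ω) (j : N →+* N') (r : (N' ≃ₐ[F'] N') ≃* (N ≃ₐ[F] N)),
      FiniteDimensional F' N' ∧ IsGalois F' N' ∧ (∀ y, (j y : Ω) = ι y) ∧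
      IntermediateField.adjoin F' (Set.range j) = ⊤ ∧
      ∀ σ y, j (r σ y) = σ (j y) := by
  obtain ⟨y, hy⟩ := Field.exists_primitive_element F N
  have hcomp : (algebraMap F' Ω).comp θ = ι.comp (algebraMap F N) := RingHom.ext fun a => (hι a).symm
  set P : Polynomial F' := (minpoly F y).map θ with hPdef
  have hP : P ≠ 0 := Polynomial.map_ne_zero (minpoly.ne_zero (Algebra.IsIntegral.isIntegral y))
  have hsplit : (P.map (algebraMap F' Ω)).Splits := IsAlgClosed.splits _
  have hPy : Polynomial.aeval (ι y) P = 0 := by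
    rw [Polynomial.aeval_def, hPdef, Polynomial.eval₂_map, hcomp, ← Polynomial.hom_eval₂,
      ← Polynomial.aeval_def, minpoly.aeval, map_zero]
  let N' : IntermediateField F' Ω := IntermediateField.adjoin F' (P.rootSet Ω)
  have hsf : Polynomial.IsSplittingField F' N' P :=
    IntermediateField.adjoin_rootSet_isSplittingField hsplit
  have : FiniteDimensional F' N' := Polynomial.IsSplittingField.finiteDimensional N' P
  have : Normal F' N' := Normal.of_isSplittingField P
  have : IsGalois F' N' := ⟨⟩
  have hmem : ∀ x, ι x ∈ N' := by
    intro x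
    have hx : x ∈ IntermediateField.adjoin F {y} := hy ▸ IntermediateField.mem_top
    induction hx using IntermediateField.adjoin_induction with
    | mem x hx =>
      rw [Set.mem_singleton_iff.1 hx]
      exact IntermediateField.subset_adjoin _ _ (Polynomial.mem_rootSet.2 ⟨hP, hPy⟩)
    | algebraMap a => rw [hι]; exact IntermediateField.algebraMap_mem _ _
    | add x y _ _ hx hy => rw [map_add]; exact add_mem hx hy
    | inv x _ hx => rw [map_inv₀]; exact inv_mem hx
    | mul x y _ _ hx hy => rw [map_mul]; exact mul_mem hx hy
  let j : N →+* N' := ι.codRestrict N'.toSubfield hmem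
  have hjι : ∀ x, (j x : Ω) = ι x := fun x => rfl
  have hj : ∀ a, j (algebraMap F N a) = algebraMap F' N' (θ a) := fun a =>
    Subtype.ext (hι a)
  -- the roots of `P` are the images of the conjugates of `y`
  have hroot : ∀ z ∈ P.rootSet Ω, ∃ x, ι x = z := by
    intro z hz
    have hsp : ((minpoly F y).map (algebraMap F N)).Splits := Normal.splits inferInstance y
    have h1 : P.map (algebraMap F' Ω) = ((minpoly F y).map (algebraMap F N)).map ι := by
      rw [hPdef, Polynomial.map_map, Polynomial.map_map, hcomp]
    have hz' : z ∈ (P.map (algebraMap F' Ω)).roots := by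
      rw [Polynomial.mem_roots (Polynomial.map_ne_zero hP), Polynomial.IsRoot.def,
        Polynomial.eval_map_algebraMap]
      exact (Polynomial.mem_rootSet.1 hz).2
    rw [h1, hsp.roots_map, Multiset.mem_map] at hz'
    obtain ⟨x, -, hx⟩ := hz'
    exact ⟨x, hx⟩
  have hgen : IntermediateField.adjoin F' (Set.range j) = ⊤ := by
    rw [eq_top_iff]
    rintro ⟨z, hz⟩ -
    have key : ∀ z (hz : z ∈ N'), (⟨z, hz⟩ : N') ∈ IntermediateField.adjoin F' (Set.range j) := by
      intro z hz
      induction hz using IntermediateField.adjoin_induction with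
      | mem x hx =>
        obtain ⟨x', rfl⟩ := hroot x hx
        exact IntermediateField.subset_adjoin _ _ ⟨x', rfl⟩
      | algebraMap a => exact IntermediateField.algebraMap_mem _ a
      | add x y hx' hy' hx hy => exact add_mem hx hy
      | inv x hx' hx => exact inv_mem hx
      | mul x y hx' hy' hx hy => exact mul_mem hx hy
    exact key z hz
  have hres : ∀ σ : N' ≃ₐ[F'] N', ∃ τ : N ≃ₐ[F] N, ∀ x, σ (j x) = j (τ x) := fun σ =>
    exists_algEquiv_comp_eq j ((σ : N' →+* N').comp j) fun a => by
      simp [hj]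
  choose τ hτ using hres
  let R : (N' ≃ₐ[F'] N') →* (N ≃ₐ[F] N) :=
    { toFun := τ
      map_one' := AlgEquiv.ext fun x => j.injective (by rw [← hτ]; rfl)
      map_mul' := fun σ σ' => AlgEquiv.ext fun x => j.injective (by
        rw [← hτ, AlgEquiv.mul_apply, AlgEquiv.mul_apply, hτ σ', hτ σ]) }
  have hinj : Function.Injective R := by
    rw [injective_iff_map_eq_one]
    intro σ hσ
    have h1 : ∀ x, σ (j x) = j x := fun x => by
      rw [hτ, show τ σ = 1 from hσ]; rfl
    refine AlgEquiv.ext fun z => ?_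
    have hz : z ∈ IntermediateField.adjoin F' (Set.range j) := hgen ▸ IntermediateField.mem_top
    induction hz using IntermediateField.adjoin_induction with
    | mem x hx => obtain ⟨x', rfl⟩ := hx; exact h1 x'
    | algebraMap a => exact σ.commutes a
    | add x y hx' hy' hx hy => rw [map_add, hx, hy]; rfl
    | inv x hx' hx => rw [map_inv₀, hx]; rfl
    | mul x y hx' hy' hx hy => rw [map_mul, hx, hy]; rfl
  have hsurj : Function.Surjective R := by
    rw [← MonoidHom.range_eq_top]
    have hfix : IntermediateField.fixedField R.range = ⊥ := by
      rw [eq_bot_iff]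
      intro x hx
      refine IntermediateField.mem_bot.2 (hdisj x ?_)
      have hx' : j x ∈ (⊥ : IntermediateField F' N') := by
        rw [IsGalois.mem_bot_iff_fixed]
        intro σ
        rw [hτ]
        congr 1
        exact hx ⟨R σ, σ, rfl⟩
      obtain ⟨a, ha⟩ := IntermediateField.mem_bot.1 hx'
      exact ⟨a, by rw [← hjι, ← ha]; rfl⟩
    have h2 := IntermediateField.fixingSubgroup_fixedField R.range
    rw [hfix, IntermediateField.fixingSubgroup_bot] at h2
    exact h2.symm
  exact ⟨N', j, MulEquiv.ofBijective R ⟨hinj, hsurj⟩, inferInstance, inferInstance, hjι, hgen,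
    fun σ x => (hτ σ x).symm⟩

/-- If `N / F` stays disjoint from the extension of `F'` by all elements algebraic over `K`, then
the compositum has no new elements algebraic over `K`. -/
theorem algebraicClosure_le_of_compositum {K : Type*} [Field K] [Algebra K F'] [Algebra K Ω]
    [IsScalarTower K F' Ω] [FiniteDimensional F N]
    [IsGalois F N] (ι : N →+* Ω) (N' : IntermediateField F' Ω) [FiniteDimensional F' N']
    [IsGalois F' N'] (j : N →+* N') (r : (N' ≃ₐ[F'] N') ≃* (N ≃ₐ[F] N))
    (hjι : ∀ y, (j y : Ω) = ι y) (hr : ∀ σ y, j (r σ y) = σ (j y))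
    (hdisj : ∀ y, ι y ∈ IntermediateField.adjoin F' {α : Ω | IsAlgebraic K α} →
      y ∈ (algebraMap F N).range)
    (α : N') (hα : IsAlgebraic K α) : α ∈ (algebraMap F' N').range := by
  set H := (IntermediateField.adjoin F' {α}).fixingSubgroup with hH
  have hfix : IntermediateField.fixedField (H.map r.toMonoidHom) = ⊥ := by
    rw [eq_bot_iff]
    intro x hx
    refine IntermediateField.mem_bot.2 (hdisj x ?_)
    have hx' : j x ∈ IntermediateField.fixedField H := by
      rintro ⟨σ, hσ⟩
      change σ (j x) = j x
      rw [← hr]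
      congr 1
      exact hx ⟨r σ, σ, hσ, rfl⟩
    rw [hH, IsGalois.fixedField_fixingSubgroup] at hx'
    rw [← hjι]
    have key : ∀ z : N', z ∈ IntermediateField.adjoin F' {α} →
        (z : Ω) ∈ IntermediateField.adjoin F' {α : Ω | IsAlgebraic K α} := by
      intro z hz
      induction hz using IntermediateField.adjoin_induction with
      | mem x hx =>
        rw [Set.mem_singleton_iff.1 hx]
        refine IntermediateField.subset_adjoin _ _ ?_
        have : IsScalarTower K N' Ω := .of_algebraMap_eq fun _ => rfl
        exact hα.algebraMap (A := Ω)
      | algebraMap a => exact IntermediateField.algebraMap_mem _ a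
      | add x y hx' hy' hx hy => exact add_mem hx hy
      | inv x hx' hx => exact inv_mem hx
      | mul x y hx' hy' hx hy => exact mul_mem hx hy
    exact key _ hx'
  have h2 := IntermediateField.fixingSubgroup_fixedField (H.map r.toMonoidHom)
  rw [hfix, IntermediateField.fixingSubgroup_bot] at h2
  have h3 : H = ⊤ := by
    rw [eq_top_iff]
    intro σ _
    have : r σ ∈ H.map r.toMonoidHom := h2 ▸ Subgroup.mem_top _
    obtain ⟨σ', h, hσ'⟩ := this
    rwa [← r.injective hσ']
  have h4 : α ∈ (⊥ : IntermediateField F' N') := by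
    rw [IsGalois.mem_bot_iff_fixed]
    intro σ
    have : σ ∈ H := h3 ▸ Subgroup.mem_top _
    exact this ⟨α, IntermediateField.mem_adjoin_simple_self _ _⟩
  obtain ⟨a, ha⟩ := IntermediateField.mem_bot.1 h4
  exact ⟨a, ha⟩

end BaseChange

/-! ### Homomorphisms from rational function fields -/

section RatFuncHom

variable {K L : Type*} [Field K] [Field L]

theorem RatFunc.ringHom_ext_of_C_of_X {f g : RatFunc K →+* L}
    (hC : ∀ c, f (RatFunc.C c) = g (RatFunc.C c)) (hX : f RatFunc.X = g RatFunc.X) : f = g := by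
  refine IsLocalization.ringHom_ext (nonZeroDivisors (Polynomial K)) ?_
  refine Polynomial.ringHom_ext (fun c => ?_) ?_
  · simpa using hC c
  · simpa using hX

theorem RatFunc.exists_ringHom (σ : K →+* L) (θ : L)
    (hθ : ∀ p : Polynomial K, p.eval₂ σ θ = 0 → p = 0) :
    ∃ E : RatFunc K →+* L, (∀ c, E (RatFunc.C c) = σ c) ∧ E RatFunc.X = θ := by
  have h : nonZeroDivisors (Polynomial K) ≤
      (nonZeroDivisors L).comap (Polynomial.eval₂RingHom σ θ) := by
    intro p hp
    rw [Submonoid.mem_comap, mem_nonZeroDivisors_iff_ne_zero]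
    exact fun h0 => nonZeroDivisors.ne_zero hp (hθ p h0)
  exact ⟨RatFunc.liftRingHom _ h, fun c => by simp [RatFunc.liftRingHom_C],
    by simp [RatFunc.liftRingHom_X]⟩

/-- A nonconstant Laurent series can be substituted for the variable of a rational function. -/
theorem RatFunc.exists_ringHom_laurentSeries (σ : K →+* L) {θ : LaurentSeries L}
    (hθ : θ ∉ (HahnSeries.C : L →+* LaurentSeries L).range) :
    ∃ E : RatFunc K →+* LaurentSeries L,
      (∀ c, E (RatFunc.C c) = HahnSeries.C (σ c)) ∧ E RatFunc.X = θ := by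
  refine RatFunc.exists_ringHom (HahnSeries.C.comp σ) θ fun p hp => ?_
  by_contra hne
  refine hθ (LaurentSeries.mem_range_C_of_isAlgebraic
    ⟨p.map σ, Polynomial.map_ne_zero hne, ?_⟩)
  rw [Polynomial.aeval_def, Polynomial.eval₂_map, ← hp]
  congr 1
  ext a : 1
  simp [LaurentSeries.algebraMap_eq_C]

end RatFuncHom

/-! ### Puiseux embeddings, ramification indices and inertia classes -/

namespace RegularGExtension

variable {K : Type u} [Field K] {G : Type v} [Group G]

theorem puiseuxParameter_coe (a : AlgebraicClosure K) (e : ℕ) :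
    puiseuxParameter (K := K) (a : OnePoint (AlgebraicClosure K)) e =
      HahnSeries.C a + HahnSeries.single (e : ℤ) 1 := rfl

theorem puiseuxParameter_infty (e : ℕ) :
    puiseuxParameter (K := K) OnePoint.infty e = HahnSeries.single (-(e : ℤ)) 1 := rfl

theorem puiseuxParameter_notMem_range (p : OnePoint (AlgebraicClosure K)) {e : ℕ} (he : 0 < e) :
    puiseuxParameter p e ∉
      (HahnSeries.C : AlgebraicClosure K →+* LaurentSeries (AlgebraicClosure K)).range := by
  rintro ⟨c, hc⟩
  induction p using OnePoint.rec with
  | infty =>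
    have := congrArg (fun x => HahnSeries.coeff x (-(e : ℤ))) hc
    simp [puiseuxParameter_infty, he.ne'] at this
  | coe a =>
    have := congrArg (fun x => HahnSeries.coeff x (e : ℤ)) hc
    simp [puiseuxParameter_coe, he.ne'] at this

variable (N : RegularGExtension.{u, v, w} K G)

instance : FiniteDimensional (RatFunc K) N.carrier := N.finite

instance : IsGalois (RatFunc K) N.carrier := N.galois

theorem algebraMap_C (c : K) :
    algebraMap (RatFunc K) N.carrier (RatFunc.C c) = algebraMap K N.carrier c := by
  rw [← RatFunc.algebraMap_eq_C, ← IsScalarTower.algebraMap_apply]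

variable {N}

theorem ringHom_agree {L : Type*} [Field L] {φ ψ : N.carrier →+* L}
    (hK : ∀ c, φ (algebraMap K N.carrier c) = ψ (algebraMap K N.carrier c)) (ht : φ N.t = ψ N.t)
    (a : RatFunc K) :
    φ (algebraMap (RatFunc K) N.carrier a) = ψ (algebraMap (RatFunc K) N.carrier a) := by
  refine RingHom.congr_fun (f := φ.comp (algebraMap (RatFunc K) N.carrier))
    (g := ψ.comp (algebraMap (RatFunc K) N.carrier))
    (RatFunc.ringHom_ext_of_C_of_X (fun c => ?_) ht) a
  simpa [N.algebraMap_C] using hK c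

/-- Two homomorphisms that agree on the constants and on `t` differ by an element of `G`. -/
theorem exists_gal_comp_eq {L : Type*} [Field L] (φ ψ : N.carrier →+* L)
    (hK : ∀ c, φ (algebraMap K N.carrier c) = ψ (algebraMap K N.carrier c)) (ht : φ N.t = ψ N.t) :
    ∃ g : G, ∀ x, ψ x = φ (N.gal.symm g x) := by
  obtain ⟨σ, hσ⟩ := exists_algEquiv_comp_eq φ ψ (ringHom_agree hK ht)
  exact ⟨N.gal σ, by simpa using hσ⟩

theorem gal_symm_algebraMap (g : G) (c : K) :
    N.gal.symm g (algebraMap K N.carrier c) = algebraMap K N.carrier c := by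
  rw [← N.algebraMap_C]
  exact (N.gal.symm g).commutes _

theorem gal_symm_t (g : G) : N.gal.symm g N.t = N.t := (N.gal.symm g).commutes _

theorem gal_symm_mul_apply (g h : G) (x : N.carrier) :
    N.gal.symm (g * h) x = N.gal.symm g (N.gal.symm h x) := by
  rw [map_mul]; rfl

theorem gal_symm_one_apply (x : N.carrier) : N.gal.symm (1 : G) x = x := by
  rw [map_one]; rfl

namespace PuiseuxEmbedding

variable {p : OnePoint (AlgebraicClosure K)} {e : ℕ}

/-- The element `g` of the Galois group induces on `N`, along the embedding `φ` into Laurent series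
in `s`, the rotation `s ↦ z s`. -/
def Rotates (φ : N.PuiseuxEmbedding p e) (z : AlgebraicClosure K) (g : G) : Prop :=
  ∀ (x : N.carrier) (n : ℤ), (φ.1 (N.gal.symm g x)).coeff n = z ^ n * (φ.1 x).coeff n

theorem exists_gal (φ ψ : N.PuiseuxEmbedding p e) : ∃ g : G, ∀ x, ψ.1 x = φ.1 (N.gal.symm g x) :=
  exists_gal_comp_eq φ.1 ψ.1 (fun c => by rw [φ.2.1, ψ.2.1]) (by rw [φ.2.2, ψ.2.2])

/-- Composition of an embedding with an element of the Galois group. -/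
noncomputable def compGal (φ : N.PuiseuxEmbedding p e) (g : G) : N.PuiseuxEmbedding p e :=
  ⟨φ.1.comp (N.gal.symm g : N.carrier →+* N.carrier), fun c => by
    simp only [RingHom.comp_apply, RingHom.coe_coe, gal_symm_algebraMap, φ.2.1], by
    simp only [RingHom.comp_apply, RingHom.coe_coe, gal_symm_t, φ.2.2]⟩

theorem compGal_apply (φ : N.PuiseuxEmbedding p e) (g : G) (x : N.carrier) :
    (φ.compGal g).1 x = φ.1 (N.gal.symm g x) := rfl

theorem twist_puiseuxParameter (z : (AlgebraicClosure K)ˣ) (hz : z ^ e = 1) :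
    LaurentSeries.twist (RingHom.id _) z (puiseuxParameter p e) = puiseuxParameter p e := by
  have hz' : (z : AlgebraicClosure K) ^ e = 1 := by simpa using congrArg Units.val hz
  induction p using OnePoint.rec with
  | infty => simp [puiseuxParameter_infty, LaurentSeries.twist_single, hz']
  | coe a => simp [puiseuxParameter_coe, LaurentSeries.twist_single, hz']

theorem exists_rotates (φ : N.PuiseuxEmbedding p e) (he : 0 < e) {z : AlgebraicClosure K}
    (hz : z ^ e = 1) : ∃ g : G, φ.Rotates z g := by
  have hz0 : z ≠ 0 := by rintro rfl; simp [he.ne'] at hz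
  let ψ : N.PuiseuxEmbedding p e :=
    ⟨(LaurentSeries.twist (RingHom.id _) (Units.mk0 z hz0)).comp φ.1,
      fun c => by rw [RingHom.comp_apply, φ.2.1, LaurentSeries.twist_C, RingHom.id_apply], by
      rw [RingHom.comp_apply, φ.2.2, twist_puiseuxParameter]
      ext; simpa using hz⟩
  obtain ⟨g, hg⟩ := φ.exists_gal ψ
  refine ⟨g, fun x n => ?_⟩
  rw [← hg]
  simp [ψ]

theorem Rotates.pow {φ : N.PuiseuxEmbedding p e} {z : AlgebraicClosure K} {g : G}
    (h : φ.Rotates z g) (k : ℕ) : φ.Rotates (z ^ k) (g ^ k) := by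
  induction k with
  | zero => intro x n; simp
  | succ k ih =>
    intro x n
    rw [pow_succ, gal_symm_mul_apply, ih, h, pow_succ, mul_zpow, mul_assoc]

theorem Rotates.eq {φ : N.PuiseuxEmbedding p e} {z : AlgebraicClosure K} {g h : G}
    (hg : φ.Rotates z g) (hh : φ.Rotates z h) : g = h := by
  apply N.gal.symm.injective
  refine AlgEquiv.ext fun x => φ.1.injective ?_
  ext n
  rw [hg, hh]

theorem Rotates.pow_eq_one {φ : N.PuiseuxEmbedding p e} {z : AlgebraicClosure K} {g : G}
    (h : φ.Rotates z g) {k : ℕ} (hz : z ^ k = 1) : g ^ k = 1 := by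
  refine (h.pow k).eq ?_
  intro x n
  simp [hz]

theorem Rotates.conj {φ : N.PuiseuxEmbedding p e} {z : AlgebraicClosure K} {g : G}
    (h : φ.Rotates z g) (c : G) : (φ.compGal c).Rotates z (c⁻¹ * g * c) := by
  intro x n
  rw [compGal_apply, compGal_apply, ← gal_symm_mul_apply, mul_assoc, mul_inv_cancel_left,
    gal_symm_mul_apply, h]

theorem expand_puiseuxParameter (m : ℕ) (hm : 0 < m) :
    LaurentSeries.expand m hm (puiseuxParameter p e) = puiseuxParameter p (m * e) := by
  induction p using OnePoint.rec with
  | infty =>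
    rw [puiseuxParameter_infty, puiseuxParameter_infty, LaurentSeries.expand_single]
    congr 2; push_cast; ring
  | coe a =>
    rw [puiseuxParameter_coe, puiseuxParameter_coe, map_add, LaurentSeries.expand_single,
      LaurentSeries.expand_C]
    push_cast; rfl

/-- The embedding with `m` times the index. -/
noncomputable def expand (φ : N.PuiseuxEmbedding p e) (m : ℕ) (hm : 0 < m) :
    N.PuiseuxEmbedding p (m * e) :=
  ⟨(LaurentSeries.expand m hm).comp φ.1, fun c => by
    rw [RingHom.comp_apply, φ.2.1, LaurentSeries.expand_C], by
    rw [RingHom.comp_apply, φ.2.2, expand_puiseuxParameter]⟩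

/-- An embedding all of whose exponents are divisible by `m` comes from one with a smaller index. -/
theorem reduce {m : ℕ} (hm : 0 < m) (φ : N.PuiseuxEmbedding p (m * e))
    (h : ∀ x n, (φ.1 x).coeff n ≠ 0 → (m : ℤ) ∣ n) : Nonempty (N.PuiseuxEmbedding p e) := by
  set E := LaurentSeries.expand (k := AlgebraicClosure K) m hm with hE
  have hmem : ∀ x, φ.1 x ∈ E.range := fun x => (LaurentSeries.mem_range_expand m hm _).2 (h x)
  let ι := RingEquiv.ofLeftInverse (f := E) (Function.leftInverse_invFun E.injective)
  have hι : ∀ y : E.range, E (ι.symm y) = y := fun y => by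
    have := ι.apply_symm_apply y
    exact congrArg Subtype.val this
  refine ⟨⟨(ι.symm : E.range →+* _).comp (φ.1.codRestrict E.range hmem), fun c => ?_, ?_⟩⟩
  · apply E.injective
    exact (hι _).trans ((φ.2.1 c).trans (LaurentSeries.expand_C m hm _).symm)
  · apply E.injective
    exact (hι _).trans (φ.2.2.trans (expand_puiseuxParameter m hm).symm)

/-- The indices of embeddings are closed under greatest common divisors: after a common extension
of the parameter two embeddings have the same image. -/
theorem gcd {a b : ℕ} (ha : 0 < a) (hb : 0 < b) (φ : N.PuiseuxEmbedding p a)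
    (ψ : N.PuiseuxEmbedding p b) : Nonempty (N.PuiseuxEmbedding p (a.gcd b)) := by
  have hd : 0 < a.gcd b := Nat.gcd_pos_of_pos_left _ ha
  obtain ⟨a', ha'⟩ := Nat.gcd_dvd_left a b
  obtain ⟨b', hb'⟩ := Nat.gcd_dvd_right a b
  have hcop : Nat.Coprime a' b' := by
    have h1 := Nat.coprime_div_gcd_div_gcd hd
    rwa [Nat.div_eq_of_eq_mul_right hd ha', Nat.div_eq_of_eq_mul_right hd hb'] at h1
  set d := a.gcd b with hdd
  have ha0 : 0 < a' := Nat.pos_of_ne_zero fun h => by simp [h] at ha'; omega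
  have hb0 : 0 < b' := Nat.pos_of_ne_zero fun h => by simp [h] at hb'; omega
  have e1 : b' * a = a' * b' * d := by rw [ha']; ring
  have e2 : a' * b = a' * b' * d := by rw [hb']; ring
  obtain ⟨χ, hχ⟩ : ∃ χ : N.PuiseuxEmbedding p (a' * b' * d),
      ∀ x n, (χ.1 x).coeff n ≠ 0 → (b' : ℤ) ∣ n := by
    rw [← e1]
    refine ⟨φ.expand b' hb0, fun x n hn => ?_⟩
    by_contra h0
    exact hn (LaurentSeries.expand_coeff_of_not_dvd b' hb0 _ _ h0)
  obtain ⟨χ', hχ'⟩ : ∃ χ : N.PuiseuxEmbedding p (a' * b' * d),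
      ∀ x n, (χ.1 x).coeff n ≠ 0 → (a' : ℤ) ∣ n := by
    rw [← e2]
    refine ⟨ψ.expand a' ha0, fun x n hn => ?_⟩
    by_contra h0
    exact hn (LaurentSeries.expand_coeff_of_not_dvd a' ha0 _ _ h0)
  obtain ⟨g, hg⟩ := χ'.exists_gal χ
  refine reduce (Nat.mul_pos ha0 hb0) χ fun x n hn => ?_
  push_cast
  refine IsCoprime.mul_dvd (Nat.isCoprime_iff_coprime.2 hcop) ?_ (hχ x n hn)
  rw [hg] at hn
  exact hχ' _ n hn

/-- If `g` induces the rotation by a primitive `e`-th root of unity, the index can be reduced to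
the order of `g`. -/
theorem Rotates.nonempty_orderOf {φ : N.PuiseuxEmbedding p e} (he : 0 < e)
    {z : AlgebraicClosure K} (hz : IsPrimitiveRoot z e) {g : G} (h : φ.Rotates z g) :
    0 < orderOf g ∧ orderOf g ∣ e ∧ Nonempty (N.PuiseuxEmbedding p (orderOf g)) := by
  have h1 : orderOf g ∣ e := orderOf_dvd_of_pow_eq_one (h.pow_eq_one hz.pow_eq_one)
  have h0 : 0 < orderOf g := Nat.pos_of_dvd_of_pos h1 he
  refine ⟨h0, h1, ?_⟩
  obtain ⟨m, hm⟩ := h1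
  have hm0 : 0 < m := Nat.pos_of_ne_zero fun h => by simp [h] at hm; omega
  obtain ⟨χ, hχ⟩ : ∃ χ : N.PuiseuxEmbedding p (m * orderOf g),
      ∀ x n, (χ.1 x).coeff n ≠ 0 → (m : ℤ) ∣ n := by
    rw [mul_comm, ← hm]
    refine ⟨φ, fun x n hn => ?_⟩
    have h2 := h.pow (orderOf g) x n
    rw [pow_orderOf_eq_one, gal_symm_one_apply] at h2
    have h3 : (z ^ orderOf g) ^ n = 1 := by
      have : ((z ^ orderOf g) ^ n - 1) * (φ.1 x).coeff n = 0 := by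
        rw [sub_mul, one_mul, ← h2, sub_self]
      exact sub_eq_zero.1 ((mul_eq_zero.1 this).resolve_right hn)
    rw [← zpow_natCast, ← zpow_mul, hz.zpow_eq_one_iff_dvd, hm] at h3
    push_cast at h3
    exact Int.dvd_of_mul_dvd_mul_left (by exact_mod_cast h0.ne') h3
  exact reduce hm0 χ hχ

end PuiseuxEmbedding

variable (N) in
theorem ramificationIndex_spec (p : OnePoint (AlgebraicClosure K)) {e : ℕ} (he : 0 < e)
    (φ : N.PuiseuxEmbedding p e) : 0 < N.ramificationIndex p ∧
      Nonempty (N.PuiseuxEmbedding p (N.ramificationIndex p)) ∧ N.ramificationIndex p ∣ e := by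
  have hne : {e : ℕ | 0 < e ∧ Nonempty (N.PuiseuxEmbedding p e)}.Nonempty := ⟨e, he, ⟨φ⟩⟩
  obtain ⟨h1, h2⟩ := Nat.sInf_mem hne
  refine ⟨h1, h2, ?_⟩
  obtain ⟨ψ⟩ := h2
  have h3 : N.ramificationIndex p ≤ (N.ramificationIndex p).gcd e :=
    Nat.sInf_le ⟨Nat.gcd_pos_of_pos_right _ he, PuiseuxEmbedding.gcd h1 he ψ φ⟩
  have h4 := Nat.gcd_dvd_left (N.ramificationIndex p) e
  have h5 : (N.ramificationIndex p).gcd e = N.ramificationIndex p :=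
    le_antisymm (Nat.le_of_dvd h1 h4) h3
  have h6 := Nat.gcd_dvd_right (N.ramificationIndex p) e
  rwa [h5] at h6

theorem ramificationIndex_eq_one {p : OnePoint (AlgebraicClosure K)}
    (φ : N.PuiseuxEmbedding p 1) : N.ramificationIndex p = 1 :=
  Nat.dvd_one.1 (N.ramificationIndex_spec p one_pos φ).2.2

/-- For `e = 0` the parameter is a constant. Hence the ramification index has its junk value `0` only
if there is no Puiseux embedding at all. -/
theorem not_puiseuxEmbedding_zero (p : OnePoint (AlgebraicClosure K)) :
    IsEmpty (N.PuiseuxEmbedding p 0) := by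
  refine ⟨fun φ => ?_⟩
  obtain ⟨c, hc⟩ : ∃ c : AlgebraicClosure K, puiseuxParameter p 0 = HahnSeries.C c := by
    induction p using OnePoint.rec with
    | infty => exact ⟨1, by simp [puiseuxParameter_infty]⟩
    | coe a => exact ⟨a + 1, by simp [puiseuxParameter_coe]⟩
  obtain ⟨P, hP, hPc⟩ : IsAlgebraic K c := Algebra.IsAlgebraic.isAlgebraic c
  have h1 : φ.1 (algebraMap (RatFunc K) N.carrier (algebraMap (Polynomial K) (RatFunc K) P)) = 0 := by
    have h2 : ((φ.1.comp (algebraMap (RatFunc K) N.carrier)).comp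
        (algebraMap (Polynomial K) (RatFunc K))) =
        HahnSeries.C.comp (Polynomial.aeval c : Polynomial K →ₐ[K] AlgebraicClosure K).toRingHom := by
      refine Polynomial.ringHom_ext (fun a => ?_) ?_
      · simp [N.algebraMap_C, φ.2.1]
      · have := φ.2.2.trans hc
        simpa [t] using this
    have h3 := RingHom.congr_fun h2 P
    simp only [RingHom.comp_apply] at h3
    rw [h3]
    simp [hPc]
  rw [map_eq_zero, map_eq_zero] at h1
  exact hP (RatFunc.algebraMap_injective K (by rw [h1, map_zero]))

/-- The elements of the inertia class at `p` have order the ramification index. -/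
theorem orderOf_of_mem_inertiaClass {ζ : ℕ → AlgebraicClosure K}
    (hζ : ∀ n : ℕ, 0 < n → IsPrimitiveRoot (ζ n) n) {p : OnePoint (AlgebraicClosure K)} {g : G}
    (hg : g ∈ N.inertiaClass ζ p) : 0 < N.ramificationIndex p ∧ orderOf g = N.ramificationIndex p := by
  obtain ⟨φ, hφ⟩ := hg
  have h0 : 0 < N.ramificationIndex p := by
    refine Nat.pos_of_ne_zero fun h0 => ?_
    rw [h0] at φ
    exact (not_puiseuxEmbedding_zero p).false φ
  have hrot : φ.Rotates (ζ (N.ramificationIndex p)) g := hφ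
  obtain ⟨h1, h2, h3⟩ := hrot.nonempty_orderOf h0 (hζ _ h0)
  exact ⟨h0, le_antisymm (Nat.le_of_dvd h0 h2) (Nat.sInf_le ⟨h1, h3⟩)⟩

/-- If all points have embeddings and only finitely many are branch points, then the inertia
classes form a ramification type. -/
theorem exists_hasRamificationType {ζ : ℕ → AlgebraicClosure K}
    (hζ : ∀ n : ℕ, 0 < n → IsPrimitiveRoot (ζ n) n) (hfin : N.branchPoints.Finite) {m : ℕ}
    (h : ∀ p, ∃ e, 0 < e ∧ e ∣ m ∧ Nonempty (N.PuiseuxEmbedding p e)) :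
    ∃ (s : ℕ) (C : Fin s → ConjClasses G), N.HasRamificationType ζ C ∧
      ∀ i, ∀ x ∈ (C i).carrier, orderOf x ∣ m := by
  have hidx : ∀ p, 0 < N.ramificationIndex p ∧
      Nonempty (N.PuiseuxEmbedding p (N.ramificationIndex p)) ∧ N.ramificationIndex p ∣ m := by
    intro p
    obtain ⟨e, he, hem, ⟨φ⟩⟩ := h p
    obtain ⟨h1, h2, h3⟩ := N.ramificationIndex_spec p he φ
    exact ⟨h1, h2, h3.trans hem⟩
  have hclass : ∀ p, ∃ C : ConjClasses G, C.carrier = N.inertiaClass ζ p := by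
    intro p
    obtain ⟨h0, ⟨φ⟩, -⟩ := hidx p
    obtain ⟨g, hg⟩ := φ.exists_rotates h0 (hζ _ h0).pow_eq_one
    refine ⟨ConjClasses.mk g, ?_⟩
    ext x
    rw [ConjClasses.mem_carrier_iff_mk_eq, ConjClasses.mk_eq_mk_iff_isConj, isConj_comm,
      isConj_iff]
    constructor
    · rintro ⟨c, rfl⟩
      refine ⟨φ.compGal c⁻¹, ?_⟩
      have := hg.conj c⁻¹
      rwa [inv_inv] at this
    · rintro ⟨ψ, hψ⟩
      obtain ⟨c, hc⟩ := φ.exists_gal ψ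
      refine ⟨c⁻¹, ?_⟩
      have h1 := hg.conj c
      rw [inv_inv]
      have h2 : (φ.compGal c) = ψ := Subtype.ext (RingHom.ext fun y => (hc y).symm)
      rw [h2] at h1
      exact h1.eq hψ
  choose C hC using hclass
  refine ⟨hfin.toFinset.card, fun i => C (hfin.toFinset.equivFin.symm i),
    ⟨fun i => hfin.toFinset.equivFin.symm i, ?_, ?_, fun i => hC _⟩, fun i x hx => ?_⟩
  · exact Subtype.val_injective.comp (Equiv.injective _)
  · ext p
    constructor
    · rintro ⟨i, rfl⟩
      exact hfin.mem_toFinset.1 (hfin.toFinset.equivFin.symm i).2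
    · intro hp
      exact ⟨hfin.toFinset.equivFin ⟨p, hfin.mem_toFinset.2 hp⟩, by simp⟩
  · rw [hC] at hx
    rw [(orderOf_of_mem_inertiaClass hζ hx).2]
    exact (hidx _).2.2

end RegularGExtension

/-! ### Local expansions of rational functions -/

section LocalExpansion

variable {K : Type u} [Field K]

open RegularGExtension

/-- The expansion of rational functions at a point `s₀`, as Laurent series in the local parameter
`s - s₀` (or `1 / s` at infinity). -/
noncomputable def localExpansion (s₀ : OnePoint (AlgebraicClosure K)) :
    RatFunc K →+* LaurentSeries (AlgebraicClosure K) :=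
  (RatFunc.exists_ringHom_laurentSeries (algebraMap K (AlgebraicClosure K))
    (puiseuxParameter_notMem_range s₀ one_pos)).choose

@[simp]
theorem localExpansion_C (s₀ : OnePoint (AlgebraicClosure K)) (c : K) :
    localExpansion s₀ (RatFunc.C c) = HahnSeries.C (algebraMap K (AlgebraicClosure K) c) :=
  (RatFunc.exists_ringHom_laurentSeries (algebraMap K (AlgebraicClosure K))
    (puiseuxParameter_notMem_range s₀ one_pos)).choose_spec.1 c

theorem localExpansion_X (s₀ : OnePoint (AlgebraicClosure K)) :
    localExpansion s₀ RatFunc.X = puiseuxParameter s₀ 1 :=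
  (RatFunc.exists_ringHom_laurentSeries (algebraMap K (AlgebraicClosure K))
    (puiseuxParameter_notMem_range s₀ one_pos)).choose_spec.2

/-- The local parameter of the projective line at `p`, evaluated at the Laurent series `F`. -/
noncomputable def localParameterAt (p : OnePoint (AlgebraicClosure K))
    (F : LaurentSeries (AlgebraicClosure K)) : LaurentSeries (AlgebraicClosure K) :=
  p.elim F⁻¹ fun a => F - HahnSeries.C a

/-- The rational function `f` takes the value `p` at `s₀` with multiplicity `n`. -/
def HasMultiplicity (f : RatFunc K) (s₀ p : OnePoint (AlgebraicClosure K)) (n : ℕ) : Prop :=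
  ∃ q : PowerSeries (AlgebraicClosure K), PowerSeries.constantCoeff q ≠ 0 ∧
    localParameterAt p (localExpansion s₀ f) =
      HahnSeries.single (n : ℤ) 1 * HahnSeries.ofPowerSeries ℤ _ q

theorem localExpansion_notMem_range {f : RatFunc K} (hf : ¬ ∃ c, f = RatFunc.C c)
    (s₀ : OnePoint (AlgebraicClosure K)) : localExpansion s₀ f ∉
      (HahnSeries.C : AlgebraicClosure K →+* LaurentSeries (AlgebraicClosure K)).range := by
  rintro ⟨c, hc⟩
  obtain ⟨P, hP, hPc⟩ : IsAlgebraic K c := Algebra.IsAlgebraic.isAlgebraic c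
  refine RatFunc.transcendental_of_ne_C _ hf ⟨P, hP, (localExpansion s₀).injective ?_⟩
  have h1 : (localExpansion s₀).comp (algebraMap K (RatFunc K)) =
      HahnSeries.C.comp (algebraMap K (AlgebraicClosure K)) := by
    ext a : 1
    simp [RatFunc.algebraMap_eq_C]
  rw [map_zero, Polynomial.aeval_def, Polynomial.hom_eval₂, h1, ← hc, ← Polynomial.hom_eval₂,
    ← Polynomial.aeval_def, hPc, map_zero]

theorem exists_hasMultiplicity {f : RatFunc K} (hf : ¬ ∃ c, f = RatFunc.C c)
    (s₀ : OnePoint (AlgebraicClosure K)) : ∃ p n, 0 < n ∧ HasMultiplicity f s₀ p n := by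
  have hne := localExpansion_notMem_range hf s₀
  set F := localExpansion s₀ f with hF
  have hF0 : F ≠ 0 := fun h => hne ⟨0, by rw [map_zero, h]⟩
  obtain ⟨n, q, hq, hFq⟩ := LaurentSeries.exists_eq_single_mul hF0
  rcases lt_or_ge n 0 with hn | hn
  · obtain ⟨m, rfl⟩ : ∃ m : ℕ, n = -(m : ℤ) := ⟨n.natAbs, by omega⟩
    refine ⟨OnePoint.infty, m, by omega, q⁻¹, by simpa using hq, ?_⟩
    change F⁻¹ = _
    rw [hFq, mul_inv, LaurentSeries.ofPowerSeries_inv hq, ← LaurentSeries.single_one_zpow (-(m : ℤ)),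
      ← zpow_neg, neg_neg, LaurentSeries.single_one_zpow]
  · obtain ⟨m, rfl⟩ := Int.eq_ofNat_of_zero_le hn
    have hF2 : F = HahnSeries.ofPowerSeries ℤ _ (PowerSeries.X ^ m * q) := by
      rw [map_mul, LaurentSeries.ofPowerSeries_X_pow]
      exact hFq
    set a := PowerSeries.constantCoeff (PowerSeries.X ^ m * q) with ha
    have hne2 : F - HahnSeries.C a ≠ 0 := fun h => hne ⟨a, (sub_eq_zero.1 h).symm⟩
    have hF3 : F - HahnSeries.C a =
        HahnSeries.ofPowerSeries ℤ _ (PowerSeries.X ^ m * q - PowerSeries.C a) := by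
      rw [map_sub, ← hF2]; congr 1; exact (HahnSeries.ofPowerSeries_C a).symm
    obtain ⟨n', q', hq', hFq'⟩ := LaurentSeries.exists_eq_single_mul hne2
    have h0 : ∀ i : ℤ, i ≤ 0 → (F - HahnSeries.C a).coeff i = 0 := by
      intro i hi
      rw [hF3, PowerSeries.coeff_coe]
      split_ifs with h
      · rfl
      · obtain rfl : i = 0 := by omega
        simp [ha]
    have hn' : 0 < n' := by
      by_contra hcon
      have h1 := h0 n' (not_lt.1 hcon)
      rw [hFq', HahnSeries.coeff_single_mul, sub_self, PowerSeries.coeff_coe] at h1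
      simp at h1
      exact hq' h1
    obtain ⟨m', rfl⟩ := Int.eq_ofNat_of_zero_le hn'.le
    refine ⟨(a : OnePoint _), m', by omega, q', hq', ?_⟩
    exact hFq'

/-- The substitution that turns the parameter of index `e` at `p` into `f`, seen with index `d` at
a point where `f` takes the value `p` with multiplicity `n`. -/
theorem HasMultiplicity.exists_subst [CharZero K] {f : RatFunc K}
    {s₀ p : OnePoint (AlgebraicClosure K)} {n d e m : ℕ} (h : HasMultiplicity f s₀ p n)
    (hm : 0 < m) (hd : 0 < d) (he : 0 < e) (hnd : n * d = e * m) :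
    ∃ (h v : PowerSeries (AlgebraicClosure K)) (h0 : PowerSeries.constantCoeff h = 0) (hne : h ≠ 0),
      LaurentSeries.subst h h0 hne (puiseuxParameter p e) =
        LaurentSeries.expand d hd (localExpansion s₀ f) ∧
      h = PowerSeries.X ^ m * v.subst (PowerSeries.X ^ d : PowerSeries (AlgebraicClosure K)) := by
  obtain ⟨q, hq, hfq⟩ := h
  obtain ⟨h, v, h0, hne, hpow, hv⟩ := LaurentSeries.exists_pow_eq_expand hm hd he hnd q hq
  refine ⟨h, v, h0, hne, ?_, hv⟩
  rw [← hfq] at hpow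
  have hX : ∀ i : ℤ, LaurentSeries.subst h h0 hne (HahnSeries.single i 1) =
      (HahnSeries.ofPowerSeries ℤ _ h) ^ i := fun i => by
    rw [← LaurentSeries.single_one_zpow, map_zpow₀, LaurentSeries.subst_X]
  induction p using OnePoint.rec with
  | infty =>
    rw [puiseuxParameter_infty, hX, zpow_neg, zpow_natCast, hpow]
    change (LaurentSeries.expand d hd (localExpansion s₀ f)⁻¹)⁻¹ = _
    rw [map_inv₀, inv_inv]
  | coe a =>
    rw [puiseuxParameter_coe, map_add, hX, zpow_natCast, hpow, LaurentSeries.subst_C]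
    change _ + LaurentSeries.expand d hd (localExpansion s₀ f - HahnSeries.C a) = _
    rw [map_sub, LaurentSeries.expand_C, add_sub_cancel]

end LocalExpansion

/-! ### Pullback of a regular extension along a rational function -/

namespace RegularGExtension

variable {K : Type u} [Field K] {G : Type v} [Group G]

/-- The regular extension `N'` is the pullback of `N` along the rational function `f`, that is the
compositum of `N` with the extension `K(s) / K(t)` given by `t = f(s)`, via `j : N → N'`. -/
structure IsPullback (N : RegularGExtension.{u, v, w} K G) (f : RatFunc K)
    (N' : RegularGExtension.{u, v, u} K G) (j : N.carrier →+* N'.carrier) : Prop where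
  map_const : ∀ c, j (algebraMap K N.carrier c) = algebraMap K N'.carrier c
  map_t : j N.t = algebraMap (RatFunc K) N'.carrier f
  adjoin_range : IntermediateField.adjoin (RatFunc K) (Set.range j) = ⊤
  map_gal : ∀ g x, j (N.gal.symm g x) = N'.gal.symm g (j x)

/-- The substitution `t ↦ f` in rational functions, for `f` not constant. -/
theorem exists_ratFunc_subst {f : RatFunc K} (hf : ¬ ∃ c, f = RatFunc.C c) :
    ∃ θ : RatFunc K →+* RatFunc K, (∀ c, θ (RatFunc.C c) = RatFunc.C c) ∧ θ RatFunc.X = f := by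
  refine RatFunc.exists_ringHom RatFunc.C f fun p hp => ?_
  by_contra hne
  exact RatFunc.transcendental_of_ne_C _ hf ⟨p, hne, hp⟩

/-- The pullback exists if `N` is linearly disjoint, over `K(t)`, from `K̄(s)`. -/
theorem exists_pullback [CharZero K] (N : RegularGExtension.{u, v, w} K G) {f : RatFunc K}
    (hf : ¬ ∃ c, f = RatFunc.C c)
    (hdisj : ∀ ι : N.carrier →+* AlgebraicClosure (RatFunc K),
      (∀ c, ι (algebraMap K N.carrier c) = algebraMap K (AlgebraicClosure (RatFunc K)) c) →
      ι N.t = algebraMap (RatFunc K) (AlgebraicClosure (RatFunc K)) f →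
      ∀ y, ι y ∈ IntermediateField.adjoin (RatFunc K)
        {α : AlgebraicClosure (RatFunc K) | IsAlgebraic K α} →
        y ∈ (algebraMap (RatFunc K) N.carrier).range) :
    ∃ (N' : RegularGExtension.{u, v, u} K G) (j : N.carrier →+* N'.carrier),
      N.IsPullback f N' j := by
  obtain ⟨θ, hθC, hθX⟩ := exists_ratFunc_subst hf
  obtain ⟨ι, hι⟩ : ∃ ι : N.carrier →+* AlgebraicClosure (RatFunc K),
      ∀ a, ι (algebraMap (RatFunc K) N.carrier a) = algebraMap (RatFunc K) _ (θ a) := by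
    let : Algebra (RatFunc K) (AlgebraicClosure (RatFunc K)) :=
      ((algebraMap (RatFunc K) (AlgebraicClosure (RatFunc K))).comp θ).toAlgebra
    let ι : N.carrier →ₐ[RatFunc K] AlgebraicClosure (RatFunc K) := IsAlgClosed.lift
    exact ⟨ι, fun a => ι.commutes a⟩
  have hιC : ∀ c, ι (algebraMap K N.carrier c) = algebraMap K (AlgebraicClosure (RatFunc K)) c := by
    intro c
    rw [← N.algebraMap_C, hι, hθC, ← RatFunc.algebraMap_eq_C, ← IsScalarTower.algebraMap_apply]
  have hιt : ι N.t = algebraMap (RatFunc K) (AlgebraicClosure (RatFunc K)) f := by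
    rw [← hθX]; exact hι _
  have hd := hdisj ι hιC hιt
  have : CharZero (RatFunc K) := charZero_of_injective_algebraMap (algebraMap K (RatFunc K)).injective
  obtain ⟨N', j, r, hfd, hgal, hjι, hgen, hr⟩ := exists_compositum θ ι hι
    (fun y hy => hd y (by
      obtain ⟨a, ha⟩ := hy
      rw [← ha]
      exact IntermediateField.algebraMap_mem _ a))
  have hreg : ∀ α : N', IsAlgebraic K α → α ∈ (algebraMap (RatFunc K) N').range :=
    algebraicClosure_le_of_compositum ι N' j r hjι hr hd
  refine ⟨
    { carrier := N'
      finite := hfd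
      galois := hgal
      regular := ?_
      gal := r.trans N.gal }, j, ?_⟩
  · rw [eq_bot_iff]
    intro α hα
    rw [mem_algebraicClosure_iff] at hα
    obtain ⟨a, rfl⟩ := hreg α hα
    have ha : IsAlgebraic K a :=
      (isAlgebraic_algebraMap_iff (algebraMap (RatFunc K) N').injective).1 hα
    by_cases hc : ∃ c, a = RatFunc.C c
    · obtain ⟨c, rfl⟩ := hc
      exact IntermediateField.mem_bot.2 ⟨c, rfl⟩
    · exact absurd ha (RatFunc.transcendental_of_ne_C _ hc)
  · refine ⟨fun c => Subtype.ext ?_, Subtype.ext ?_, hgen, fun g x => ?_⟩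
    · rw [hjι, hιC]; rfl
    · exact (hjι _).trans hιt
    · have := hr (r.symm (N.gal.symm g)) x
      rwa [MulEquiv.apply_symm_apply] at this

namespace IsPullback

variable {N : RegularGExtension.{u, v, w} K G} {f : RatFunc K}
  {N' : RegularGExtension.{u, v, u} K G} {j : N.carrier →+* N'.carrier}

/-- A homomorphism from `K(s)` extends to the pullback if its restriction to `K(t)` extends
to `N`. -/
theorem exists_ringHom (h : N.IsPullback f N' j) (hf : ¬ ∃ c, f = RatFunc.C c) {L : Type*} [Field L]
    (E : RatFunc K →+* L) (φ : N.carrier →+* L)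
    (hC : ∀ c, φ (algebraMap K N.carrier c) = E (RatFunc.C c)) (ht : φ N.t = E f) :
    ∃ ψ : N'.carrier →+* L, ∀ a, ψ (algebraMap (RatFunc K) N'.carrier a) = E a := by
  obtain ⟨θ, hθC, hθX⟩ := exists_ratFunc_subst hf
  have h1 : j.comp (algebraMap (RatFunc K) N.carrier) =
      (algebraMap (RatFunc K) N'.carrier).comp θ := by
    refine RatFunc.ringHom_ext_of_C_of_X (fun c => ?_) ?_
    · simp only [RingHom.comp_apply]
      rw [N.algebraMap_C, h.map_const, hθC, N'.algebraMap_C]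
    · simp only [RingHom.comp_apply]
      rw [hθX, ← h.map_t]; rfl
  have h2 : φ.comp (algebraMap (RatFunc K) N.carrier) = E.comp θ := by
    refine RatFunc.ringHom_ext_of_C_of_X (fun c => ?_) ?_
    · simp only [RingHom.comp_apply]
      rw [N.algebraMap_C, hC, hθC]
    · simp only [RingHom.comp_apply]
      rw [hθX, ← ht]; rfl
  exact exists_ringHom_extending_of_generated θ j (RingHom.congr_fun h1) h.adjoin_range E φ
    (RingHom.congr_fun h2)

/-- A substitution `Φ` of Puiseux series that is compatible with `t = f(s)` carries a Puiseux
embedding of `N` to one of the pullback. -/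
theorem exists_puiseuxEmbedding_comp [CharZero K] (h : N.IsPullback f N' j)
    (hf : ¬ ∃ c, f = RatFunc.C c)
    {s₀ p : OnePoint (AlgebraicClosure K)} {d e : ℕ} (hd : 0 < d) (φ : N.PuiseuxEmbedding p e)
    (Φ : LaurentSeries (AlgebraicClosure K) →+* LaurentSeries (AlgebraicClosure K))
    (hΦC : ∀ a, Φ (HahnSeries.C a) = HahnSeries.C a)
    (hΦ : Φ (puiseuxParameter p e) = LaurentSeries.expand d hd (localExpansion s₀ f)) :
    ∃ ψ : N'.PuiseuxEmbedding s₀ d, ∀ x, ψ.1 (j x) = Φ (φ.1 x) := by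
  obtain ⟨ψ, hψ⟩ := h.exists_ringHom hf ((LaurentSeries.expand d hd).comp (localExpansion s₀))
    (Φ.comp φ.1) (fun c => by
      rw [RingHom.comp_apply, φ.2.1, hΦC, RingHom.comp_apply, localExpansion_C,
        LaurentSeries.expand_C]) (by rw [RingHom.comp_apply, φ.2.2, hΦ]; rfl)
  let ψ' : N'.PuiseuxEmbedding s₀ d := ⟨ψ, fun c => by
      rw [← N'.algebraMap_C, hψ, RingHom.comp_apply, localExpansion_C, LaurentSeries.expand_C], by
      refine (hψ _).trans ?_
      rw [RingHom.comp_apply, localExpansion_X, PuiseuxEmbedding.expand_puiseuxParameter, mul_one]⟩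
  obtain ⟨c, hc⟩ := exists_gal_comp_eq (ψ'.1.comp j) (Φ.comp φ.1) (fun c => by
      rw [RingHom.comp_apply, RingHom.comp_apply, φ.2.1, hΦC, h.map_const, ψ'.2.1]) (by
      rw [RingHom.comp_apply, RingHom.comp_apply, φ.2.2, hΦ, h.map_t]
      exact hψ f)
  refine ⟨ψ'.compGal c, fun x => ?_⟩
  rw [PuiseuxEmbedding.compGal_apply, ← h.map_gal]
  exact (hc x).symm

/-- Abhyankar's lemma: if `f` has multiplicity `n` at `s₀` and `e ∣ n * d`, then the `e`-th root of
the parameter at `f(s₀)` is a series in the `d`-th root of the parameter at `s₀`. -/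
theorem nonempty_puiseuxEmbedding [CharZero K] (h : N.IsPullback f N' j)
    (hf : ¬ ∃ c, f = RatFunc.C c) {s₀ p : OnePoint (AlgebraicClosure K)} {n d e m : ℕ}
    (hmult : HasMultiplicity f s₀ p n) (hm : 0 < m) (hd : 0 < d) (he : 0 < e)
    (hnd : n * d = e * m) (φ : N.PuiseuxEmbedding p e) : Nonempty (N'.PuiseuxEmbedding s₀ d) := by
  obtain ⟨q, v, h0, hne, hs, -⟩ := hmult.exists_subst hm hd he hnd
  obtain ⟨ψ, -⟩ := h.exists_puiseuxEmbedding_comp hf hd φ _ (LaurentSeries.subst_C q h0 hne) hs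
  exact ⟨ψ⟩

/-- Where `f` is unramified, the pullback has the same inertia. -/
theorem exists_rotates [CharZero K] (h : N.IsPullback f N' j)
    (hf : ¬ ∃ c, f = RatFunc.C c) {s₀ p : OnePoint (AlgebraicClosure K)} {e : ℕ}
    (hmult : HasMultiplicity f s₀ p 1) (he : 0 < e) (φ : N.PuiseuxEmbedding p e)
    {z : AlgebraicClosure K} (hz : z ^ e = 1) {g : G} (hg : φ.Rotates z g) :
    ∃ ψ : N'.PuiseuxEmbedding s₀ e, ψ.Rotates z g := by
  obtain ⟨q, v, h0, hne, hs, hq⟩ := hmult.exists_subst (m := 1) one_pos he he (by ring)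
  have hz0 : z ≠ 0 := by rintro rfl; simp [he.ne'] at hz
  have hresc : PowerSeries.rescale z q = z • q := by
    ext n
    rw [PowerSeries.coeff_rescale, PowerSeries.coeff_smul, hq, pow_one]
    rcases n with _ | n
    · simp
    · rw [PowerSeries.coeff_succ_X_mul, PowerSeries.coeff_subst_X_pow he.ne', smul_eq_mul]
      split_ifs with hn
      · obtain ⟨k, rfl⟩ := hn
        rw [pow_succ, pow_mul, hz, one_pow, one_mul]
      · simp
  obtain ⟨ψ, hψ⟩ := h.exists_puiseuxEmbedding_comp hf he φ _ (LaurentSeries.subst_C q h0 hne) hs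
  refine ⟨ψ, fun x n => ?_⟩
  set T := LaurentSeries.twist (RingHom.id (AlgebraicClosure K)) (Units.mk0 z hz0) with hT
  suffices hx : (ψ.compGal g).1 x = T (ψ.1 x) by
    rw [← PuiseuxEmbedding.compGal_apply, hx, hT, LaurentSeries.twist_coeff]; rfl
  have hφ : ∀ x, φ.1 (N.gal.symm g x) = T (φ.1 x) := fun x => by
    ext n
    rw [hg, hT, LaurentSeries.twist_coeff]; rfl
  have hT1 : ∀ a, T (ψ.1 (algebraMap (RatFunc K) N'.carrier a)) =
      ψ.1 (algebraMap (RatFunc K) N'.carrier a) := by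
    refine ringHom_agree (φ := T.comp ψ.1) (ψ := ψ.1) (fun c => ?_) ?_
    · rw [RingHom.comp_apply, ψ.2.1, hT, LaurentSeries.twist_C]; rfl
    · rw [RingHom.comp_apply, ψ.2.2, hT, PuiseuxEmbedding.twist_puiseuxParameter]
      ext; simpa using hz
  have hmem : x ∈ IntermediateField.adjoin (RatFunc K) (Set.range j) :=
    h.adjoin_range ▸ IntermediateField.mem_top
  induction hmem using IntermediateField.adjoin_induction with
  | mem x hx =>
    obtain ⟨y, rfl⟩ := hx
    rw [PuiseuxEmbedding.compGal_apply, ← h.map_gal, hψ, hφ, hψ, hT,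
      LaurentSeries.twist_subst _ _ _ _ hresc]
  | algebraMap a =>
    rw [PuiseuxEmbedding.compGal_apply, hT1]
    congr 1
    exact (N'.gal.symm g).commutes a
  | add x y _ _ hx hy => rw [map_add, map_add, map_add, hx, hy]
  | inv x _ hx => rw [map_inv₀, map_inv₀, map_inv₀, hx]
  | mul x y _ _ hx hy => rw [map_mul, map_mul, map_mul, hx, hy]

end IsPullback

end RegularGExtension

/-! ### An Euler operator on polynomials -/

namespace EulerOperator

open Polynomial

variable {k : Type*} [Field k]

/-- The numerator of the logarithmic derivative of `s ^ a (s - 1) ^ b (s - μ) ^ (-c)`. -/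
noncomputable def logNum (a b c : ℕ) (μ : k) : k[X] :=
  C (a : k) * (X - 1) * (X - C μ) + C (b : k) * X * (X - C μ) - C (c : k) * X * (X - 1)

/-- `(s - μ) ^ (n + 1)` times the derivative of `P / (s - μ) ^ n`, times `s (s - 1)`. -/
noncomputable def derivNum (n : ℕ) (μ : k) (P : k[X]) : k[X] :=
  X * (X - 1) * (derivative P * (X - C μ) - C (n : k) * P)

/-- The polynomial `s ^ (a m) (s - 1) ^ (b m) (s - μ) ^ (n - c m)`. -/
noncomputable def monomial (a b c n : ℕ) (μ : k) (m : ℕ) : k[X] :=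
  X ^ (a * m) * (X - 1) ^ (b * m) * (X - C μ) ^ (n - c * m)

variable {a b c n : ℕ} {μ : k}

theorem derivNum_add (P Q : k[X]) : derivNum n μ (P + Q) = derivNum n μ P + derivNum n μ Q := by
  simp only [derivNum, derivative_add]; ring

theorem derivNum_smul (r : k) (P : k[X]) : derivNum n μ (r • P) = r • derivNum n μ P := by
  simp only [derivNum, smul_eq_C_mul, derivative_C_mul]; ring

theorem X_sub_C_mul_derivative_pow (x : k) (i : ℕ) :
    (X - C x) * derivative ((X - C x) ^ i) = C (i : k) * (X - C x) ^ i := by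
  rcases i with _ | i
  · simp
  · rw [derivative_X_sub_C_pow, Nat.add_sub_cancel, pow_succ]; ring

theorem logNum_eval_zero : (logNum a b c μ).eval 0 = a * μ := by simp [logNum]

theorem logNum_eval_one : (logNum a b c μ).eval 1 = b * (1 - μ) := by simp [logNum]

theorem logNum_eval_mu : (logNum a b c μ).eval μ = - (c * μ * (μ - 1)) := by simp [logNum]

/-- The Euler operator acts on the leading term of an expansion at `x` through the exponent. -/
theorem derivNum_sub_leading (lam x : k) (j : ℕ) (g : k[X]) :
    (X - C x) * (derivNum n μ ((X - C x) ^ j * g) - C lam * logNum a b c μ * ((X - C x) ^ j * g)) =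
      (X - C x) ^ j * ((X * (X - 1) * ((X - C μ) * (C (j : k) * g + (X - C x) * derivative g) -
        C (n : k) * (X - C x) * g)) - C lam * logNum a b c μ * (X - C x) * g) := by
  simp only [derivNum, derivative_mul]
  linear_combination (X * (X - 1) * (X - C μ) * g) * X_sub_C_mul_derivative_pow x j

/-- The order at `0` of an eigenvector of the Euler operator. Together with the orders at `1` and `μ`
it shows that the eigenvector is a monomial in the zeros and poles. -/
theorem exponent_zero (hμ : μ ≠ 0) {lam : k} {P : k[X]} (hP : P ≠ 0)
    (h : derivNum n μ P = C lam * logNum a b c μ * P) :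
    (P.rootMultiplicity 0 : k) = lam * a := by
  obtain ⟨g, hg, hg0⟩ := exists_eq_pow_rootMultiplicity_mul_and_not_dvd P hP 0
  set j := P.rootMultiplicity 0
  have h1 := derivNum_sub_leading (n := n) (μ := μ) (a := a) (b := b) (c := c) lam 0 j g
  rw [← hg, h, sub_self, mul_zero, eq_comm, mul_eq_zero] at h1
  have h2 := h1.resolve_left (pow_ne_zero _ (X_sub_C_ne_zero 0))
  have hg1 : g.eval 0 ≠ 0 := fun h0 => hg0 (dvd_iff_isRoot.2 h0)
  have h3 : X * ((X - 1) * ((X - C μ) * (C (j : k) * g + (X - C 0) * derivative g) -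
        C (n : k) * (X - C 0) * g) - C lam * logNum a b c μ * g) = (0 : k[X]) := by
    rw [← h2, map_zero]; ring
  have h4 := (mul_eq_zero.1 h3).resolve_left X_ne_zero
  have h5 := congrArg (eval 0) h4
  simp [logNum_eval_zero] at h5
  have h6 : (μ * g.eval 0) * ((j : k) - lam * a) = 0 := by linear_combination h5
  exact sub_eq_zero.1 ((mul_eq_zero.1 h6).resolve_left (mul_ne_zero hμ hg1))

theorem exponent_one (hμ : μ ≠ 1) {lam : k} {P : k[X]} (hP : P ≠ 0)
    (h : derivNum n μ P = C lam * logNum a b c μ * P) :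
    (P.rootMultiplicity 1 : k) = lam * b := by
  obtain ⟨g, hg, hg0⟩ := exists_eq_pow_rootMultiplicity_mul_and_not_dvd P hP 1
  set j := P.rootMultiplicity 1
  have h1 := derivNum_sub_leading (n := n) (μ := μ) (a := a) (b := b) (c := c) lam 1 j g
  rw [← hg, h, sub_self, mul_zero, eq_comm, mul_eq_zero] at h1
  have h2 := h1.resolve_left (pow_ne_zero _ (X_sub_C_ne_zero 1))
  have hg1 : g.eval 1 ≠ 0 := fun h0 => hg0 (dvd_iff_isRoot.2 h0)
  have h3 : (X - C 1) * (X * ((X - C μ) * (C (j : k) * g + (X - C 1) * derivative g) -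
        C (n : k) * (X - C 1) * g) - C lam * logNum a b c μ * g) = (0 : k[X]) := by
    rw [← h2, map_one]; ring
  have h4 := (mul_eq_zero.1 h3).resolve_left (X_sub_C_ne_zero 1)
  have h5 := congrArg (eval 1) h4
  simp [logNum_eval_one] at h5
  have h6 : ((1 - μ) * g.eval 1) * ((j : k) - lam * b) = 0 := by linear_combination h5
  exact sub_eq_zero.1 ((mul_eq_zero.1 h6).resolve_left
    (mul_ne_zero (sub_ne_zero.2 hμ.symm) hg1))

theorem exponent_mu (hμ0 : μ ≠ 0) (hμ : μ ≠ 1) {lam : k} {P : k[X]} (hP : P ≠ 0)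
    (h : derivNum n μ P = C lam * logNum a b c μ * P) :
    (P.rootMultiplicity μ : k) = n - lam * c := by
  obtain ⟨g, hg, hg0⟩ := exists_eq_pow_rootMultiplicity_mul_and_not_dvd P hP μ
  set j := P.rootMultiplicity μ
  have h1 := derivNum_sub_leading (n := n) (μ := μ) (a := a) (b := b) (c := c) lam μ j g
  rw [← hg, h, sub_self, mul_zero, eq_comm, mul_eq_zero] at h1
  have h2 := h1.resolve_left (pow_ne_zero _ (X_sub_C_ne_zero μ))
  have hg1 : g.eval μ ≠ 0 := fun h0 => hg0 (dvd_iff_isRoot.2 h0)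
  have h3 : (X - C μ) * (X * (X - 1) * ((C (j : k) * g + (X - C μ) * derivative g) -
        C (n : k) * g) - C lam * logNum a b c μ * g) = (0 : k[X]) := by
    rw [← h2]; ring
  have h4 := (mul_eq_zero.1 h3).resolve_left (X_sub_C_ne_zero μ)
  have h5 := congrArg (eval μ) h4
  simp [logNum_eval_mu] at h5
  have h6 : (μ * (μ - 1) * g.eval μ) * ((j : k) - (n - lam * c)) = 0 := by linear_combination h5
  exact sub_eq_zero.1 ((mul_eq_zero.1 h6).resolve_left
    (mul_ne_zero (mul_ne_zero hμ0 (sub_ne_zero.2 hμ)) hg1))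

theorem derivNum_mul_monomial {m : ℕ} (hm : c * m ≤ n) (g : k[X]) :
    derivNum n μ (monomial a b c n μ m * g) = C (m : k) * logNum a b c μ * (monomial a b c n μ m * g) +
      X * (X - 1) * (X - C μ) * monomial a b c n μ m * derivative g := by
  have e0 := X_sub_C_mul_derivative_pow (0 : k) (a * m)
  have e1 := X_sub_C_mul_derivative_pow (1 : k) (b * m)
  have e2 := X_sub_C_mul_derivative_pow μ (n - c * m)
  rw [map_zero, sub_zero] at e0
  rw [map_one] at e1
  have hn : (C ((n - c * m : ℕ) : k) : k[X]) = C (n : k) - C (c : k) * C (m : k) := by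
    rw [Nat.cast_sub hm]; simp
  rw [hn] at e2
  simp only [Nat.cast_mul, map_mul] at e0 e1
  simp only [derivNum, monomial, logNum, derivative_mul]
  set A := (X : k[X]) ^ (a * m)
  set B := ((X : k[X]) - 1) ^ (b * m)
  set D := ((X : k[X]) - C μ) ^ (n - c * m)
  linear_combination (X - 1) * (X - C μ) * B * D * g * e0 + X * (X - C μ) * A * D * g * e1
    + X * (X - 1) * A * B * g * e2

theorem monomial_ne_zero (m : ℕ) : monomial a b c n μ m ≠ 0 :=
  mul_ne_zero (mul_ne_zero (pow_ne_zero _ X_ne_zero) (pow_ne_zero _ (X_sub_C_ne_zero 1)))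
    (pow_ne_zero _ (X_sub_C_ne_zero μ))

variable [CharZero k]

/-- An eigenvector of the Euler operator is a power of `s ^ a (s - 1) ^ b (s - μ) ^ (-c)`: its
exponents at `0` and `μ` show that the eigenvalue is an integer. -/
theorem eq_smul_monomial_of_eigen (ha : 0 < a) (hac : a.Coprime c) (hμ0 : μ ≠ 0) (hμ1 : μ ≠ 1)
    {lam : k} {P : k[X]} (hP : P ≠ 0) (h : derivNum n μ P = C lam * logNum a b c μ * P) :
    ∃ m : ℕ, lam = m ∧ c * m ≤ n ∧ ∃ r : k, P = r • monomial a b c n μ m := by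
  have h0 := exponent_zero hμ0 hP h
  have h1 := exponent_one hμ1 hP h
  have hmu := exponent_mu hμ0 hμ1 hP h
  set i := P.rootMultiplicity 0
  set i' := P.rootMultiplicity 1
  set j := P.rootMultiplicity μ
  obtain ⟨m, hm⟩ : ∃ m : ℕ, lam = m := by
    have hb : (1 : ℤ) = a * Nat.gcdA a c + c * Nat.gcdB a c := by
      have := Nat.gcd_eq_gcd_ab a c
      rwa [hac.gcd_eq_one, Nat.cast_one] at this
    have hl : lam = ((i * Nat.gcdA a c + (n - j) * Nat.gcdB a c : ℤ) : k) := by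
      have hb' : (1 : k) = a * (Nat.gcdA a c : ℤ) + c * (Nat.gcdB a c : ℤ) := by exact_mod_cast hb
      push_cast
      rw [h0, hmu]
      linear_combination lam * hb'
    set z : ℤ := i * Nat.gcdA a c + (n - j) * Nat.gcdB a c
    have hz : (i : ℤ) = z * a := by
      have : ((i : ℤ) : k) = ((z * a : ℤ) : k) := by push_cast; rw [h0, hl]
      exact_mod_cast this
    have hz0 : 0 ≤ z := by
      by_contra hneg
      have : z * a < 0 := mul_neg_of_neg_of_pos (not_le.1 hneg) (by exact_mod_cast ha)
      omega
    obtain ⟨m, hm⟩ := Int.eq_ofNat_of_zero_le hz0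
    exact ⟨m, by rw [hl, hm]; simp⟩
  subst hm
  have hi : i = a * m := by
    have : (i : k) = ((a * m : ℕ) : k) := by rw [h0]; push_cast; ring
    exact_mod_cast this
  have hi' : i' = b * m := by
    have : (i' : k) = ((b * m : ℕ) : k) := by rw [h1]; push_cast; ring
    exact_mod_cast this
  have hj : j + c * m = n := by
    have : ((j + c * m : ℕ) : k) = n := by push_cast; rw [hmu]; ring
    exact_mod_cast this
  refine ⟨m, rfl, by omega, ?_⟩
  have hdvd : monomial a b c n μ m ∣ P := by
    have d0 : (X - C (0 : k)) ^ (a * m) ∣ P := hi ▸ pow_rootMultiplicity_dvd P 0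
    have d1 : (X - C (1 : k)) ^ (b * m) ∣ P := hi' ▸ pow_rootMultiplicity_dvd P 1
    have d2 : (X - C μ) ^ (n - c * m) ∣ P := by
      rw [show n - c * m = j by omega]; exact pow_rootMultiplicity_dvd P μ
    have c01 : IsCoprime (X - C (0 : k)) (X - C (1 : k)) :=
      pairwise_coprime_X_sub_C Function.injective_id zero_ne_one
    have c02 : IsCoprime (X - C (0 : k)) (X - C μ) :=
      pairwise_coprime_X_sub_C Function.injective_id hμ0.symm
    have c12 : IsCoprime (X - C (1 : k)) (X - C μ) :=
      pairwise_coprime_X_sub_C Function.injective_id hμ1.symm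
    have := IsCoprime.mul_dvd (IsCoprime.mul_left (c02.pow) (c12.pow))
      (IsCoprime.mul_dvd c01.pow d0 d1) d2
    simpa [monomial] using this
  obtain ⟨g, rfl⟩ := hdvd
  rw [derivNum_mul_monomial (by omega)] at h
  have h2 : X * (X - 1) * (X - C μ) * monomial a b c n μ m * derivative g = 0 := by
    linear_combination h
  have h3 : derivative g = 0 := by
    refine (mul_eq_zero.1 h2).resolve_left ?_
    exact mul_ne_zero (mul_ne_zero (mul_ne_zero X_ne_zero (X_sub_C_ne_zero 1)) (X_sub_C_ne_zero μ))
      (monomial_ne_zero m)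
  rw [eq_C_of_derivative_eq_zero h3, mul_comm, ← smul_eq_C_mul]
  exact ⟨_, rfl⟩

/-- The Euler operator has no Jordan blocks: a logarithm is not a rational function. -/
theorem eq_zero_of_jordan (ha : 0 < a) (hμ0 : μ ≠ 0)
    {m : ℕ} (r : k) {P : k[X]}
    (h : derivNum n μ P = logNum a b c μ * (C (m : k) * P + C r * monomial a b c n μ m)) :
    r = 0 := by
  by_contra hr
  have hP : P ≠ 0 := by
    rintro rfl
    simp only [derivNum, derivative_zero, zero_mul, mul_zero, sub_zero, zero_add] at h
    have hl : logNum a b c μ ≠ 0 := fun h0 => by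
      have := logNum_eval_zero (a := a) (b := b) (c := c) (μ := μ)
      rw [h0, eval_zero, eq_comm, mul_eq_zero] at this
      exact this.elim (by exact_mod_cast ha.ne') hμ0
    exact mul_ne_zero hl (mul_ne_zero (C_ne_zero.2 hr) (monomial_ne_zero m)) h.symm
  obtain ⟨g, hg, hg0⟩ := exists_eq_pow_rootMultiplicity_mul_and_not_dvd P hP 0
  set j := P.rootMultiplicity 0
  have hg1 : g.eval 0 ≠ 0 := fun h0 => hg0 (dvd_iff_isRoot.2 h0)
  have h1 := derivNum_sub_leading (n := n) (μ := μ) (a := a) (b := b) (c := c) (m : k) 0 j g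
  rw [← hg, h] at h1
  set B : k[X] := (X - 1) ^ (b * m) * (X - C μ) ^ (n - c * m) with hB
  have hBm : monomial a b c n μ m = X ^ (a * m) * B := by rw [hB, monomial, mul_assoc]
  have hB0 : B.eval 0 ≠ 0 := by
    simp [hB, hμ0]
  set S : k[X] := (X - 1) * ((X - C μ) * (C (j : k) * g + X * derivative g) -
        C (n : k) * X * g) - C (m : k) * logNum a b c μ * g with hS
  have h2 : X * (logNum a b c μ * C r * X ^ (a * m) * B) = X * (X ^ j * S) := by
    rw [hBm] at h1
    rw [map_zero, sub_zero] at h1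
    rw [hS]
    linear_combination h1
  have h3 := mul_left_cancel₀ X_ne_zero h2
  have hS0 : S.eval 0 = μ * ((j : k) - m * a) * g.eval 0 := by
    rw [hS]; simp [logNum_eval_zero]; ring
  rcases lt_or_ge j (a * m) with hlt | hge
  · obtain ⟨d, hd⟩ := Nat.exists_eq_add_of_lt hlt
    have h4 : X ^ j * (logNum a b c μ * C r * X ^ (d + 1) * B) = X ^ j * S := by
      rw [← h3, hd]; ring
    have h5 := congrArg (eval 0) (mul_left_cancel₀ (pow_ne_zero _ X_ne_zero) h4)
    rw [hS0] at h5
    simp [hμ0, hg1] at h5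
    have h6 : (j : k) = ((m * a : ℕ) : k) := by push_cast; linear_combination h5
    have h7 : j = m * a := by exact_mod_cast h6
    rw [mul_comm] at h7
    omega
  · obtain ⟨d, hd⟩ := Nat.exists_eq_add_of_le hge
    have h4 : X ^ (a * m) * (logNum a b c μ * C r * B) = X ^ (a * m) * (X ^ d * S) := by
      rw [← mul_assoc (X ^ (a * m)) (X ^ d), ← pow_add, ← hd, ← h3]; ring
    have h5 := congrArg (eval 0) (mul_left_cancel₀ (pow_ne_zero _ X_ne_zero) h4)
    have hz : eval 0 (X ^ d * S) = 0 := by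
      rcases d with _ | d
      · rw [pow_zero, one_mul, hS0]
        have : (j : k) = m * a := by rw [hd]; push_cast; ring
        rw [this]; ring
      · simp
    rw [hz] at h5
    simp [logNum_eval_zero, hr, hB0, hμ0, ha.ne'] at h5

/-- A finite-dimensional space of polynomials `P`, standing for the functions `P / (s - μ) ^ n`, that
is stable under the Euler operator consists of polynomials in `s ^ a (s - 1) ^ b (s - μ) ^ (-c)`. -/
theorem mem_span_monomial [IsAlgClosed k] (ha : 0 < a) (hac : a.Coprime c) (hμ0 : μ ≠ 0)
    (hμ1 : μ ≠ 1) (V : Submodule k k[X]) [FiniteDimensional k V]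
    (hV : ∀ P ∈ V, ∃ Q ∈ V, logNum a b c μ * Q = derivNum n μ P) {P : k[X]} (hP : P ∈ V) :
    P ∈ Submodule.span k {Q | ∃ m, c * m ≤ n ∧ Q = monomial a b c n μ m} := by
  have hl : logNum a b c μ ≠ 0 := fun h0 => by
    have := logNum_eval_zero (a := a) (b := b) (c := c) (μ := μ)
    rw [h0, eval_zero, eq_comm, mul_eq_zero] at this
    exact this.elim (by exact_mod_cast ha.ne') hμ0
  choose! T hTV hT using hV
  let τ : Module.End k V :=
    { toFun := fun P => ⟨T P, hTV P P.2⟩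
      map_add' := fun P Q => Subtype.ext (mul_left_cancel₀ hl (by
        simp only [Submodule.coe_add, mul_add]
        rw [hT _ (V.add_mem P.2 Q.2), hT _ P.2, hT _ Q.2, derivNum_add]))
      map_smul' := fun r P => Subtype.ext (mul_left_cancel₀ hl (by
        simp only [Submodule.coe_smul, RingHom.id_apply]
        rw [hT _ (V.smul_mem r P.2), mul_smul_comm, hT _ P.2, derivNum_smul])) }
  have hτ : ∀ P : V, logNum a b c μ * (τ P : k[X]) = derivNum n μ (P : k[X]) := fun P => hT P P.2
  have hker : ∀ (lam : k) (Q : V), (τ - algebraMap k _ lam) Q = 0 →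
      derivNum n μ (Q : k[X]) = C lam * logNum a b c μ * Q := by
    intro lam Q hQ
    have h1 : τ Q = lam • Q := by
      rwa [LinearMap.sub_apply, sub_eq_zero, Module.algebraMap_end_apply] at hQ
    rw [← hτ, h1, Submodule.coe_smul, smul_eq_C_mul]; ring
  have hsq : ∀ (lam : k) (Q : V), (τ - algebraMap k _ lam) ((τ - algebraMap k _ lam) Q) = 0 →
      (τ - algebraMap k _ lam) Q = 0 := by
    intro lam Q hQ
    by_contra hne
    set R := (τ - algebraMap k _ lam) Q with hR
    have hR0 : (R : k[X]) ≠ 0 := fun h0 => hne (Subtype.ext h0)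
    obtain ⟨m, rfl, -, r, hr⟩ := eq_smul_monomial_of_eigen ha hac hμ0 hμ1 hR0 (hker lam R hQ)
    have h1 : τ Q = (m : k) • Q + R := by
      rw [hR, LinearMap.sub_apply, Module.algebraMap_end_apply]; abel
    have h2 := hτ Q
    rw [h1, Submodule.coe_add, Submodule.coe_smul, hr, smul_eq_C_mul, smul_eq_C_mul] at h2
    have h3 := eq_zero_of_jordan ha hμ0 r h2.symm
    rw [h3, zero_smul] at hr
    exact hR0 hr
  have hgen : ∀ (lam : k) (i : ℕ) (Q : V), ((τ - algebraMap k _ lam) ^ (i + 1)) Q = 0 →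
      (τ - algebraMap k _ lam) Q = 0 := by
    intro lam i
    induction i with
    | zero => intro Q hQ; simpa using hQ
    | succ i ih =>
      intro Q hQ
      rw [pow_succ, Module.End.mul_apply] at hQ
      exact hsq lam Q (ih _ hQ)
  have htop := Module.End.iSup_maxGenEigenspace_eq_top τ
  have key : ∀ Q : V, (Q : k[X]) ∈ Submodule.span k {Q | ∃ m, c * m ≤ n ∧ Q = monomial a b c n μ m} := by
    intro Q
    have hQ : Q ∈ ⨆ lam, τ.maxGenEigenspace lam := htop ▸ Submodule.mem_top
    induction hQ using Submodule.iSup_induction' with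
    | mem lam Q hQ =>
      rw [Module.End.mem_maxGenEigenspace] at hQ
      obtain ⟨i, hi⟩ := hQ
      have h1 : (τ - algebraMap k _ lam) Q = 0 := by
        refine hgen lam i Q ?_
        rw [pow_succ', Module.End.mul_apply]
        have h2 : ((τ - algebraMap k _ lam) ^ i) Q = 0 := hi
        rw [h2, map_zero]
      by_cases hQ0 : (Q : k[X]) = 0
      · rw [hQ0]; exact Submodule.zero_mem _
      · obtain ⟨m, -, hm, r, hr⟩ := eq_smul_monomial_of_eigen ha hac hμ0 hμ1 hQ0 (hker lam Q h1)
        rw [hr]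
        exact Submodule.smul_mem _ _ (Submodule.subset_span ⟨m, hm, rfl⟩)
    | zero => exact Submodule.zero_mem _
    | add x y _ _ hx hy => exact Submodule.add_mem _ hx hy
  exact key ⟨P, hP⟩

end EulerOperator

/-! ### Linear disjointness from the constant extension -/

section Disjointness

open Polynomial

/-- If `K` is algebraically closed in `N`, then an element of `N` which lies in the extension of
`F` by constants lies in `F`. -/
theorem mem_range_of_mem_adjoin_isAlgebraic {K F N Ω : Type*} [Field K] [Field F] [Field N]
    [Field Ω] [CharZero K] [Algebra K F] [Algebra K N] [Algebra F N] [Algebra K Ω] [Algebra F Ω]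
    [Algebra N Ω] [IsScalarTower K F N] [IsScalarTower K F Ω] [IsScalarTower F N Ω]
    [IsScalarTower K N Ω] (hK : ∀ x : N, IsAlgebraic K x → x ∈ (algebraMap K N).range) {y : N}
    (hy : algebraMap N Ω y ∈ IntermediateField.adjoin F {α : Ω | IsAlgebraic K α}) :
    y ∈ (algebraMap F N).range := by
  obtain ⟨T, hTS, hyT⟩ := IntermediateField.exists_finset_of_mem_adjoin hy
  have hTi : ∀ x ∈ (T : Set Ω), IsIntegral K x := fun x hx => (hTS hx).isIntegral
  have : FiniteDimensional K (IntermediateField.adjoin K (T : Set Ω)) :=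
    IntermediateField.finiteDimensional_adjoin hTi
  obtain ⟨β', hβ'⟩ := Field.exists_primitive_element K (IntermediateField.adjoin K (T : Set Ω))
  set β : Ω := β'.1 with hβ
  have hTβ : IntermediateField.adjoin K (T : Set Ω) = IntermediateField.adjoin K {β} := by
    have h1 := congrArg IntermediateField.lift hβ'
    rw [IntermediateField.lift_top, IntermediateField.lift_adjoin_simple] at h1
    exact h1.symm
  have hβint : IsIntegral K β :=
    ((IsIntegral.of_finite K β').map (IntermediateField.val _))
  have hyβ : algebraMap N Ω y ∈ IntermediateField.adjoin F {β} := by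
    refine IntermediateField.adjoin_le_iff.2 (fun x hx => ?_) hyT
    have h1 : x ∈ IntermediateField.adjoin K {β} :=
      hTβ ▸ IntermediateField.subset_adjoin K _ hx
    have h2 : IntermediateField.adjoin K {β} ≤
        (IntermediateField.adjoin F {β}).restrictScalars K := by
      rw [IntermediateField.adjoin_simple_le_iff]
      exact IntermediateField.mem_adjoin_simple_self F β
    exact h2 h1
  have hβF : IsIntegral F β := hβint.tower_top
  rw [← IntermediateField.mem_toSubalgebra,
    IntermediateField.adjoin_simple_toSubalgebra_of_isAlgebraic hβF.isAlgebraic,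
    Algebra.adjoin_singleton_eq_range_aeval] at hyβ
  obtain ⟨q, hq⟩ := hyβ
  set M := minpoly K β with hM
  have hMm : M.Monic := minpoly.monic hβint
  have hMN : minpoly N β = M.map (algebraMap K N) := by
    have hdvd : minpoly N β ∣ M.map (algebraMap K N) := minpoly.dvd_map_of_isScalarTower K N β
    have hmem := integralClosure.mem_lifts_of_monic_of_dvd_map (R := K) N hMm
      (minpoly.monic hβint.tower_top) hdvd
    have hlift : minpoly N β ∈ Polynomial.lifts (algebraMap K N) := by
      rw [Polynomial.lifts_iff_coeff_lifts] at hmem ⊢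
      intro n
      obtain ⟨x, hx⟩ := hmem n
      rw [← hx]
      exact hK _ (isAlgebraic_iff_isIntegral.2 x.2)
    obtain ⟨p0, hp0⟩ := (Polynomial.mem_lifts _).1 hlift
    have h1 : M ∣ p0 := by
      refine minpoly.dvd K β ?_
      rw [← Polynomial.aeval_map_algebraMap N, hp0, minpoly.aeval]
    refine (Polynomial.eq_of_dvd_of_natDegree_le_of_leadingCoeff hdvd ?_ ?_)
    · have hp00 : p0 ≠ 0 := by
        rintro rfl
        rw [Polynomial.map_zero] at hp0
        exact minpoly.ne_zero (hβint.tower_top : IsIntegral N β) hp0.symm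
      rw [← hp0, natDegree_map, natDegree_map]
      exact natDegree_le_of_dvd h1 hp00
    · rw [(minpoly.monic hβint.tower_top).leadingCoeff, (hMm.map _).leadingCoeff]
  set m := M.map (algebraMap K F) with hm
  have hmm : m.Monic := hMm.map _
  have hmβ : aeval β m = 0 := by rw [hm, aeval_map_algebraMap, hM, minpoly.aeval]
  set q' := q %ₘ m with hq'
  have hq'β : aeval β q' = algebraMap N Ω y := by
    rw [hq', aeval_modByMonic_eq_self_of_root hmβ]; exact hq
  have hroot : aeval β (q'.map (algebraMap F N) - C y) = 0 := by
    rw [map_sub, aeval_map_algebraMap, hq'β, aeval_C, sub_self]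
  have hdeg : (q'.map (algebraMap F N) - C y).degree < (minpoly N β).degree := by
    refine lt_of_le_of_lt (degree_sub_le _ _) (max_lt ?_ ?_)
    · rw [degree_map, hMN, degree_map]
      calc q'.degree < m.degree := degree_modByMonic_lt _ hmm
        _ = M.degree := degree_map _ _
    · exact degree_C_le.trans_lt (minpoly.degree_pos hβint.tower_top)
  have hz : q'.map (algebraMap F N) - C y = 0 := by
    by_contra hne
    exact absurd (minpoly.degree_le_of_ne_zero N β hne hroot) (not_le.2 hdeg)
  refine ⟨q'.coeff 0, ?_⟩
  have := congrArg (fun p => p.coeff 0) hz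
  simp only [coeff_sub, coeff_map, coeff_C_zero, coeff_zero] at this
  exact sub_eq_zero.1 this

end Disjointness

namespace EulerOperator

open Polynomial

variable {k : Type*} [Field k]

/-- The expansion of polynomials at the point `x`. -/
noncomputable def taylorSeries (x : k) : k[X] →+* PowerSeries k :=
  coeToPowerSeries.ringHom.comp (taylorAlgHom x : k[X] →+* k[X])

theorem taylorSeries_apply (x : k) (P : k[X]) :
    taylorSeries x P = (taylor x P : PowerSeries k) := rfl

@[simp]
theorem taylorSeries_C (x a : k) : taylorSeries x (C a) = PowerSeries.C a := by
  rw [taylorSeries_apply, taylor_C, coe_C]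

@[simp]
theorem taylorSeries_X (x : k) : taylorSeries x X = PowerSeries.X + PowerSeries.C x := by
  rw [taylorSeries_apply, taylor_X, coe_add, coe_X, coe_C]

theorem constantCoeff_taylorSeries (x : k) (P : k[X]) :
    PowerSeries.constantCoeff (taylorSeries x P) = P.eval x := by
  rw [taylorSeries_apply, constantCoeff_coe, taylor_coeff_zero]

theorem taylorSeries_injective (x : k) : Function.Injective (taylorSeries x) := fun _ _ h =>
  taylor_injective x (coe_injective k h)

theorem derivative_taylorSeries (x : k) (P : k[X]) :
    PowerSeries.derivative k (taylorSeries x P) = taylorSeries x (derivative P) := by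
  rw [taylorSeries_apply, PowerSeries.derivative_coe, taylorSeries_apply]
  simp [taylor_apply, derivative_comp]

theorem X_pow_dvd_coe_iff (P : k[X]) (m : ℕ) :
    PowerSeries.X ^ m ∣ (P : PowerSeries k) ↔ X ^ m ∣ P := by
  rw [PowerSeries.X_pow_dvd_iff, X_pow_dvd_iff]
  simp

theorem X_pow_dvd_taylor_iff (x : k) (P : k[X]) (m : ℕ) :
    X ^ m ∣ taylor x P ↔ (X - C x) ^ m ∣ P := by
  have h : taylor x ((X - C x) ^ m) = X ^ m := by
    rw [taylor_pow]; simp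
  constructor
  · rintro ⟨Q, hQ⟩
    refine ⟨taylor (-x) Q, ?_⟩
    apply taylor_injective x
    rw [taylor_mul, h, hQ, taylor_taylor]
    simp
  · rintro ⟨Q, rfl⟩
    rw [taylor_mul, h]
    exact dvd_mul_right _ _

/-- Over an algebraically closed field, divisibility can be tested on the expansions at roots. -/
theorem dvd_of_taylor_dvd [IsAlgClosed k] {q Q : k[X]} (hq : q ≠ 0)
    (h : ∀ x, q.eval x = 0 → taylorSeries x q ∣ taylorSeries x Q) :
    q ∣ Q := by
  classical
  by_cases hQ : Q = 0
  · rw [hQ]; exact dvd_zero _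
  refine (IsAlgClosed.splits q).dvd_of_roots_le_roots hq ?_
  rw [Multiset.le_iff_count]
  intro x
  by_cases hx : q.eval x = 0
  · rw [count_roots, count_roots, le_rootMultiplicity_iff hQ, ← X_pow_dvd_taylor_iff,
      ← X_pow_dvd_coe_iff, ← taylorSeries_apply]
    refine dvd_trans ?_ (h x hx)
    rw [taylorSeries_apply, X_pow_dvd_coe_iff, X_pow_dvd_taylor_iff]
    exact pow_rootMultiplicity_dvd q x
  · rw [Multiset.count_eq_zero.2 (fun hmem => hx (isRoot_of_mem_roots hmem))]
    exact Nat.zero_le _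

theorem mul_derivative_pow (z : PowerSeries k) (n : ℕ) :
    z * PowerSeries.derivative k (z ^ n) = n * z ^ n * PowerSeries.derivative k z := by
  rcases n with _ | n
  · simp
  · rw [PowerSeries.derivative_pow, Nat.add_sub_cancel, pow_succ]; ring

variable {a b c n : ℕ} {μ ν : k}

theorem natDegree_logNum_le : (logNum a b c μ).natDegree ≤ 2 := by
  unfold logNum; compute_degree

theorem coeff_logNum : (logNum a b c μ).coeff 2 = a + b - c := by
  have h : logNum a b c μ = C ((a : k) + b - c) * X ^ 2 +
      C (-(a : k) - a * μ - b * μ + c) * X + C (a * μ) := by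
    unfold logNum
    simp only [map_add, map_sub, map_mul, map_neg]
    ring
  rw [h, coeff_add, coeff_add, coeff_C_mul, coeff_C_mul, coeff_X_pow, coeff_X, coeff_C]
  simp

/-- The logarithmic derivative of `s ^ a (s - 1) ^ b (s - μ) ^ (-c)` in terms of expansions:
`w + f₀` is the expansion of that function. -/
theorem taylorSeries_logNum_mul {x f₀ : k} {w : PowerSeries k} (hxμ : x ≠ μ)
    (hw : taylorSeries x (X - C μ) ^ c * (w + PowerSeries.C f₀) =
      taylorSeries x (C ν * X ^ a * (X - 1) ^ b)) :
    taylorSeries x (X * (X - 1) * (X - C μ)) * PowerSeries.derivative k w =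
      taylorSeries x (logNum a b c μ) * (w + PowerSeries.C f₀) := by
  have hu : taylorSeries x (X - C μ) ≠ 0 := fun h => by
    have := constantCoeff_taylorSeries x (X - C μ)
    rw [h, map_zero] at this
    simp at this
    exact hxμ (sub_eq_zero.1 this.symm)
  have hd : PowerSeries.derivative k (taylorSeries x (X - C μ)) = 1 := by
    rw [derivative_taylorSeries]; simp
  have h1 := congrArg (PowerSeries.derivative k) hw
  have e2 := mul_derivative_pow (taylorSeries x (X - C μ)) c
  rw [hd, mul_one] at e2
  rw [derivative_taylorSeries, Derivation.leibniz, smul_eq_mul, smul_eq_mul, map_add,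
    PowerSeries.derivative_C, add_zero] at h1
  have h2 : X * (X - 1) * derivative (C ν * X ^ a * (X - 1) ^ b) =
      (C (a : k) * (X - 1) + C (b : k) * X) * (C ν * X ^ a * (X - 1) ^ b) := by
    have e0 := X_sub_C_mul_derivative_pow (0 : k) a
    have e1 := X_sub_C_mul_derivative_pow (1 : k) b
    rw [map_zero, sub_zero] at e0
    rw [map_one] at e1
    simp only [derivative_mul, derivative_C]
    linear_combination (X - 1) * C ν * (X - 1) ^ b * e0 + X * C ν * X ^ a * e1
  have h3 := congrArg (taylorSeries x) h2
  rw [map_mul, map_mul _ _ (C ν * X ^ a * (X - 1) ^ b), ← hw] at h3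
  have h4 : taylorSeries x (logNum a b c μ) =
      taylorSeries x (C (a : k) * (X - 1) + C (b : k) * X) * taylorSeries x (X - C μ) -
        (c : PowerSeries k) * taylorSeries x (X * (X - 1)) := by
    have : (c : PowerSeries k) = taylorSeries x (C (c : k)) := by simp
    rw [this, ← map_mul, ← map_mul, ← map_sub]
    congr 1
    unfold logNum
    ring
  rw [h4, map_mul _ (X * (X - 1))]
  refine mul_left_cancel₀ (pow_ne_zero c hu) ?_
  set U := taylorSeries x (X - C μ)
  linear_combination (taylorSeries x (X * (X - 1))) * U * h1 + U * h3
    - (taylorSeries x (X * (X - 1))) * (w + PowerSeries.C f₀) * e2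

/-- If a rational function with poles only at `μ` is locally a power series in
`s ^ a (s - 1) ^ b (s - μ) ^ (-c)` at each critical point other than `0`, `1`, `μ`, `∞`, then it is
a polynomial in that function. -/
theorem mem_span_monomial_of_subst [IsAlgClosed k] [CharZero k] (ha : 0 < a) (hb : 0 < b)
    (hc : 0 < c) (hac : a.Coprime c) (habc : c < a + b) (hμ0 : μ ≠ 0) (hμ1 : μ ≠ 1) (f₀ : k → k)
    (w : k → PowerSeries k)
    (hw0 : ∀ x, (logNum a b c μ).eval x = 0 → PowerSeries.constantCoeff (w x) = 0)
    (hw : ∀ x, (logNum a b c μ).eval x = 0 → taylorSeries x (X - C μ) ^ c *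
      (w x + PowerSeries.C (f₀ x)) = taylorSeries x (C ν * X ^ a * (X - 1) ^ b))
    {P : k[X]} (hP : P.natDegree ≤ 2 * n)
    (hPw : ∀ x, (logNum a b c μ).eval x = 0 → ∃ h : PowerSeries k,
      taylorSeries x P = taylorSeries x (X - C μ) ^ n * h.subst (w x)) :
    P ∈ Submodule.span k {Q | ∃ m, c * m ≤ n ∧ Q = monomial a b c n μ m} := by
  have hroot : ∀ x, (logNum a b c μ).eval x = 0 → x ≠ 0 ∧ x ≠ 1 ∧ x ≠ μ := by
    refine fun x hx => ⟨?_, ?_, ?_⟩ <;> rintro rfl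
    · rw [logNum_eval_zero, mul_eq_zero] at hx
      exact hx.elim (by exact_mod_cast ha.ne') hμ0
    · rw [logNum_eval_one, mul_eq_zero] at hx
      exact hx.elim (by exact_mod_cast hb.ne') (sub_ne_zero.2 hμ1.symm)
    · rw [logNum_eval_mu, neg_eq_zero, mul_eq_zero, mul_eq_zero] at hx
      rcases hx with (hx | hx) | hx
      · exact absurd hx (by exact_mod_cast hc.ne')
      · exact hμ0 hx
      · exact hμ1 (sub_eq_zero.1 hx)
  have hlead : (logNum a b c μ).coeff 2 ≠ 0 := by
    rw [coeff_logNum]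
    have : ((a + b : ℕ) : k) ≠ (c : ℕ) := by exact_mod_cast habc.ne'
    push_cast at this
    exact sub_ne_zero.2 this
  have hl : logNum a b c μ ≠ 0 := fun h => hlead (by rw [h, coeff_zero])
  have hldeg : (logNum a b c μ).natDegree = 2 :=
    le_antisymm natDegree_logNum_le (le_natDegree_of_ne_zero hlead)
  let V : Submodule k k[X] :=
    { carrier := {P | P ∈ degreeLT k (2 * n + 1) ∧ ∀ x, (logNum a b c μ).eval x = 0 →
        ∃ h : PowerSeries k, taylorSeries x P = taylorSeries x (X - C μ) ^ n * h.subst (w x)}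
      add_mem' := by
        rintro P Q ⟨hP, hP'⟩ ⟨hQ, hQ'⟩
        refine ⟨add_mem hP hQ, fun x hx => ?_⟩
        obtain ⟨h, hh⟩ := hP' x hx
        obtain ⟨h', hh'⟩ := hQ' x hx
        refine ⟨h + h', ?_⟩
        rw [map_add, hh, hh',
          PowerSeries.subst_add (PowerSeries.HasSubst.of_constantCoeff_zero' (hw0 x hx)), mul_add]
      zero_mem' := by
        refine ⟨zero_mem _, fun x hx => ⟨0, ?_⟩⟩
        rw [map_zero, ← PowerSeries.coe_substAlgHom
          (PowerSeries.HasSubst.of_constantCoeff_zero' (hw0 x hx)), map_zero, mul_zero]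
      smul_mem' := by
        rintro r P ⟨hP, hP'⟩
        refine ⟨Submodule.smul_mem _ r hP, fun x hx => ?_⟩
        obtain ⟨h, hh⟩ := hP' x hx
        refine ⟨r • h, ?_⟩
        rw [PowerSeries.subst_smul (PowerSeries.HasSubst.of_constantCoeff_zero' (hw0 x hx)),
          smul_eq_C_mul, map_mul, hh, taylorSeries_C, PowerSeries.smul_eq_C_mul]
        ring }
  have hVdeg : V ≤ degreeLT k (2 * n + 1) := fun P hP => hP.1
  have : FiniteDimensional k (degreeLT k (2 * n + 1)) :=
    Module.Finite.equiv (degreeLTEquiv k (2 * n + 1)).symm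
  have : FiniteDimensional k V := Submodule.finiteDimensional_of_le hVdeg
  refine mem_span_monomial (n := n) ha hac hμ0 hμ1 V ?_ (P := P) ⟨?_, hPw⟩
  · rintro P ⟨hPdeg, hPw⟩
    have key : ∀ x, (logNum a b c μ).eval x = 0 → ∃ h : PowerSeries k,
        taylorSeries x (derivNum n μ P) =
          taylorSeries x (logNum a b c μ) * (taylorSeries x (X - C μ) ^ n * h.subst (w x)) := by
      intro x hx
      obtain ⟨h, hh⟩ := hPw x hx
      have hsub := PowerSeries.HasSubst.of_constantCoeff_zero' (hw0 x hx)
      refine ⟨(PowerSeries.X + PowerSeries.C (f₀ x)) * PowerSeries.derivative k h, ?_⟩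
      have h1 := taylorSeries_logNum_mul (hroot x hx).2.2 (hw x hx)
      have e2 := mul_derivative_pow (taylorSeries x (X - C μ)) n
      have hd : PowerSeries.derivative k (taylorSeries x (X - C μ)) = 1 := by
        rw [derivative_taylorSeries]; simp
      rw [hd, mul_one] at e2
      have h2 := congrArg (PowerSeries.derivative k) hh
      rw [derivative_taylorSeries, Derivation.leibniz, smul_eq_mul, smul_eq_mul,
        PowerSeries.derivative_subst hsub] at h2
      have hs : ((PowerSeries.X + PowerSeries.C (f₀ x)) * PowerSeries.derivative k h).subst (w x) =
          (w x + PowerSeries.C (f₀ x)) * (PowerSeries.derivative k h).subst (w x) := by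
        rw [PowerSeries.subst_mul hsub, PowerSeries.subst_add hsub, PowerSeries.subst_X hsub,
          PowerSeries.subst_C]
        rfl
      rw [hs]
      have h3 : taylorSeries x (derivNum n μ P) = taylorSeries x (X * (X - 1)) *
          (taylorSeries x (derivative P) * taylorSeries x (X - C μ) - n * taylorSeries x P) := by
        have : (n : PowerSeries k) = taylorSeries x (C (n : k)) := by simp
        rw [this, ← map_mul, ← map_mul, ← map_sub, ← map_mul]
        rfl
      rw [h3, h2, hh]
      rw [map_mul _ (X * (X - 1))] at h1
      linear_combination (taylorSeries x (X - C μ) ^ n * (PowerSeries.derivative k h).subst (w x))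
        * h1 + taylorSeries x (X * (X - 1)) * h.subst (w x) * e2
    obtain ⟨Q, hQ⟩ := dvd_of_taylor_dvd hl (Q := derivNum n μ P) fun x hx => by
      obtain ⟨h, hh⟩ := key x hx
      exact ⟨_, hh⟩
    refine ⟨Q, ⟨?_, fun x hx => ?_⟩, hQ.symm⟩
    · rw [mem_degreeLT]
      by_cases hQ0 : Q = 0
      · rw [hQ0, degree_zero]; exact WithBot.bot_lt_coe _
      have h1 : P.natDegree ≤ 2 * n := by
        by_cases hP0 : P = 0
        · simp [hP0]
        · have := mem_degreeLT.1 hPdeg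
          rw [← natDegree_lt_iff_degree_lt hP0] at this
          omega
      have h2 : (derivNum n μ P).natDegree ≤ 2 * n + 2 := by
        unfold derivNum
        have e1 : (derivative P * (X - C μ)).natDegree ≤ 2 * n := by
          by_cases hn : P.natDegree = 0
          · rw [eq_C_of_natDegree_eq_zero hn]; simp
          · have := natDegree_derivative_lt hn
            refine natDegree_mul_le.trans ?_
            rw [natDegree_X_sub_C]
            omega
        have e2 : (C (n : k) * P).natDegree ≤ 2 * n := (natDegree_C_mul_le _ _).trans h1
        have e3 := (natDegree_sub_le (derivative P * (X - C μ)) (C (n : k) * P)).trans (max_le e1 e2)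
        have e4 : (X * (X - 1) : k[X]).natDegree ≤ 2 := by compute_degree
        refine natDegree_mul_le.trans ?_
        omega
      rw [hQ, natDegree_mul hl hQ0, hldeg] at h2
      rw [← natDegree_lt_iff_degree_lt hQ0]
      omega
    · obtain ⟨h, hh⟩ := key x hx
      refine ⟨h, ?_⟩
      rw [hQ, map_mul] at hh
      refine mul_left_cancel₀ ?_ hh
      exact fun h0 => hl (taylorSeries_injective x (by rw [h0, map_zero]))
  · rw [mem_degreeLT]
    by_cases hP0 : P = 0
    · rw [hP0, degree_zero]; exact WithBot.bot_lt_coe _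
    · rw [← natDegree_lt_iff_degree_lt hP0]; omega

end EulerOperator

/-! ### Rational functions that are locally functions of `f` -/

section ConstantExtension

open Polynomial

theorem IsAlgClosed.mem_range_algebraMap_of_isAlgebraic {K k L : Type*} [Field K] [Field k] [Field L]
    [IsAlgClosed k] (i : K →+* k) (j : k →+* L) {z : L} {p : K[X]} (hp : p ≠ 0)
    (hz : p.eval₂ (j.comp i) z = 0) : z ∈ j.range := by
  refine (IsAlgClosed.splits (p.map i)).mem_range_of_isRoot (Polynomial.map_ne_zero hp) ?_
  rw [IsRoot.def, eval_map, eval₂_map, hz]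

/-- The constant extension from `K` to its algebraic closure: the extension of `K(s)` generated by
algebraic elements is contained in `K̄(s)`. -/
theorem exists_constantExtension (K : Type u) [Field K] :
    ∃ (κ : RatFunc K →+* RatFunc (AlgebraicClosure K))
      (i : AlgebraicClosure (RatFunc K) →+* AlgebraicClosure (RatFunc (AlgebraicClosure K))),
      (∀ c, κ (RatFunc.C c) = RatFunc.C (algebraMap K _ c)) ∧ κ RatFunc.X = RatFunc.X ∧
      (∀ a, i (algebraMap (RatFunc K) _ a) = algebraMap _ _ (κ a)) ∧
      ∀ z ∈ IntermediateField.adjoin (RatFunc K)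
        {α : AlgebraicClosure (RatFunc K) | IsAlgebraic K α},
        i z ∈ (algebraMap (RatFunc (AlgebraicClosure K)) _).range := by
  obtain ⟨κ, hκC, hκX⟩ := RatFunc.exists_ringHom
    (RatFunc.C.comp (algebraMap K (AlgebraicClosure K))) RatFunc.X fun p hp => by
      have h1 : algebraMap (AlgebraicClosure K)[X] (RatFunc (AlgebraicClosure K))
          (p.map (algebraMap K (AlgebraicClosure K))) = 0 := by
        rw [← hp, ← eval₂_map]
        conv_lhs => rw [← Polynomial.eval₂_C_X (p := p.map (algebraMap K (AlgebraicClosure K)))]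
        rw [hom_eval₂, RatFunc.algebraMap_X]
        congr 1
      have h2 := (map_eq_zero_iff _ (RatFunc.algebraMap_injective _)).1 h1
      exact (Polynomial.map_eq_zero _).1 h2
  let : Algebra (RatFunc K) (AlgebraicClosure (RatFunc (AlgebraicClosure K))) :=
    ((algebraMap (RatFunc (AlgebraicClosure K)) _).comp κ).toAlgebra
  let i : AlgebraicClosure (RatFunc K) →ₐ[RatFunc K]
    AlgebraicClosure (RatFunc (AlgebraicClosure K)) := IsAlgClosed.lift
  refine ⟨κ, i, hκC, hκX, fun a => i.commutes a, fun z hz => ?_⟩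
  induction hz using IntermediateField.adjoin_induction with
  | mem α hα =>
    obtain ⟨p, hp, hpα⟩ := hα
    obtain ⟨c, hc⟩ := IsAlgClosed.mem_range_algebraMap_of_isAlgebraic
      (algebraMap K (AlgebraicClosure K))
      ((algebraMap (RatFunc (AlgebraicClosure K))
        (AlgebraicClosure (RatFunc (AlgebraicClosure K)))).comp RatFunc.C) (z := i α) hp (by
      rw [← map_zero (i : AlgebraicClosure (RatFunc K) →+*
        AlgebraicClosure (RatFunc (AlgebraicClosure K))), ← hpα, aeval_def, hom_eval₂]
      congr 1
      ext c : 1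
      simp only [RingHom.comp_apply]
      rw [← RingHom.comp_apply RatFunc.C, ← hκC, ← RatFunc.algebraMap_eq_C, IsScalarTower.algebraMap_apply K (RatFunc K)]
      exact (i.commutes _).symm)
    exact ⟨_, hc⟩
  | algebraMap a => exact ⟨κ a, (i.commutes a).symm⟩
  | add x y _ _ hx hy => exact (map_add i x y).symm ▸ add_mem hx hy
  | inv x _ hx =>
    obtain ⟨c, hc⟩ := hx
    exact ⟨c⁻¹, by rw [map_inv₀, hc, RingHom.coe_coe, map_inv₀]⟩
  | mul x y _ _ hx hy => exact (map_mul i x y).symm ▸ mul_mem hx hy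

/-- A rational function that is integral over rational functions with poles only at `μ` has poles
only at `μ` (and possibly at infinity). -/
theorem exists_pow_mul_eq_algebraMap {A k : Type*} [CommRing A] [Field k] {μ : k}
    (E : A →+* RatFunc k)
    (hE : ∀ q, ∃ n Q, (RatFunc.X - RatFunc.C μ) ^ n * E q = algebraMap k[X] (RatFunc k) Q)
    {p : A[X]} (hp : p.Monic) {R : RatFunc k} (hR : p.eval₂ E R = 0) :
    ∃ (n : ℕ) (P : k[X]), P.natDegree ≤ 2 * n ∧
      (RatFunc.X - RatFunc.C μ) ^ n * R = algebraMap k[X] (RatFunc k) P := by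
  choose N Q hQ using hE
  have hu : RatFunc.X - RatFunc.C μ = algebraMap k[X] (RatFunc k) (X - C μ) := by simp
  set n₀ := p.support.sup fun i => N (p.coeff i) with hn₀
  set u := (RatFunc.X - RatFunc.C μ) ^ n₀ with hu'
  have hmem : ∀ i, E (p.coeff i) * u ∈ (algebraMap k[X] (RatFunc k)).range := by
    intro i
    by_cases hi : p.coeff i = 0
    · rw [hi, map_zero, zero_mul]; exact zero_mem _
    · have hle : N (p.coeff i) ≤ n₀ :=
        Finset.le_sup (f := fun i => N (p.coeff i)) (mem_support_iff.2 hi)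
      obtain ⟨d, hd⟩ := Nat.exists_eq_add_of_le hle
      rw [hu', hd, pow_add, mul_comm, mul_right_comm, hQ, hu, ← map_pow, ← map_mul]
      exact ⟨_, rfl⟩
  have humem : u ∈ (algebraMap k[X] (RatFunc k)).range := ⟨(X - C μ) ^ n₀, by rw [map_pow, ← hu]⟩
  have hmon : (p.map E).Monic := hp.map E
  have hlift : (p.map E).scaleRoots u ∈ lifts (algebraMap k[X] (RatFunc k)) := by
    rw [lifts_iff_coeff_lifts]
    intro i
    rw [coeff_scaleRoots, coeff_map]
    rcases lt_trichotomy i (p.map E).natDegree with h | h | h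
    · obtain ⟨d, hd⟩ := Nat.exists_eq_add_of_lt h
      rw [show (p.map E).natDegree - i = d + 1 by omega, pow_succ', ← mul_assoc]
      exact mul_mem (hmem i) (pow_mem humem d)
    · rw [h, Nat.sub_self, pow_zero, mul_one, ← coeff_map, hmon.coeff_natDegree]
      exact one_mem (algebraMap k[X] (RatFunc k)).range
    · rw [← coeff_map, coeff_eq_zero_of_natDegree_lt h, zero_mul]
      exact zero_mem (algebraMap k[X] (RatFunc k)).range
  obtain ⟨p', hp', -, hp'm⟩ := lifts_and_natDegree_eq_and_monic hlift ((monic_scaleRoots_iff u).2 hmon)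
  have hint : IsIntegral k[X] (u * R) := by
    refine ⟨p', hp'm, ?_⟩
    rw [← eval_map, hp', ← eval₂_id]
    refine scaleRoots_eval₂_eq_zero (RingHom.id _) ?_
    rw [eval₂_id, eval_map, hR]
  obtain ⟨P₀, hP₀⟩ := IsIntegrallyClosed.isIntegral_iff.1 hint
  refine ⟨n₀ + P₀.natDegree, (X - C μ) ^ P₀.natDegree * P₀, ?_, ?_⟩
  · refine natDegree_mul_le.trans ?_
    rw [natDegree_pow, natDegree_X_sub_C]
    omega
  · rw [map_mul, hP₀, map_pow, ← hu, pow_add, hu']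
    ring

/-- If `f` does not take a branch point as value, then a rational function in `N(s)` is locally a
power series in `f`. -/
theorem RegularGExtension.exists_powerSeries_of_root {K : Type u} [Field K] {G : Type v} [Group G]
    (N : RegularGExtension.{u, v, w} K G) {f₀ : AlgebraicClosure K}
    (φ : N.PuiseuxEmbedding (f₀ : OnePoint (AlgebraicClosure K)) 1) {y : N.carrier}
    (hy : ((algebraMap (RatFunc K) N.carrier).comp (algebraMap K[X] (RatFunc K))).IsIntegralElem y)
    {M : Type*} [Field M] (Φ : LaurentSeries (AlgebraicClosure K) →+* M) {Z : M}
    (hZ : (minpoly (RatFunc K) y).eval₂ ((Φ.comp φ.1).comp (algebraMap (RatFunc K) N.carrier)) Z = 0) :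
    ∃ h : PowerSeries (AlgebraicClosure K), Z = Φ (HahnSeries.ofPowerSeries ℤ _ h) := by
  have hint : IsIntegral (RatFunc K) y := Algebra.IsIntegral.isIntegral y
  obtain ⟨y', hy'⟩ : Z ∈ (Φ.comp φ.1).range := by
    refine (Normal.splits (F := RatFunc K) (K := N.carrier) inferInstance y).mem_range_of_isRoot
      (Polynomial.map_ne_zero (minpoly.ne_zero hint)) ?_
    rw [IsRoot.def, eval_map, eval₂_map, hZ]
  have hroot : aeval y' (minpoly (RatFunc K) y) = 0 := by
    refine (Φ.comp φ.1).injective ?_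
    rw [aeval_def, hom_eval₂, hy', hZ, map_zero]
  obtain ⟨p, hp, hpy⟩ := hy
  have hpy' : p.eval₂ ((algebraMap (RatFunc K) N.carrier).comp (algebraMap K[X] (RatFunc K))) y' = 0 := by
    have h1 : minpoly (RatFunc K) y ∣ p.map (algebraMap K[X] (RatFunc K)) :=
      minpoly.dvd _ _ (by rw [aeval_def, eval₂_map, hpy])
    have h2 := aeval_eq_zero_of_dvd_aeval_eq_zero h1 hroot
    rwa [aeval_def, eval₂_map] at h2
  have hint' : IsIntegral (PowerSeries (AlgebraicClosure K)) (φ.1 y') := by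
    let E : K[X] →+* PowerSeries (AlgebraicClosure K) :=
      eval₂RingHom (PowerSeries.C.comp (algebraMap K (AlgebraicClosure K)))
        (PowerSeries.C f₀ + PowerSeries.X)
    refine ⟨p.map E, hp.map E, ?_⟩
    rw [eval₂_map, ← map_zero φ.1, ← hpy', hom_eval₂]
    congr 1
    refine Polynomial.ringHom_ext (fun c => ?_) ?_
    · simp only [RingHom.comp_apply, LaurentSeries.coe_algebraMap, E, coe_eval₂RingHom, eval₂_C,
        HahnSeries.ofPowerSeries_C, RatFunc.algebraMap_C, N.algebraMap_C, φ.2.1]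
    · simp only [RingHom.comp_apply, LaurentSeries.coe_algebraMap, E, coe_eval₂RingHom, eval₂_X,
        map_add, HahnSeries.ofPowerSeries_C, HahnSeries.ofPowerSeries_X, RatFunc.algebraMap_X]
      refine Eq.trans ?_ φ.2.2.symm
      rw [puiseuxParameter_coe, Nat.cast_one]
  obtain ⟨h, hh⟩ := IsIntegrallyClosed.isIntegral_iff.1 hint'
  refine ⟨h, ?_⟩
  rw [← hy', RingHom.comp_apply, ← hh]
  rfl

/-- The descent of `mem_range_of_mem_adjoin_isAlgebraic` in terms of a homomorphism to a field. -/
theorem mem_range_of_mem_closure {K F N M : Type*} [Field K] [Field F] [Field N] [Field M]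
    [CharZero K] [Algebra K F] [Algebra K N] [Algebra F N] [IsScalarTower K F N]
    (hK : algebraicClosure K N = ⊥) (I : N →+* M) {y : N}
    (hy : I y ∈ Subfield.closure (Set.range (I.comp (algebraMap F N)) ∪
      {α | ∃ p : K[X], p ≠ 0 ∧ p.eval₂ (I.comp (algebraMap K N)) α = 0})) :
    y ∈ (algebraMap F N).range := by
  let : Algebra N M := I.toAlgebra
  let : Algebra F M := (I.comp (algebraMap F N)).toAlgebra
  let : Algebra K M := (I.comp (algebraMap K N)).toAlgebra
  have : IsScalarTower F N M := IsScalarTower.of_algebraMap_eq fun _ => rfl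
  have : IsScalarTower K N M := IsScalarTower.of_algebraMap_eq fun _ => rfl
  have : IsScalarTower K F M := IsScalarTower.of_algebraMap_eq fun c => by
    change I _ = I _
    rw [IsScalarTower.algebraMap_apply K F N]
  refine mem_range_of_mem_adjoin_isAlgebraic (K := K) (Ω := M) (fun x hx => ?_) hy
  have h1 := mem_algebraicClosure_iff.2 hx
  rw [hK] at h1
  exact IntermediateField.mem_bot.1 h1

end ConstantExtension

/-- The rational function `ν s ^ a (s - 1) ^ b / (s - μ) ^ c`. -/
noncomputable def powerQuotient {K : Type*} [Field K] (a b c : ℕ) (μ ν : K) : RatFunc K :=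
  RatFunc.C ν * RatFunc.X ^ a * (RatFunc.X - 1) ^ b / (RatFunc.X - RatFunc.C μ) ^ c

section PowerQuotient

open Polynomial EulerOperator

variable {K : Type u} [Field K] {a b c : ℕ} {μ ν : K}

theorem RatFunc.X_sub_C_ne_zero : RatFunc.X - RatFunc.C μ ≠ 0 := by
  rw [← RatFunc.algebraMap_X, ← RatFunc.algebraMap_C, ← map_sub]
  exact RatFunc.algebraMap_ne_zero (Polynomial.X_sub_C_ne_zero μ)

theorem powerQuotient_mul :
    powerQuotient a b c μ ν * (RatFunc.X - RatFunc.C μ) ^ c =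
      RatFunc.C ν * RatFunc.X ^ a * (RatFunc.X - 1) ^ b :=
  div_mul_cancel₀ _ (pow_ne_zero _ RatFunc.X_sub_C_ne_zero)

theorem powerQuotient_ne_C (ha : 0 < a) (hμ0 : μ ≠ 0) (hν : ν ≠ 0) :
    ¬ ∃ r, powerQuotient a b c μ ν = RatFunc.C r := by
  rintro ⟨r, hr⟩
  have h := powerQuotient_mul (a := a) (b := b) (c := c) (μ := μ) (ν := ν)
  rw [hr] at h
  have h1 : C r * (X - C μ) ^ c = C ν * X ^ a * (X - 1) ^ b := by
    apply RatFunc.algebraMap_injective K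
    simpa using h
  have h2 := congrArg (eval 0) h1
  simp [ha.ne', hμ0] at h2
  rw [h2] at h1
  simp only [map_zero, zero_mul] at h1
  exact mul_ne_zero (mul_ne_zero (C_ne_zero.2 hν) (pow_ne_zero a X_ne_zero))
    (pow_ne_zero _ (X_sub_C_ne_zero 1)) (by simpa using h1.symm)

/-- Linear disjointness of `N` from `K̄(s)` over `K(t)`, for `t = ν s ^ a (s - 1) ^ b / (s - μ) ^ c`
with critical values, other than `0` and `∞`, that are no branch points. -/
theorem RegularGExtension.mem_range_of_powerQuotient [CharZero K] {G : Type v} [Group G]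
    (N : RegularGExtension.{u, v, w} K G) (ha : 0 < a) (hb : 0 < b) (hc : 0 < c)
    (hac : a.Coprime c) (habc : c < a + b) (hμ0 : μ ≠ 0) (hμ1 : μ ≠ 1) (hν : ν ≠ 0)
    (hbr : ∀ x f₀ : AlgebraicClosure K, (logNum a b c (algebraMap K _ μ)).eval x = 0 →
      f₀ * (x - algebraMap K _ μ) ^ c = algebraMap K _ ν * x ^ a * (x - 1) ^ b →
      Nonempty (N.PuiseuxEmbedding (f₀ : OnePoint (AlgebraicClosure K)) 1))
    (ι : N.carrier →+* AlgebraicClosure (RatFunc K))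
    (hιC : ∀ r, ι (algebraMap K N.carrier r) = algebraMap K (AlgebraicClosure (RatFunc K)) r)
    (hιt : ι N.t = algebraMap (RatFunc K) (AlgebraicClosure (RatFunc K))
      (powerQuotient a b c μ ν)) (y : N.carrier)
    (hy : ι y ∈ IntermediateField.adjoin (RatFunc K)
        {α : AlgebraicClosure (RatFunc K) | IsAlgebraic K α}) :
    y ∈ (algebraMap (RatFunc K) N.carrier).range := by
  obtain ⟨κ, i, hκC, hκX, hi, hadj⟩ := exists_constantExtension K
  obtain ⟨θ, hθC, hθX⟩ := exists_ratFunc_subst (powerQuotient_ne_C (b := b) (c := c) ha hμ0 hν)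
  set μ' := algebraMap K (AlgebraicClosure K) μ with hμ'
  set ν' := algebraMap K (AlgebraicClosure K) ν with hν'
  have hν'0 : ν' ≠ 0 := (_root_.map_ne_zero _).2 hν
  have hμ'0 : μ' ≠ 0 := (_root_.map_ne_zero _).2 hμ0
  have hμ'1 : μ' ≠ 1 := fun h => hμ1 ((algebraMap K (AlgebraicClosure K)).injective (by rw [map_one]; exact h))
  set f' := powerQuotient a b c μ' ν' with hf'
  have hκf : κ (powerQuotient a b c μ ν) = f' := by
    simp only [powerQuotient, hf', map_div₀, map_mul, map_pow, map_sub, map_one, hκC, hκX, ← hμ', ← hν']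
  -- the homomorphism `K(t) → K̄(s)` that underlies `i ∘ ι`
  set Ψ := κ.comp θ with hΨ
  have hΨC : ∀ r, Ψ (RatFunc.C r) = RatFunc.C (algebraMap K _ r) := fun r => by
    rw [hΨ, RingHom.comp_apply, hθC, hκC]
  have hΨX : Ψ RatFunc.X = f' := by rw [hΨ, RingHom.comp_apply, hθX, hκf]
  set I := i.comp ι with hI
  have hIC : ∀ r, I (algebraMap K N.carrier r) =
      algebraMap (RatFunc (AlgebraicClosure K)) _ (RatFunc.C (algebraMap K _ r)) := fun r => by
    rw [hI, RingHom.comp_apply, hιC, IsScalarTower.algebraMap_apply K (RatFunc K), hi,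
      RatFunc.algebraMap_eq_C, hκC]
  have hIΨ : I.comp (algebraMap (RatFunc K) N.carrier) =
      (algebraMap (RatFunc (AlgebraicClosure K)) _).comp Ψ := by
    refine RatFunc.ringHom_ext_of_C_of_X (fun r => ?_) ?_
    · change I (algebraMap _ _ _) = algebraMap _ _ (Ψ _)
      rw [N.algebraMap_C, hIC, hΨC]
    · change i (ι N.t) = algebraMap _ _ (Ψ _)
      rw [hΨX, hιt, hi, hκf]
  -- reduction to elements that are integral over `K[t]`
  wlog hyint : ((algebraMap (RatFunc K) N.carrier).comp
      (algebraMap K[X] (RatFunc K))).IsIntegralElem y generalizing y with H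
  · let : Algebra K[X] N.carrier := ((algebraMap (RatFunc K) N.carrier).comp
      (algebraMap K[X] (RatFunc K))).toAlgebra
    have : IsScalarTower K[X] (RatFunc K) N.carrier := IsScalarTower.of_algebraMap_eq fun _ => rfl
    obtain ⟨D, hD⟩ := IsIntegral.exists_multiple_integral_of_isLocalization
      (nonZeroDivisors K[X]) (Rₘ := RatFunc K) y (Algebra.IsIntegral.isIntegral y)
    have hDy : D • y = algebraMap (RatFunc K) N.carrier (algebraMap K[X] (RatFunc K) D) * y :=
      Algebra.smul_def (D : K[X]) y
    rw [hDy] at hD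
    have hD0 : algebraMap (RatFunc K) N.carrier (algebraMap K[X] (RatFunc K) D) ≠ 0 :=
      (_root_.map_ne_zero _).2 (RatFunc.algebraMap_ne_zero (nonZeroDivisors.ne_zero D.2))
    have hιθ : ∀ r, ι (algebraMap (RatFunc K) N.carrier r) = algebraMap (RatFunc K) _ (θ r) := by
      refine RingHom.congr_fun (f := ι.comp _) (g := (algebraMap _ _).comp θ)
        (RatFunc.ringHom_ext_of_C_of_X (fun r => ?_) ?_)
      · rw [RingHom.comp_apply, RingHom.comp_apply, N.algebraMap_C, hιC, hθC,
          ← RatFunc.algebraMap_eq_C, ← IsScalarTower.algebraMap_apply]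
      · rw [RingHom.comp_apply, RingHom.comp_apply, hθX, ← hιt]; rfl
    obtain ⟨q, hq⟩ := H _ (by
      rw [map_mul, hιθ]
      exact mul_mem (IntermediateField.algebraMap_mem _ _) hy) hD
    refine ⟨q / algebraMap K[X] (RatFunc K) D, ?_⟩
    rw [map_div₀, hq, mul_div_cancel_left₀ _ hD0]
  obtain ⟨R, hR⟩ := hadj _ hy
  have hRI : algebraMap _ _ R = I y := hR
  have hmin : (minpoly (RatFunc K) y).eval₂ Ψ R = 0 := by
    refine (algebraMap (RatFunc (AlgebraicClosure K)) (AlgebraicClosure (RatFunc (AlgebraicClosure K)))).injective ?_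
    rw [hom_eval₂, ← hIΨ, hRI, ← hom_eval₂, ← aeval_def, minpoly.aeval, map_zero, map_zero]
  obtain ⟨p, hp, hpy⟩ := id hyint
  have hpR : p.eval₂ (Ψ.comp (algebraMap K[X] (RatFunc K))) R = 0 := by
    refine (algebraMap (RatFunc (AlgebraicClosure K)) (AlgebraicClosure (RatFunc (AlgebraicClosure K)))).injective ?_
    rw [hom_eval₂, ← RingHom.comp_assoc, ← hIΨ, hRI, RingHom.comp_assoc, ← hom_eval₂, hpy, map_zero, map_zero]
  have hden : (RatFunc.X - RatFunc.C μ' : RatFunc (AlgebraicClosure K)) ≠ 0 := RatFunc.X_sub_C_ne_zero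
  have hfmul : (RatFunc.X - RatFunc.C μ') ^ c * f' =
      RatFunc.C ν' * RatFunc.X ^ a * (RatFunc.X - 1) ^ b := by
    rw [mul_comm]; exact powerQuotient_mul
  obtain ⟨n, P, hPdeg, hP⟩ := exists_pow_mul_eq_algebraMap (μ := μ')
    (Ψ.comp (algebraMap K[X] (RatFunc K))) (fun q => by
      induction q using Polynomial.induction_on' with
      | add p q hp hq =>
        obtain ⟨n, P, hP⟩ := hp
        obtain ⟨m, Q, hQ⟩ := hq
        refine ⟨n + m, (X - C μ') ^ m * P + (X - C μ') ^ n * Q, ?_⟩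
        rw [map_add, map_add, map_mul, map_mul, ← hP, ← hQ, map_pow, map_pow, map_sub,
          RatFunc.algebraMap_X, RatFunc.algebraMap_C]
        ring
      | monomial m r =>
        refine ⟨c * m, C (algebraMap K _ r) * (C ν' * X ^ a * (X - 1) ^ b) ^ m, ?_⟩
        rw [← C_mul_X_pow_eq_monomial]
        simp only [RingHom.comp_apply, map_mul, map_pow, map_sub, map_one, RatFunc.algebraMap_X,
          RatFunc.algebraMap_C, hΨC, hΨX]
        rw [pow_mul, ← hfmul]
        ring) hp hpR
  have hroot : ∀ x, (logNum a b c μ').eval x = 0 → x ≠ μ' := by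
    rintro x hx rfl
    rw [logNum_eval_mu, neg_eq_zero, mul_eq_zero, mul_eq_zero] at hx
    have : CharZero (AlgebraicClosure K) :=
      charZero_of_injective_algebraMap (algebraMap K (AlgebraicClosure K)).injective
    rcases hx with (hx | hx) | hx
    · exact absurd hx (by exact_mod_cast hc.ne')
    · exact hμ'0 hx
    · exact hμ'1 (sub_eq_zero.1 hx)
  let f₀ : AlgebraicClosure K → AlgebraicClosure K := fun x =>
    ν' * x ^ a * (x - 1) ^ b / (x - μ') ^ c
  let g : (AlgebraicClosure K)[X] := C ν' * X ^ a * (X - 1) ^ b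
  let W : AlgebraicClosure K → PowerSeries (AlgebraicClosure K) := fun x =>
    (taylorSeries x (X - C μ') ^ c)⁻¹ * taylorSeries x g - PowerSeries.C (f₀ x)
  have hcc : ∀ x, x ≠ μ' → PowerSeries.constantCoeff (taylorSeries x (X - C μ') ^ c) ≠ 0 := by
    intro x hx
    rw [map_pow, constantCoeff_taylorSeries]
    simpa using pow_ne_zero c (sub_ne_zero.2 hx)
  have hW0 : ∀ x, PowerSeries.constantCoeff (W x) = 0 := by
    intro x
    simp only [W, map_sub, map_mul, PowerSeries.constantCoeff_inv, map_pow,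
      constantCoeff_taylorSeries, PowerSeries.constantCoeff_C, f₀, g]
    simp only [eval_X, eval_C, eval_one]
    ring
  have hW : ∀ x, x ≠ μ' → taylorSeries x (X - C μ') ^ c * (W x + PowerSeries.C (f₀ x)) =
      taylorSeries x g := by
    intro x hx
    simp only [W, sub_add_cancel]
    rw [← mul_assoc, PowerSeries.mul_inv_cancel _ (hcc x hx), one_mul]
  have hWne : ∀ x, x ≠ μ' → W x ≠ 0 := by
    intro x hx h0
    have h1 := hW x hx
    rw [h0, zero_add, ← taylorSeries_C x, ← map_pow, ← map_mul] at h1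
    refine powerQuotient_ne_C (b := b) (c := c) ha hμ'0 hν'0 ⟨f₀ x, ?_⟩
    refine mul_left_cancel₀ (pow_ne_zero c hden) ?_
    rw [hfmul]
    have h2 := congrArg (algebraMap _ (RatFunc (AlgebraicClosure K))) (taylorSeries_injective x h1)
    simpa [g] using h2.symm
  have : CharZero (AlgebraicClosure K) :=
    charZero_of_injective_algebraMap (algebraMap K (AlgebraicClosure K)).injective
  have hspan := mem_span_monomial_of_subst (n := n) (ν := ν') ha hb hc hac habc hμ'0 hμ'1 f₀ W
    (fun x _ => hW0 x) (fun x hx => hW x (hroot x hx)) hPdeg (fun x hx => by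
      obtain ⟨φ⟩ := hbr x (f₀ x) hx
        (div_mul_cancel₀ _ (pow_ne_zero c (sub_ne_zero.2 (hroot x hx))))
      obtain ⟨E, hEC, hEX⟩ := RatFunc.exists_ringHom_laurentSeries
        (RingHom.id (AlgebraicClosure K))
        (puiseuxParameter_notMem_range (x : OnePoint (AlgebraicClosure K)) one_pos)
      rw [puiseuxParameter_coe, Nat.cast_one] at hEX
      have hEP : ∀ Q, E (algebraMap _ _ Q) = HahnSeries.ofPowerSeries ℤ _ (taylorSeries x Q) := by
        refine RingHom.congr_fun (f := E.comp (algebraMap _ _))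
          (g := (HahnSeries.ofPowerSeries ℤ _).comp (taylorSeries x))
          (Polynomial.ringHom_ext (fun r => ?_) ?_)
        · rw [RingHom.comp_apply, RingHom.comp_apply, RatFunc.algebraMap_C, hEC, taylorSeries_C,
            HahnSeries.ofPowerSeries_C, RingHom.id_apply]
        · rw [RingHom.comp_apply, RingHom.comp_apply, RatFunc.algebraMap_X, hEX, taylorSeries_X,
            map_add, HahnSeries.ofPowerSeries_C, HahnSeries.ofPowerSeries_X, add_comm]
      have hXμ : algebraMap (AlgebraicClosure K)[X] (RatFunc (AlgebraicClosure K)) (X - C μ') =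
          RatFunc.X - RatFunc.C μ' := by simp
      have hEf : E f' = HahnSeries.C (f₀ x) + HahnSeries.ofPowerSeries ℤ _ (W x) := by
        refine mul_left_cancel₀ (pow_ne_zero c ((_root_.map_ne_zero E).2 hden)) ?_
        have h1 := hW x (hroot x hx)
        rw [← map_pow, ← map_mul, hfmul, ← HahnSeries.ofPowerSeries_C, ← map_add,
          add_comm, ← hXμ, ← map_pow, hEP, ← map_mul, map_pow, h1, ← hEP]
        simp [g]
      set Φ := LaurentSeries.subst (W x) (hW0 x) (hWne x (hroot x hx)) with hΦ
      have hEΨ : (Φ.comp φ.1).comp (algebraMap (RatFunc K) N.carrier) = E.comp Ψ := by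
        refine RatFunc.ringHom_ext_of_C_of_X (fun r => ?_) ?_
        · rw [RingHom.comp_apply, RingHom.comp_apply, N.algebraMap_C, φ.2.1, hΦ,
            LaurentSeries.subst_C, RingHom.comp_apply, hΨC, hEC, RingHom.id_apply]
        · rw [RingHom.comp_apply, RingHom.comp_apply, RingHom.comp_apply, hΨX, hEf]
          refine (congrArg Φ φ.2.2).trans ?_
          rw [puiseuxParameter_coe, map_add, hΦ, LaurentSeries.subst_C, Nat.cast_one,
            LaurentSeries.subst_X]
      obtain ⟨h, hh⟩ := N.exists_powerSeries_of_root φ hyint Φ (Z := E R) (by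
        rw [hEΨ, ← hom_eval₂, hmin, map_zero])
      refine ⟨h, ?_⟩
      apply HahnSeries.ofPowerSeries_injective (Γ := ℤ)
      rw [← hEP, ← hP, map_mul, hh, hΦ, LaurentSeries.subst_ofPowerSeries, map_mul, map_pow, map_pow,
        ← hXμ, hEP])
  refine mem_range_of_mem_closure (K := K) (F := RatFunc K) N.regular I ?_
  set S := Subfield.closure (Set.range (I.comp (algebraMap (RatFunc K) N.carrier)) ∪
      {α | ∃ p : K[X], p ≠ 0 ∧ p.eval₂ (I.comp (algebraMap K N.carrier)) α = 0}) with hS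
  have hSC : ∀ r : AlgebraicClosure K, algebraMap (RatFunc (AlgebraicClosure K)) _ (RatFunc.C r) ∈ S := by
    intro r
    refine Subfield.subset_closure (Or.inr ?_)
    obtain ⟨p, hp, hpr⟩ : IsAlgebraic K r := Algebra.IsAlgebraic.isAlgebraic r
    refine ⟨p, hp, ?_⟩
    rw [aeval_def] at hpr
    rw [← map_zero ((algebraMap (RatFunc (AlgebraicClosure K))
      (AlgebraicClosure (RatFunc (AlgebraicClosure K)))).comp RatFunc.C), ← hpr, hom_eval₂]
    congr 1
    ext r : 1
    rw [RingHom.comp_apply, hIC]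
    rfl
  have hSf : algebraMap (RatFunc (AlgebraicClosure K)) _ f' ∈ S := by
    refine Subfield.subset_closure (Or.inl ⟨RatFunc.X, ?_⟩)
    rw [hIΨ, RingHom.comp_apply, hΨX]
  have hSspan : ∀ Q ∈ Submodule.span (AlgebraicClosure K)
      {Q | ∃ m, c * m ≤ n ∧ Q = EulerOperator.monomial a b c n μ' m},
      algebraMap (RatFunc (AlgebraicClosure K)) _
        (algebraMap (AlgebraicClosure K)[X] (RatFunc (AlgebraicClosure K)) Q /
          (RatFunc.X - RatFunc.C μ') ^ n) ∈ S := by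
    intro Q hQ
    induction hQ using Submodule.span_induction with
    | mem Q hQ =>
      obtain ⟨m, hm, rfl⟩ := hQ
      have h1 : algebraMap (AlgebraicClosure K)[X] (RatFunc (AlgebraicClosure K))
          (EulerOperator.monomial a b c n μ' m) / (RatFunc.X - RatFunc.C μ') ^ n =
            ((RatFunc.C ν')⁻¹ * f') ^ m := by
        have hν'' : RatFunc.C ν' ≠ 0 := (_root_.map_ne_zero _).2 hν'0
        rw [div_eq_iff (pow_ne_zero _ hden), ← Nat.sub_add_cancel hm, pow_add,
          pow_mul (RatFunc.X - RatFunc.C μ') c m, mul_left_comm, ← mul_pow, mul_assoc,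
          mul_comm f', hfmul, mul_assoc (RatFunc.C ν'), inv_mul_cancel_left₀ hν'']
        simp only [EulerOperator.monomial, map_mul, map_pow, map_sub, map_one,
          RatFunc.algebraMap_X, RatFunc.algebraMap_C, Nat.sub_add_cancel hm]
        ring
      rw [h1, map_pow, map_mul, map_inv₀]
      exact pow_mem (mul_mem (inv_mem (hSC _)) hSf) m
    | zero => simp
    | add P Q _ _ hP hQ => rw [map_add, add_div, map_add]; exact add_mem hP hQ
    | smul r Q _ hQ =>
      rw [smul_eq_C_mul, map_mul, RatFunc.algebraMap_C, mul_div_assoc, map_mul]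
      exact mul_mem (hSC r) hQ
  have hfin := hSspan P hspan
  rw [← hP, mul_div_cancel_left₀ _ (pow_ne_zero n hden), hRI] at hfin
  exact hfin

end PowerQuotient

/-! ### Inertia and ramification in towers of number fields -/

section Inertia

open IsDedekindDomain

/-- A Galois subextension on which an inertia group acts trivially is unramified. -/
theorem isUnramifiedIn_of_inertia_fixes {K F E : Type*} [Field K] [Field F] [Field E] [NumberField K]
    [NumberField F] [NumberField E] [Algebra K F] [Algebra F E] [Algebra K E] [IsScalarTower K F E]
    [IsGalois K F] [IsGalois K E] (𝔭 : HeightOneSpectrum (𝓞 K)) (𝔓 : Ideal (𝓞 E)) [𝔓.IsPrime]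
    [𝔓.LiesOver 𝔭.asIdeal]
    (h : ∀ σ ∈ 𝔓.inertia Gal(E/K), ∀ x : F, σ (algebraMap F E x) = algebraMap F E x) :
    Algebra.IsUnramifiedIn (𝓞 F) 𝔭.asIdeal := by
  have : IsGalois F E := IsGalois.tower_top_of_isGalois K F E
  set 𝔔 : Ideal (𝓞 F) := 𝔓.under (𝓞 F) with h𝔔
  have : 𝔔.LiesOver 𝔭.asIdeal := Ideal.LiesOver.tower_bot 𝔓 𝔔 𝔭.asIdeal
  have h𝔭 : 𝔭.asIdeal.IsPrime := 𝔭.isPrime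
  have : 𝔭.asIdeal.IsMaximal := 𝔭.isMaximal
  have h𝔔b : 𝔔 ≠ ⊥ := Ideal.ne_bot_of_liesOver_of_ne_bot 𝔭.ne_bot 𝔔
  have : 𝔔.IsMaximal := Ideal.IsPrime.isMaximal inferInstance h𝔔b
  have : Finite (𝓞 K ⧸ 𝔭.asIdeal) := Ideal.finiteQuotientOfFreeOfNeBot _ 𝔭.ne_bot
  have : Finite (𝓞 F ⧸ 𝔔) := Ideal.finiteQuotientOfFreeOfNeBot _ h𝔔b
  have c1 := Ideal.card_inertia_eq_ramificationIdxIn (G := Gal(E/K)) 𝔭.asIdeal 𝔓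
  have c2 := Ideal.card_inertia_eq_ramificationIdxIn (G := Gal(E/F)) 𝔔 𝔓
  have hle : Nat.card (𝔓.inertia Gal(E/K)) ≤ Nat.card (𝔓.inertia Gal(E/F)) := by
    let f : 𝔓.inertia Gal(E/K) → 𝔓.inertia Gal(E/F) := fun σ =>
      ⟨AlgEquiv.ofRingEquiv (f := (σ.1 : E ≃+* E)) (fun x => h σ.1 σ.2 x), fun x => σ.2 x⟩
    refine Nat.card_le_card_of_injective f fun σ τ hστ => ?_
    apply Subtype.ext
    apply AlgEquiv.ext
    intro x
    exact AlgEquiv.congr_fun (congrArg Subtype.val hστ) x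
  have htower := Ideal.ramificationIdxIn_mul_ramificationIdxIn (p := 𝔭.asIdeal) 𝔔 Gal(F/K) (𝓞 E)
    Gal(E/K) Gal(E/F)
  have hpos := Ideal.ramificationIdxIn_ne_zero (A := 𝓞 F) (B := 𝓞 E) (p := 𝔔) Gal(E/F)
  have hpos' := Ideal.ramificationIdxIn_ne_zero (A := 𝓞 K) (B := 𝓞 F) (p := 𝔭.asIdeal) Gal(F/K)
  rw [c1, c2, ← htower] at hle
  have h1 : 𝔭.asIdeal.ramificationIdxIn (𝓞 F) = 1 := by
    have h2 : 𝔭.asIdeal.ramificationIdxIn (𝓞 F) * 𝔔.ramificationIdxIn (𝓞 E) ≤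
        1 * 𝔔.ramificationIdxIn (𝓞 E) := by rwa [one_mul]
    have h3 := Nat.le_of_mul_le_mul_right h2 (Nat.pos_of_ne_zero hpos)
    omega
  rw [Algebra.isUnramifiedIn_iff_forall_ramificationIdx_eq_one]
  intro P _ hP
  rw [← Ideal.ramificationIdxIn_eq_ramificationIdx 𝔭.asIdeal P Gal(F/K), h1]

end Inertia

/-! ### Rationality of a rescaled Puiseux embedding -/

section Rationality

theorem RingHom.exists_lift_of_range_le {A B C : Type*} [Ring A] [Ring B] [Ring C] (f : A →+* C)
    {i : B →+* C} (hi : Function.Injective i) (h : ∀ a, f a ∈ i.range) :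
    ∃ f' : A →+* B, ∀ a, i (f' a) = f a := by
  choose F hF using h
  exact ⟨{ toFun := F
           map_one' := hi (by rw [hF, map_one, map_one])
           map_mul' := fun a b => hi (by rw [hF, map_mul, map_mul, hF, hF])
           map_zero' := hi (by rw [hF, map_zero, map_zero])
           map_add' := fun a b => hi (by rw [hF, map_add, map_add, hF, hF]) }, hF⟩

theorem LaurentSeries.mem_range_twist {k l : Type*} [Field k] [Field l] (i : k →+* l)
    (x : LaurentSeries l) (hx : ∀ n, x.coeff n ∈ i.range) : x ∈ (twist i 1).range := by
  choose c hc using hx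
  have hsupp : Function.support c = Function.support x.coeff := by
    ext n
    rw [Function.mem_support, Function.mem_support, ← hc n, Ne, Ne, map_eq_zero]
  refine ⟨⟨c, hsupp ▸ x.isPWO_support⟩, ?_⟩
  ext n
  rw [twist_coeff, hc]
  simp

namespace RegularGExtension

open PuiseuxEmbedding

variable {K : Type u} [Field K] {G : Type v} [Group G]
  {N : RegularGExtension.{u, v, w} K G} {e : ℕ}

theorem PuiseuxEmbedding.coeff_t (φ : N.PuiseuxEmbedding ((0 : AlgebraicClosure K) : OnePoint _) e) :
    (φ.1 N.t).coeff e = 1 := by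
  rw [φ.2.2, puiseuxParameter_coe, map_zero, zero_add, HahnSeries.coeff_single_same]

/-- An automorphism of `K̄` over `K(ζ)` acts on the coefficients of a Puiseux embedding like a power
of the generator of inertia, because it commutes with inertia. -/
theorem PuiseuxEmbedding.Rotates.exists_galois_action [Finite G]
    {φ : N.PuiseuxEmbedding ((0 : AlgebraicClosure K) : OnePoint _) e} {z : AlgebraicClosure K}
    {g : G} (hg : φ.Rotates z g)
    (hcent : Subgroup.centralizer (Subgroup.zpowers g : Set G) = Subgroup.zpowers g)
    (σ : AlgebraicClosure K ≃ₐ[K] AlgebraicClosure K) (hσ : σ z = z) :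
    ∃ i : ℕ, ∀ x n, σ ((φ.1 x).coeff n) = (z ^ i) ^ n * (φ.1 x).coeff n := by
  let T := LaurentSeries.twist (σ : AlgebraicClosure K →+* AlgebraicClosure K) 1
  have hT : ∀ x n, (T x).coeff n = σ (x.coeff n) := fun x n => by
    simp [T, LaurentSeries.twist_coeff]
  let ψ : N.PuiseuxEmbedding ((0 : AlgebraicClosure K) : OnePoint _) e :=
    ⟨T.comp φ.1, fun c => by
      rw [RingHom.comp_apply, φ.2.1, LaurentSeries.twist_C]
      exact congrArg _ (σ.commutes c), by
      rw [RingHom.comp_apply, φ.2.2, puiseuxParameter_coe, map_zero, zero_add,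
        LaurentSeries.twist_single]
      simp⟩
  obtain ⟨h, hh⟩ := φ.exists_gal ψ
  have hh' : ∀ x n, (φ.1 (N.gal.symm h x)).coeff n = σ ((φ.1 x).coeff n) := fun x n => by
    rw [← hh, ← hT]; rfl
  have hcomm : h * g = g * h := by
    apply N.gal.symm.injective
    apply AlgEquiv.ext
    intro x
    apply φ.1.injective
    ext n
    rw [gal_symm_mul_apply, gal_symm_mul_apply, hh', hg, hg, hh', map_mul, map_zpow₀, hσ]
  have hmem : h ∈ Subgroup.zpowers g := by
    rw [← hcent, Subgroup.mem_centralizer_iff]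
    rintro _ ⟨j, rfl⟩
    have hc : Commute g h := hcomm.symm
    exact (hc.zpow_left j)
  obtain ⟨i, rfl⟩ := mem_powers_iff_mem_zpowers.2 hmem
  exact ⟨i, fun x n => by rw [← hh', hg.pow i]⟩

/-- If the inertia group at `0` is its own centralizer, then after rescaling the parameter the
Puiseux embedding is defined over `K(ζ)`. -/
theorem PuiseuxEmbedding.Rotates.exists_rational [Finite G] [CharZero K] (he : 0 < e)
    {φ : N.PuiseuxEmbedding ((0 : AlgebraicClosure K) : OnePoint _) e} {z : AlgebraicClosure K}
    (hz : IsPrimitiveRoot z e) {g : G} (hg : φ.Rotates z g) (hord : orderOf g = e)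
    (hcent : Subgroup.centralizer (Subgroup.zpowers g : Set G) = Subgroup.zpowers g) :
    ∃ (c : IntermediateField.adjoin K {z}) (_ : c ≠ 0)
      (φ' : N.carrier →+* LaurentSeries (IntermediateField.adjoin K {z})),
      (∀ r, φ' (algebraMap K N.carrier r) = HahnSeries.C (algebraMap K _ r)) ∧
      φ' N.t = HahnSeries.single (e : ℤ) c⁻¹ := by
  have hz0 : z ≠ 0 := hz.ne_zero he.ne'
  have hL : ∀ x : AlgebraicClosure K,
      (∀ σ : AlgebraicClosure K ≃ₐ[K] AlgebraicClosure K, σ z = z → σ x = x) →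
        x ∈ IntermediateField.adjoin K {z} := by
    intro x hx
    rw [← InfiniteGalois.fixedField_fixingSubgroup (IntermediateField.adjoin K {z})]
    intro σ
    exact hx σ.1 (σ.2 ⟨z, IntermediateField.mem_adjoin_simple_self K z⟩)
  have hact := fun σ : {σ : AlgebraicClosure K ≃ₐ[K] AlgebraicClosure K // σ z = z} =>
    hg.exists_galois_action hcent σ.1 σ.2
  choose i hi using hact
  -- the degrees in which some element transforms like a coefficient
  let H : AddSubgroup ℤ :=
    { carrier := {n | ∃ β : AlgebraicClosure K, β ≠ 0 ∧
        ∀ σ, σ.1 β = (z ^ i σ) ^ n * β}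
      zero_mem' := ⟨1, one_ne_zero, fun σ => by simp⟩
      add_mem' := by
        rintro a b ⟨β, hβ, hβσ⟩ ⟨β', hβ', hβσ'⟩
        refine ⟨β * β', mul_ne_zero hβ hβ', fun σ => ?_⟩
        rw [map_mul, hβσ, hβσ', zpow_add₀ (pow_ne_zero _ hz0)]
        ring
      neg_mem' := by
        rintro a ⟨β, hβ, hβσ⟩
        refine ⟨β⁻¹, inv_ne_zero hβ, fun σ => ?_⟩
        rw [map_inv₀, hβσ, mul_inv, zpow_neg] }
  have hH : ∀ x n, (φ.1 x).coeff n ≠ 0 → n ∈ H := fun x n hx => ⟨_, hx, fun σ => hi σ x n⟩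
  obtain ⟨m₀, hm₀⟩ := Int.subgroup_cyclic H
  have hm : ∀ n, n ∈ H ↔ (m₀.natAbs : ℤ) ∣ n := by
    intro n
    rw [hm₀, ← AddSubgroup.zmultiples_eq_closure, Int.mem_zmultiples_iff, Int.natAbs_dvd]
  set m := m₀.natAbs
  have hme : m ∣ e := by
    have := (hm e).1 (hH N.t e (by rw [φ.coeff_t]; exact one_ne_zero))
    exact_mod_cast this
  obtain ⟨e', he'⟩ := hme
  have hge : g ^ e' = 1 := by
    apply N.gal.symm.injective
    apply AlgEquiv.ext
    intro x
    apply φ.1.injective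
    ext n
    rw [hg.pow e', gal_symm_one_apply]
    by_cases hx : (φ.1 x).coeff n = 0
    · rw [hx, mul_zero]
    · obtain ⟨j, rfl⟩ := (hm n).1 (hH x n hx)
      rw [zpow_mul, zpow_natCast, ← pow_mul, mul_comm e', ← he', hz.pow_eq_one, one_zpow, one_mul]
  have hm1 : m = 1 := by
    have h1 := orderOf_dvd_of_pow_eq_one hge
    rw [hord] at h1
    have he'0 : 0 < e' := Nat.pos_of_ne_zero (by rintro rfl; simp at he'; omega)
    have h2 := Nat.le_of_dvd he'0 h1
    have hm0 : 0 < m := Nat.pos_of_ne_zero (by rintro h; rw [h] at he'; simp at he'; omega)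
    nlinarith
  obtain ⟨γ, hγ, hγσ⟩ := (hm 1).2 (by rw [hm1]; simp)
  have hcoef : ∀ x n, (φ.1 x).coeff n * γ ^ (-n) ∈ IntermediateField.adjoin K {z} := by
    intro x n
    refine hL _ fun σ hσ => ?_
    rw [map_mul, map_zpow₀, hi ⟨σ, hσ⟩, hγσ ⟨σ, hσ⟩, zpow_one, mul_zpow, zpow_neg (z ^ _)]
    have : (z ^ i ⟨σ, hσ⟩) ^ n ≠ 0 := zpow_ne_zero _ (pow_ne_zero _ hz0)
    field_simp
  have hc : γ ^ e ∈ IntermediateField.adjoin K {z} := by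
    have := hcoef N.t e
    rw [φ.coeff_t, one_mul, zpow_neg, zpow_natCast] at this
    exact inv_mem_iff.1 this
  let j : IntermediateField.adjoin K {z} →+* AlgebraicClosure K := algebraMap _ _
  let T := LaurentSeries.twist (RingHom.id (AlgebraicClosure K)) (Units.mk0 γ hγ)⁻¹
  have hT : ∀ x n, (T x).coeff n = x.coeff n * γ ^ (-n) := fun x n => by
    simp [T, LaurentSeries.twist_coeff, mul_comm]
  obtain ⟨φ', hφ'⟩ := RingHom.exists_lift_of_range_le (T.comp φ.1)
    (LaurentSeries.twist_injective j 1) fun x => LaurentSeries.mem_range_twist j _ fun n =>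
      ⟨⟨_, hcoef x n⟩, by rw [RingHom.comp_apply, hT]; rfl⟩
  refine ⟨⟨γ ^ e, hc⟩, fun h => pow_ne_zero e hγ (congrArg Subtype.val h), φ', fun r => ?_, ?_⟩
  · apply LaurentSeries.twist_injective j 1
    rw [hφ', RingHom.comp_apply, φ.2.1, LaurentSeries.twist_C, LaurentSeries.twist_C]
    rfl
  · apply LaurentSeries.twist_injective j 1
    rw [hφ', RingHom.comp_apply, φ.2.2, puiseuxParameter_coe, map_zero, zero_add,
      LaurentSeries.twist_single, LaurentSeries.twist_single]
    congr 1
    simp [j]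

end RegularGExtension

end Rationality

/-! ### Krasner's lemma and inertia -/

section Krasner

variable {E Γ : Type*} [Field E] [LinearOrderedCommGroupWithZero Γ] {v : Valuation E Γ}

/-- Roots of unity of order prime to the residue characteristic are distinct modulo the maximal
ideal. -/
theorem Valuation.eq_one_of_pow_eq_one {e : ℕ} (hve : v (e : E) = 1) {z : E}
    (hz : z ^ e = 1) (hz1 : v (z - 1) < 1) : z = 1 := by
  by_contra hne
  have he : e ≠ 0 := by rintro rfl; simp at hve
  have hvz : v z = 1 := by
    have : v z ^ e = 1 := by rw [← map_pow, hz, map_one]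
    exact (pow_eq_one_iff_of_nonneg zero_le he).1 this
  have hsum : ∑ i ∈ Finset.range e, z ^ i = 0 := by
    have := mul_geom_sum z e
    rw [hz, sub_self, mul_eq_zero] at this
    exact this.resolve_left (sub_ne_zero.2 hne)
  have h1 : (e : E) = -∑ i ∈ Finset.range e, (z ^ i - 1) := by
    rw [Finset.sum_sub_distrib, hsum]; simp
  have h2 : v (e : E) < 1 := by
    rw [h1, Valuation.map_neg]
    refine v.map_sum_lt one_ne_zero fun i _ => ?_
    rw [← mul_geom_sum, map_mul]
    refine mul_lt_one_of_lt_of_le hz1 (v.map_sum_le fun j _ => ?_)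
    rw [map_pow, hvz, one_pow]
  exact h2.ne hve

variable {σ : E →+* E}

/-- An inertia automorphism fixes `τ` if it fixes `τ ^ e`, for `e` prime to the residue
characteristic, and `τ` has the valuation of an element that is fixed. -/
theorem Valuation.inertia_fixes_of_pow (hσ : ∀ x, v x ≤ 1 → v (σ x - x) < 1) {e : ℕ}
    (hve : v (e : E) = 1) {τ : E} (hτ : σ (τ ^ e) = τ ^ e) {y : E} (hy : σ y = y) (hvy : v y = v τ) :
    σ τ = τ := by
  by_cases hτ0 : τ = 0
  · rw [hτ0, map_zero]
  have hvτ : v τ ≠ 0 := (v.ne_zero_iff).2 hτ0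
  have hy0 : y ≠ 0 := (v.ne_zero_iff).1 (hvy ▸ hvτ)
  have h1 : v (τ / y) = 1 := by rw [map_div₀, hvy, div_self hvτ]
  have h2 := hσ (τ / y) h1.le
  rw [map_div₀, hy, ← sub_div, show σ τ - τ = τ * (σ τ / τ - 1) by field_simp, mul_div_right_comm,
    map_mul, h1, one_mul] at h2
  have h3 := Valuation.eq_one_of_pow_eq_one hve (z := σ τ / τ) (by
    rw [div_pow, ← map_pow, hτ, div_self (pow_ne_zero e hτ0)]) h2
  rwa [div_eq_one_iff_eq hτ0] at h3

/-- Krasner's lemma for inertia automorphisms: a root is fixed if it is approximated by fixed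
elements more closely than by other roots. -/
theorem Valuation.inertia_fixes_of_approx {ι : Type*} [Fintype ι] (hσv : ∀ x, v (σ x) = v x)
    {η y : ι → E} {δ : Γ} (hη : ∀ i, ∃ j, σ (η i) = η j)
    (hsep : ∀ i j, η i ≠ η j → δ ≤ v (η i - η j)) (hy : ∀ i, σ (y i) = y i)
    (happ : ∀ i, v (∏ j, (η i - y j)) < δ ^ Fintype.card ι) (i : ι) : σ (η i) = η i := by
  obtain ⟨j, hj⟩ : ∃ j, v (η i - y j) < δ := by
    by_contra! hcon
    refine absurd (happ i) (not_lt.2 ?_)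
    rw [map_prod, ← Finset.card_univ, ← Finset.prod_const]
    exact Finset.prod_le_prod (fun _ _ => zero_le) fun j _ => hcon j
  have h1 : v (σ (η i) - y j) < δ := by
    rw [← hy j, ← RingHom.map_sub, hσv]; exact hj
  obtain ⟨i', hi'⟩ := hη i
  by_contra hne
  have h2 := hsep i' i (fun h => hne (hi'.trans h))
  refine absurd h2 (not_le.2 ?_)
  rw [← hi', show σ (η i) - η i = (σ (η i) - y j) - (η i - y j) by ring]
  exact lt_of_le_of_lt (v.map_sub _ _) (max_lt h1 hj)

end Krasner

section InertiaValuation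

open IsDedekindDomain HeightOneSpectrum

variable {K E : Type*} [Field K] [Field E] [Algebra K E]
  {𝔓 : HeightOneSpectrum (𝓞 E)} {σ : Gal(E/K)}

theorem inertia_mem_asIdeal_pow (hσ : σ ∈ 𝔓.asIdeal.inertia Gal(E/K)) {n : ℕ} {x : 𝓞 E}
    (hx : x ∈ 𝔓.asIdeal ^ n) : σ • x ∈ 𝔓.asIdeal ^ n := by
  have h1 : 𝔓.asIdeal.map (MulSemiringAction.toRingHom Gal(E/K) (𝓞 E) σ) ≤ 𝔓.asIdeal := by
    rw [Ideal.map_le_iff_le_comap]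
    intro y hy
    have := add_mem (hσ y) hy
    rwa [sub_add_cancel] at this
  have h2 := Ideal.mem_map_of_mem (MulSemiringAction.toRingHom Gal(E/K) (𝓞 E) σ) hx
  rw [Ideal.map_pow] at h2
  exact Ideal.pow_right_mono h1 n h2

theorem intValuation_inertia_le [NumberField E] (hσ : σ ∈ 𝔓.asIdeal.inertia Gal(E/K)) (x : 𝓞 E) :
    𝔓.intValuation (σ • x) ≤ 𝔓.intValuation x := by
  by_cases hx : x = 0
  · rw [hx, smul_zero]
  · rw [𝔓.intValuation_if_neg hx, intValuation_le_pow_iff_mem]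
    apply inertia_mem_asIdeal_pow hσ
    rw [← intValuation_le_pow_iff_mem, 𝔓.intValuation_if_neg hx]

theorem valuation_inertia [NumberField E] (hσ : σ ∈ 𝔓.asIdeal.inertia Gal(E/K)) (x : E) :
    𝔓.valuation E (σ x) = 𝔓.valuation E x := by
  have h1 : ∀ y : 𝓞 E, 𝔓.intValuation (σ • y) = 𝔓.intValuation y := fun y => by
    refine le_antisymm (intValuation_inertia_le hσ y) ?_
    have := intValuation_inertia_le (inv_mem hσ) (σ • y)
    rwa [inv_smul_smul] at this
  have h2 : ∀ y : 𝓞 E, 𝔓.valuation E (σ (algebraMap (𝓞 E) E y)) =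
      𝔓.valuation E (algebraMap (𝓞 E) E y) := fun y => by
    rw [valuation_of_algebraMap, ← h1 y, ← valuation_of_algebraMap (K := E)]
    rfl
  obtain ⟨a, b, hb, rfl⟩ := IsFractionRing.div_surjective (A := 𝓞 E) x
  rw [map_div₀, map_div₀, map_div₀, h2, h2]

theorem valuation_inertia_sub_lt [NumberField E] (hσ : σ ∈ 𝔓.asIdeal.inertia Gal(E/K)) (x : E)
    (hx : 𝔓.valuation E x ≤ 1) : 𝔓.valuation E (σ x - x) < 1 := by
  obtain ⟨a, ⟨b, hb⟩, hab⟩ := 𝔓.exists_primeCompl_mul_eq_of_integer x hx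
  have h1 : ∀ y : 𝓞 E, 𝔓.valuation E (σ (algebraMap (𝓞 E) E y) - algebraMap (𝓞 E) E y) < 1 :=
    fun y => (𝔓.valuation_lt_one_iff_mem (K := E) _).2 (hσ y)
  have hvb : 𝔓.valuation E (algebraMap (𝓞 E) E b) = 1 := 𝔓.valuation_eq_one_iff_notMem.2 hb
  have h2 : (σ x - x) * σ (algebraMap (𝓞 E) E b) =
      (σ (algebraMap (𝓞 E) E a) - algebraMap (𝓞 E) E a) -
        x * (σ (algebraMap (𝓞 E) E b) - algebraMap (𝓞 E) E b) := by
    rw [← hab, map_mul]; ring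
  have h3 : 𝔓.valuation E ((σ x - x) * σ (algebraMap (𝓞 E) E b)) < 1 := by
    rw [h2]
    refine lt_of_le_of_lt (Valuation.map_sub _ _ _) (max_lt (h1 a) ?_)
    rw [map_mul]
    exact (mul_le_of_le_one_left zero_le hx).trans_lt (h1 b)
  rwa [map_mul, valuation_inertia hσ, hvb, mul_one] at h3

end InertiaValuation

/-! ### Specializations near a totally ramified point -/

section Specialization

open Polynomial

/-- A polynomial with integral coefficients, evaluated at integral elements. -/
theorem Valuation.eval₂_le_one {A E Γ : Type*} [CommRing A] [Field E]
    [LinearOrderedCommGroupWithZero Γ] (v : Valuation E Γ) (f : A →+* E) {x : E} (hx : v x ≤ 1)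
    {b : E} {p : A[X]} (hp : ∀ i, v (b * f (p.coeff i)) ≤ 1) : v (b * p.eval₂ f x) ≤ 1 := by
  rw [eval₂_eq_sum_range, Finset.mul_sum]
  refine v.map_sum_le fun i _ => ?_
  rw [← mul_assoc, map_mul, map_pow]
  exact mul_le_one' (hp i) (pow_le_one' hx i)

/-- The substitution `t = c⁻¹ τ ^ e`. -/
noncomputable def powerSubst {R L : Type*} [CommRing R] [Field L] (f : R →+* L) (c : L) (e : ℕ) :
    R[X] →+* L[X] :=
  eval₂RingHom (C.comp f) (C c⁻¹ * X ^ e)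

theorem prod_X_sub_C_sub_dvd {ι A : Type*} [CommRing A] [Fintype ι] {a b : ι → A} {z : A}
    (h : ∀ i, z ∣ a i - b i) : C z ∣ ∏ i, (X - C (a i)) - ∏ i, (X - C (b i)) := by
  rw [← Ideal.mem_span_singleton, ← Ideal.Quotient.eq, map_prod, map_prod]
  refine Finset.prod_congr rfl fun i _ => ?_
  rw [Ideal.Quotient.eq, Ideal.mem_span_singleton]
  have : X - C (a i) - (X - C (b i)) = -C (a i - b i) := by rw [C_sub]; ring
  rw [this, dvd_neg]
  exact map_dvd C (h i)

theorem X_pow_dvd_sub_trunc {L : Type*} [Field L] (M : ℕ) (Y : PowerSeries L) :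
    PowerSeries.X ^ M ∣ Y - (PowerSeries.trunc M Y : PowerSeries L) := by
  rw [PowerSeries.X_pow_dvd_iff]
  intro m hm
  rw [map_sub, coeff_coe, PowerSeries.coeff_trunc, if_pos hm, sub_self]

/-- If `∏ (Y - Yᵢ(τ))` is the expansion of a polynomial `P(t, Y)`, with `t = c⁻¹ τ ^ e`, and `u` is a
sufficiently small value of `t` for which `τ` is fixed by inertia, then the roots of `P(u, Y)` are
fixed by inertia. The bound on `u` is uniform in the valuation. -/
theorem exists_bound_of_expansion {K L : Type u} [Field K] [NumberField K] [Field L] [NumberField L]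
    [Algebra K L] {ι : Type v} [Fintype ι] [Nonempty ι] {P A B : (𝓞 K)[X][X]} (hP : P.Monic)
    {d : (𝓞 K)[X]} (hd : d ≠ 0) (hAB : A * P + B * derivative P = C d) {c : L} (hc : c ≠ 0) {e : ℕ}
    (he : 0 < e) (Y : ι → PowerSeries L)
    (hY : (P.map (powerSubst (algebraMap (𝓞 K) L) c e)).map (coeToPowerSeries.ringHom (R := L)) =
      ∏ i, (X - C (Y i))) :
    ∃ D : 𝓞 K, D ≠ 0 ∧ IsIntegral ℤ (algebraMap (𝓞 K) L D * c) ∧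
      IsIntegral ℤ (algebraMap (𝓞 K) L D * c⁻¹) ∧
      ∀ (E : Type u) [Field E] [CharZero E] [Algebra L E]
        (v : Valuation E (WithZero (Multiplicative ℤ))),
        (∀ x, IsIntegral ℤ x → v x ≤ 1) →
      ∀ σ : E →+* E, (∀ x, v (σ x) = v x) → (∀ x : L, σ (algebraMap L E x) = algebraMap L E x) →
      ∀ (u : K) (τ : E), u ≠ 0 → τ ^ e = algebraMap L E (c * algebraMap K L u) → σ τ = τ →
        v (algebraMap L E (algebraMap K L u)) < v (algebraMap L E (algebraMap (𝓞 K) L D)) →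
        d.eval₂ (algebraMap (𝓞 K) K) u ≠ 0 ∧
        ∀ η : ι → E, P.map (((algebraMap L E).comp (algebraMap K L)).comp
          (eval₂RingHom (algebraMap (𝓞 K) K) u)) = ∏ i, (X - C (η i)) → ∀ i, σ (η i) = η i := by
  classical
  set n := Fintype.card ι with hn
  have hn0 : 0 < n := Fintype.card_pos
  obtain ⟨d₁, hd₁, hd₁0⟩ := exists_eq_pow_rootMultiplicity_mul_and_not_dvd d hd 0
  set k := d.rootMultiplicity 0
  rw [map_zero, sub_zero] at hd₁ hd₁0
  have hd₁c : d₁.coeff 0 ≠ 0 := fun h => hd₁0 (X_dvd_iff.2 h)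
  set M' := k * n + 1 with hM'
  set M := e * M' with hM
  set E₀ := powerSubst (algebraMap (𝓞 K) L) c e with hE₀
  let y : ι → L[X] := fun i => PowerSeries.trunc M (Y i)
  obtain ⟨S, hS⟩ : C (X ^ M) ∣ P.map E₀ - ∏ i, (X - C (y i)) := by
    rw [C_dvd_iff_dvd_coeff]
    intro i
    rw [← EulerOperator.X_pow_dvd_coe_iff]
    have h1 : C (PowerSeries.X ^ M) ∣ (P.map E₀ - ∏ i, (X - C (y i))).map
        (coeToPowerSeries.ringHom (R := L)) := by
      rw [Polynomial.map_sub, hY, Polynomial.map_prod]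
      simp only [Polynomial.map_sub, map_X, map_C]
      exact prod_X_sub_C_sub_dvd fun i => X_pow_dvd_sub_trunc M (Y i)
    have h2 := (C_dvd_iff_dvd_coeff _ _).1 h1 i
    rwa [coeff_map] at h2
  -- a common denominator
  obtain ⟨b, hb0, hb⟩ := exists_integral_multiples ℤ ℚ (L := L)
    (insert c (insert c⁻¹ (S.support.biUnion fun i => (S.coeff i).support.image (S.coeff i).coeff)))
  have hbc : IsIntegral ℤ ((b : L) * c) := by
    have := hb c (by simp); rwa [zsmul_eq_mul] at this
  have hbc' : IsIntegral ℤ ((b : L) * c⁻¹) := by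
    have := hb c⁻¹ (by simp); rwa [zsmul_eq_mul] at this
  have hbS : ∀ i j, IsIntegral ℤ ((b : L) * (S.coeff i).coeff j) := by
    intro i j
    by_cases h1 : (S.coeff i).coeff j = 0
    · rw [h1, mul_zero]; exact isIntegral_zero
    · have h2 : S.coeff i ≠ 0 := fun h => h1 (by rw [h, coeff_zero])
      have := hb ((S.coeff i).coeff j) (by
        simp only [Finset.mem_insert, Finset.mem_biUnion, Finset.mem_image, mem_support_iff]
        exact Or.inr (Or.inr ⟨i, h2, j, h1, rfl⟩))
      rwa [zsmul_eq_mul] at this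
  set δ₀ := d₁.coeff 0 with hδ₀
  set D : 𝓞 K := (b : 𝓞 K) ^ (k * n + 2) * δ₀ ^ n with hD
  have hDint : ∀ x : L, IsIntegral ℤ ((b : L) * x) → IsIntegral ℤ (algebraMap (𝓞 K) L D * x) := by
    intro x hx
    have h1 : algebraMap (𝓞 K) L D * x =
        algebraMap (𝓞 K) L ((b : 𝓞 K) ^ (k * n + 1) * δ₀ ^ n) * (b * x) := by
      rw [hD, map_mul, map_mul, map_pow, map_pow, map_pow, map_intCast]; ring
    rw [h1]
    refine IsIntegral.mul ?_ hx
    have h2 : IsIntegral ℤ ((b : 𝓞 K) ^ (k * n + 1) * δ₀ ^ n) := Algebra.IsIntegral.isIntegral _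
    exact h2.map (IsScalarTower.toAlgHom ℤ (𝓞 K) L)
  refine ⟨D, mul_ne_zero (pow_ne_zero _ (by exact_mod_cast hb0)) (pow_ne_zero _ hd₁c), hDint c hbc,
    hDint _ hbc', ?_⟩
  intro E _ _ _ v hv σ hσv hσL u τ hu hτ hστ hvu
  set j := (algebraMap L E).comp (algebraMap K L) with hj
  have hvint : ∀ r : 𝓞 K, v (j (algebraMap (𝓞 K) K r)) ≤ 1 := by
    intro r
    refine hv _ ?_
    have h1 : IsIntegral ℤ (algebraMap (𝓞 K) K r) := r.2
    exact h1.map (j.toIntAlgHom)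
  set U := v (j u) with hU
  set q := v (b : E) with hq
  set δ := v (j (algebraMap (𝓞 K) K δ₀)) with hδ
  have hU0 : U ≠ 0 := v.ne_zero_iff.2 ((map_ne_zero j).2 hu)
  have hq0 : q ≠ 0 := v.ne_zero_iff.2 (by exact_mod_cast hb0)
  have hq1 : q ≤ 1 := hv _ (by
    have : IsIntegral ℤ (algebraMap ℤ E b) := isIntegral_algebraMap
    simpa using this)
  have hδ1 : δ ≤ 1 := hvint _
  have hUD : U < q ^ (k * n + 2) * δ ^ n := by
    have h1 : algebraMap L E (algebraMap (𝓞 K) L D) = (b : E) ^ (k * n + 2) *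
        (j (algebraMap (𝓞 K) K δ₀)) ^ n := by
      rw [hD, map_mul, map_mul, map_pow, map_pow, map_pow, map_pow, map_intCast, map_intCast]
      rfl
    rw [h1, map_mul, map_pow, map_pow] at hvu
    exact hvu
  have hUδ : U < δ := by
    refine hUD.trans_le ((mul_le_of_le_one_left zero_le (pow_le_one' hq1 _)).trans ?_)
    exact pow_le_of_le_one zero_le hδ1 hn0.ne'
  have hUq : U ≤ q := by
    refine hUD.le.trans ((mul_le_of_le_one_right zero_le (pow_le_one' hδ1 _)).trans ?_)
    exact pow_le_of_le_one zero_le hq1 (by omega)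
  have hU1 : U ≤ 1 := hUq.trans hq1
  have hvτ : v τ ^ e = v (algebraMap L E c) * U := by
    rw [← map_pow, hτ, map_mul, map_mul]; rfl
  have hqc : q * v (algebraMap L E c) ≤ 1 := by
    have h1 := hv _ (hbc.map (algebraMap L E).toIntAlgHom)
    have h2 : (algebraMap L E).toIntAlgHom ((b : L) * c) = (b : E) * algebraMap L E c := by
      change algebraMap L E ((b : L) * c) = _
      rw [map_mul, map_intCast]
    rw [h2, map_mul] at h1
    exact h1
  have hτ1 : v τ ≤ 1 := by
    refine (pow_le_one_iff_of_nonneg zero_le he.ne').1 ?_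
    rw [hvτ]
    exact (mul_le_mul' le_rfl hUq).trans (by rwa [mul_comm])
  -- the value of `d` at `u`
  set Eu : (𝓞 K)[X] →+* E := j.comp (eval₂RingHom (algebraMap (𝓞 K) K) u) with hEu
  have hEuC : ∀ r, Eu (C r) = j (algebraMap (𝓞 K) K r) := fun r => by simp [hEu]
  have hEuX : Eu X = j u := by simp [hEu]
  have hEu1 : ∀ p, v (Eu p) ≤ 1 := by
    intro p
    have h1 : Eu p = 1 * p.eval₂ (j.comp (algebraMap (𝓞 K) K)) (j u) := by
      rw [one_mul, hEu, RingHom.comp_apply, coe_eval₂RingHom, hom_eval₂]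
    rw [h1]
    exact v.eval₂_le_one _ hU1 fun i => by rw [one_mul]; exact hvint _
  have hvd₁ : v (Eu d₁) = δ := by
    obtain ⟨d₂, hd₂⟩ : X ∣ d₁ - C δ₀ := X_dvd_iff.2 (by simp [hδ₀])
    have h1 : Eu d₁ = j (algebraMap (𝓞 K) K δ₀) + j u * Eu d₂ := by
      rw [← hEuC, ← hEuX, ← map_mul, ← hd₂, ← map_add]; congr 1; ring
    rw [h1]
    refine v.map_add_eq_of_lt_left ?_
    rw [map_mul]
    exact (mul_le_of_le_one_right zero_le (hEu1 _)).trans_lt hUδ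
  have hvd : v (Eu d) = U ^ k * δ := by
    rw [hd₁, map_mul, map_pow, hEuX, map_mul, map_pow, hvd₁]
  have hδ0 : δ ≠ 0 := (lt_of_le_of_lt zero_le hUδ).ne'
  have hvd0 : U ^ k * δ ≠ 0 := mul_ne_zero (pow_ne_zero _ hU0) hδ0
  refine ⟨fun h0 => ?_, fun η hη => ?_⟩
  · have h1 : Eu d = 0 := by
      rw [hEu, RingHom.comp_apply, coe_eval₂RingHom, h0, map_zero]
    rw [h1, map_zero] at hvd
    exact hvd0 hvd.symm
  have hEu' : P.map Eu = ∏ i, (X - C (η i)) := hη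
  have hroot : ∀ i, (P.map Eu).eval (η i) = 0 := by
    intro i
    rw [hEu', eval_prod]
    exact Finset.prod_eq_zero (Finset.mem_univ i) (by simp)
  -- the roots are integral at `v`
  have hη1 : ∀ i, v (η i) ≤ 1 := by
    intro i
    have h1 : IsIntegral v.integer (η i) := by
      obtain ⟨f, hf⟩ := RingHom.exists_lift_of_range_le Eu (i := v.integer.subtype)
        Subtype.val_injective fun a => ⟨⟨Eu a, hEu1 a⟩, rfl⟩
      refine ⟨P.map f, hP.map f, ?_⟩
      have h2 : (v.integer.subtype).comp f = Eu := RingHom.ext hf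
      rw [eval₂_map]
      change P.eval₂ (v.integer.subtype.comp f) _ = 0
      rw [h2, ← eval_map, hroot]
    exact (Valuation.integer.integers v).mem_of_integral h1
  have heval1 : ∀ (p : (𝓞 K)[X][X]) i, v ((p.map Eu).eval (η i)) ≤ 1 := by
    intro p i
    rw [eval_map]
    have := v.eval₂_le_one Eu (hη1 i) (b := 1) (p := p) fun i => by rw [one_mul]; exact hEu1 _
    rwa [one_mul] at this
  have hsep : ∀ i i', η i ≠ η i' → U ^ k * δ ≤ v (η i - η i') := by
    intro i i' hii'
    have h1 := congrArg (fun p => (p.map Eu).eval (η i)) hAB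
    simp only [Polynomial.map_add, Polynomial.map_mul, map_C, eval_add, eval_mul, eval_C, hroot,
      mul_zero, zero_add, ← derivative_map] at h1
    have hne : i ≠ i' := fun h => hii' (by rw [h])
    have h2 : (derivative (P.map Eu)).eval (η i) =
        (η i - η i') * ∏ l ∈ (Finset.univ.erase i).erase i', (η i - η l) := by
      rw [hEu', ← Finset.mul_prod_erase _ _ (Finset.mem_univ i),
        ← Finset.mul_prod_erase _ _ (Finset.mem_erase.2 ⟨hne.symm, Finset.mem_univ i'⟩)]
      simp [eval_prod]
    rw [← hvd, ← h1, h2, map_mul, map_mul]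
    refine (mul_le_of_le_one_left zero_le (heval1 B i)).trans (mul_le_of_le_one_right zero_le ?_)
    rw [map_prod]
    exact Finset.prod_le_one' fun l _ => (v.map_sub _ _).trans (max_le (hη1 i) (hη1 l))
  have hjL : ∀ x : K, σ (j x) = j x := fun x => hσL _
  let yτ : ι → E := fun i => (y i).eval₂ (algebraMap L E) τ
  refine v.inertia_fixes_of_approx hσv (y := yτ) (δ := U ^ k * δ) (fun i => ?_) hsep (fun i => ?_)
    (fun i => ?_)
  · have h1 : (P.map Eu).eval (σ (η i)) = 0 := by
      have h2 : σ.comp Eu = Eu := by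
        refine Polynomial.ringHom_ext (fun r => ?_) ?_
        · rw [RingHom.comp_apply, hEuC, hjL]
        · rw [RingHom.comp_apply, hEuX, hjL]
      rw [eval_map, ← h2, ← hom_eval₂, ← eval_map, hroot, map_zero]
    rw [hEu', eval_prod, Finset.prod_eq_zero_iff] at h1
    obtain ⟨i', -, hi'⟩ := h1
    exact ⟨i', by simpa [sub_eq_zero] using hi'⟩
  · have h2 : σ.comp (algebraMap L E) = algebraMap L E := RingHom.ext hσL
    simp only [yτ]
    rw [hom_eval₂, h2, hστ]
  · -- evaluation of the congruence between `P` and `∏ (Y - yᵢ)`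
    set F : L[X] →+* E := eval₂RingHom (algebraMap L E) τ with hF
    have hFE₀ : F.comp E₀ = Eu := by
      refine Polynomial.ringHom_ext (fun r => ?_) ?_
      · rw [RingHom.comp_apply, hEuC]
        simp only [hF, hE₀, powerSubst, coe_eval₂RingHom, eval₂_C, RingHom.comp_apply]
        rfl
      · rw [RingHom.comp_apply, hEuX]
        simp only [hF, hE₀, powerSubst, coe_eval₂RingHom, eval₂_X, eval₂_mul, eval₂_C, eval₂_pow]
        rw [hτ, ← map_mul, inv_mul_cancel_left₀ hc]
        rfl
    have h1 := congrArg (fun p => (p.map F).eval (η i)) hS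
    simp only [Polynomial.map_sub, Polynomial.map_mul, eval_sub, eval_mul, Polynomial.map_map,
      map_C, eval_C, hFE₀, hroot, Polynomial.map_prod, map_X, eval_prod, eval_X, zero_sub] at h1
    have h2 : F (X ^ M) = τ ^ M := by simp [hF]
    have h3 : ∀ l, F (y l) = yτ l := fun l => rfl
    simp only [h2, h3] at h1
    have h4 : v ((b : E) * (S.map F).eval (η i)) ≤ 1 := by
      rw [eval_map]
      refine v.eval₂_le_one F (hη1 i) fun l => ?_
      refine v.eval₂_le_one (algebraMap L E) hτ1 fun m => ?_
      have h5 := hv _ ((hbS l m).map (algebraMap L E).toIntAlgHom)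
      have h6 : (algebraMap L E).toIntAlgHom ((b : L) * (S.coeff l).coeff m) =
          (b : E) * algebraMap L E ((S.coeff l).coeff m) := by
        change algebraMap L E ((b : L) * (S.coeff l).coeff m) = _
        rw [map_mul, map_intCast]
      rwa [h6] at h5
    have h5 : q * v (∏ l, (η i - yτ l)) ≤ (v (algebraMap L E c) * U) ^ M' := by
      rw [← hvτ, ← pow_mul, ← hM, ← Valuation.map_neg, h1, map_mul, map_pow, mul_left_comm]
      rw [map_mul] at h4
      exact mul_le_of_le_one_right zero_le h4
    have h6 : q ^ (M' + 1) * v (∏ l, (η i - yτ l)) < q ^ (M' + 1) * (U ^ k * δ) ^ n := by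
      calc q ^ (M' + 1) * v (∏ l, (η i - yτ l)) = q ^ M' * (q * v (∏ l, (η i - yτ l))) := by
            rw [pow_succ, mul_assoc]
        _ ≤ q ^ M' * (v (algebraMap L E c) * U) ^ M' := mul_le_mul' le_rfl h5
        _ = (q * v (algebraMap L E c)) ^ M' * U ^ M' := by rw [← mul_pow, ← mul_pow, mul_assoc]
        _ ≤ U ^ M' := mul_le_of_le_one_left zero_le (pow_le_one' hqc _)
        _ = U ^ (k * n) * U := by rw [hM', pow_succ]
        _ < U ^ (k * n) * (q ^ (k * n + 2) * δ ^ n) :=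
            mul_lt_mul_of_pos_left hUD (zero_lt_iff.2 (pow_ne_zero _ hU0))
        _ = q ^ (M' + 1) * (U ^ k * δ) ^ n := by
            rw [mul_pow, ← pow_mul, mul_left_comm]
    exact lt_of_mul_lt_mul_left h6 zero_le

end Specialization

/-! ### Integral models of regular extensions -/

section IntegralModel

open Polynomial

/-- Clearing denominators of finitely many elements. -/
theorem exists_common_denominator {R F : Type*} [CommRing R] [IsDomain R] [Field F] (θ : R →+* F)
    (h : ∀ x, ∃ b : R, b ≠ 0 ∧ θ b * x ∈ θ.range) (s : Finset F) :
    ∃ b : R, b ≠ 0 ∧ ∀ x ∈ s, θ b * x ∈ θ.range := by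
  classical
  induction s using Finset.induction_on with
  | empty => exact ⟨1, one_ne_zero, by simp⟩
  | insert a s _ ih =>
    obtain ⟨b, hb, hbs⟩ := ih
    obtain ⟨b', hb', hba⟩ := h a
    refine ⟨b * b', mul_ne_zero hb hb', fun x hx => ?_⟩
    rw [map_mul]
    rcases Finset.mem_insert.1 hx with rfl | hx
    · rw [mul_assoc]; exact mul_mem ⟨b, rfl⟩ hba
    · rw [mul_comm (θ b), mul_assoc]; exact mul_mem ⟨b', rfl⟩ (hbs x hx)

theorem exists_map_eq_C_mul {R F : Type*} [CommRing R] [IsDomain R] [Field F] (θ : R →+* F)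
    (h : ∀ x, ∃ b : R, b ≠ 0 ∧ θ b * x ∈ θ.range) (p q : F[X]) :
    ∃ b : R, b ≠ 0 ∧ ∃ p' q' : R[X], p'.map θ = C (θ b) * p ∧ q'.map θ = C (θ b) * q := by
  classical
  obtain ⟨b, hb, hbs⟩ := exists_common_denominator θ h
    (p.support.image p.coeff ∪ q.support.image q.coeff)
  have key : ∀ r : F[X], r.support.image r.coeff ⊆ p.support.image p.coeff ∪ q.support.image q.coeff →
      ∃ r' : R[X], r'.map θ = C (θ b) * r := by
    intro r hr
    refine (mem_lifts _).1 ((lifts_iff_coeff_lifts _).2 fun i => ?_)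
    rw [coeff_C_mul]
    by_cases hi : r.coeff i = 0
    · rw [hi, mul_zero]; exact ⟨0, map_zero _⟩
    · exact hbs _ (hr (Finset.mem_image_of_mem _ (mem_support_iff.2 hi)))
  obtain ⟨p', hp'⟩ := key p Finset.subset_union_left
  obtain ⟨q', hq'⟩ := key q Finset.subset_union_right
  exact ⟨b, hb, p', q', hp', hq'⟩

/-- A finite separable extension of a fraction field is generated by a root of a monic polynomial
with integral coefficients. -/
theorem exists_integral_model {R F N : Type*} [CommRing R] [IsDomain R] [Field F] [Field N]
    [Algebra F N] [FiniteDimensional F N] [Algebra.IsSeparable F N] {θ : R →+* F}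
    (hθ : Function.Injective θ) (h : ∀ x, ∃ b : R, b ≠ 0 ∧ θ b * x ∈ θ.range) :
    ∃ (y : N) (P A B : R[X]) (d : R), IntermediateField.adjoin F {y} = ⊤ ∧ P.Monic ∧
      P.map θ = minpoly F y ∧ d ≠ 0 ∧ A * P + B * derivative P = C d := by
  obtain ⟨y₀, hy₀⟩ := Field.exists_primitive_element F N
  obtain ⟨b, hb, p₁, -, hp₁, -⟩ := exists_map_eq_C_mul θ h (minpoly F y₀) 0
  have hθb : θ b ≠ 0 := (map_ne_zero_iff θ hθ).2 hb
  have hint₀ : IsIntegral F y₀ := Algebra.IsIntegral.isIntegral y₀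
  have hmon := minpoly.monic hint₀
  have hlift : (minpoly F y₀).scaleRoots (θ b) ∈ lifts θ := by
    rw [lifts_iff_coeff_lifts]
    intro i
    rw [coeff_scaleRoots]
    rcases lt_trichotomy i (minpoly F y₀).natDegree with h1 | h1 | h1
    · obtain ⟨j, hj⟩ := Nat.exists_eq_add_of_lt h1
      rw [show (minpoly F y₀).natDegree - i = j + 1 by omega, pow_succ', ← mul_assoc]
      have h2 := congrArg (fun p => p.coeff i) hp₁
      simp only [coeff_map, coeff_C_mul] at h2
      rw [mul_comm _ (θ b), ← h2, ← map_pow, ← map_mul]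
      exact ⟨_, rfl⟩
    · rw [h1, Nat.sub_self, pow_zero, mul_one, hmon.coeff_natDegree]
      exact ⟨1, map_one _⟩
    · rw [coeff_eq_zero_of_natDegree_lt h1, zero_mul]
      exact ⟨0, map_zero _⟩
  obtain ⟨P, hP, hPdeg, hPm⟩ := lifts_and_natDegree_eq_and_monic hlift
    ((monic_scaleRoots_iff _).2 hmon)
  set y := algebraMap F N (θ b) * y₀ with hy
  have hprim : IntermediateField.adjoin F {y} = ⊤ := by
    rw [eq_top_iff, ← hy₀, IntermediateField.adjoin_simple_le_iff]
    have h1 : y₀ = algebraMap F N (θ b)⁻¹ * y := by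
      rw [hy, ← mul_assoc, ← map_mul, inv_mul_cancel₀ hθb, map_one, one_mul]
    rw [h1]
    exact mul_mem (IntermediateField.algebraMap_mem _ _) (IntermediateField.mem_adjoin_simple_self F y)
  have hroot : aeval y (P.map θ) = 0 := by
    rw [hP]; exact scaleRoots_aeval_eq_zero (minpoly.aeval F y₀)
  have hPmin : P.map θ = minpoly F y := by
    refine (eq_of_monic_of_dvd_of_natDegree_le (minpoly.monic (Algebra.IsIntegral.isIntegral y))
      (hPm.map θ) (minpoly.dvd F y hroot) ?_)
    rw [hP, natDegree_scaleRoots]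
    rw [(Field.primitive_element_iff_minpoly_natDegree_eq F y).1 hprim,
      (Field.primitive_element_iff_minpoly_natDegree_eq F y₀).1 hy₀]
  obtain ⟨a₁, b₁, hab⟩ : (minpoly F y).Separable := Algebra.IsSeparable.isSeparable F y
  obtain ⟨d, hd, A, B, hA, hB⟩ := exists_map_eq_C_mul θ h a₁ b₁
  refine ⟨y, P, A, B, d, hprim, hPm, hPmin, hd, ?_⟩
  apply map_injective θ hθ
  rw [Polynomial.map_add, Polynomial.map_mul, Polynomial.map_mul, hA, hB, ← derivative_map, hPmin,
    map_C, mul_assoc, mul_assoc, ← mul_add, hab, mul_one]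

/-- The embedding of the polynomials over the ring of integers into the rational functions. -/
noncomputable def integralPolynomialHom (K : Type*) [Field K] : (𝓞 K)[X] →+* RatFunc K :=
  (algebraMap K[X] (RatFunc K)).comp (mapRingHom (algebraMap (𝓞 K) K))

theorem integralPolynomialHom_injective (K : Type*) [Field K] :
    Function.Injective (integralPolynomialHom K) :=
  (RatFunc.algebraMap_injective K).comp (map_injective _ (FaithfulSMul.algebraMap_injective _ _))

theorem exists_integralPolynomialHom_mul_mem (K : Type*) [Field K] [NumberField K] (x : RatFunc K) :
    ∃ b : (𝓞 K)[X], b ≠ 0 ∧ integralPolynomialHom K b * x ∈ (integralPolynomialHom K).range := by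
  obtain ⟨b, hb, p, q, hp, hq⟩ := exists_map_eq_C_mul (algebraMap (𝓞 K) K) (fun x => by
    obtain ⟨a, b, hb, rfl⟩ := IsFractionRing.div_surjective (A := 𝓞 K) x
    have hb0 := nonZeroDivisors.ne_zero hb
    exact ⟨b, hb0, a, (mul_div_cancel₀ _
      ((map_ne_zero_iff _ (FaithfulSMul.algebraMap_injective (𝓞 K) K)).2 hb0)).symm⟩) x.num x.denom
  have hbK : algebraMap (𝓞 K) K b ≠ 0 :=
    (map_ne_zero_iff _ (FaithfulSMul.algebraMap_injective (𝓞 K) K)).2 hb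
  refine ⟨q, ?_, p, ?_⟩
  · rintro rfl
    rw [Polynomial.map_zero] at hq
    exact mul_ne_zero (C_ne_zero.2 hbK) x.denom_ne_zero hq.symm
  · have hden : algebraMap K[X] (RatFunc K) x.denom ≠ 0 := RatFunc.algebraMap_ne_zero x.denom_ne_zero
    conv_rhs => rw [← RatFunc.num_div_denom x]
    simp only [integralPolynomialHom, RingHom.comp_apply, coe_mapRingHom, hp, hq, map_mul]
    field_simp

theorem Polynomial.Splits.exists_eq_prod_fin {E : Type*} [Field E] {p : E[X]} (hp : p.Monic)
    (hs : p.Splits) : ∃ η : Fin p.natDegree → E, p = ∏ i, (X - C (η i)) := by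
  obtain ⟨l, hl⟩ := Quot.exists_rep p.roots
  have hl' : p.roots = (l : Multiset E) := hl.symm
  have hlen : p.natDegree = l.length := by rw [hs.natDegree_eq_card_roots, hl', Multiset.coe_card]
  have hprod := hs.eq_prod_roots_of_monic hp
  rw [hl', Multiset.map_coe, Multiset.prod_coe] at hprod
  rw [hlen]
  exact ⟨l.get, hprod.trans (Fin.prod_univ_fun_getElem l fun x => X - C x).symm⟩

end IntegralModel

/-! ### Unramified specializations near a totally ramified point -/

section UnramifiedSpecialization

open Polynomial IsDedekindDomain HeightOneSpectrum

theorem HeightOneSpectrum.exists_liesOver {A B : Type*} [CommRing A] [IsDedekindDomain A] [CommRing B]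
    [IsDedekindDomain B] [Algebra A B] [Algebra.IsIntegral A B] [FaithfulSMul A B]
    (𝔭 : HeightOneSpectrum A) : ∃ 𝔓 : HeightOneSpectrum B, 𝔓.asIdeal.LiesOver 𝔭.asIdeal := by
  have := 𝔭.isPrime
  obtain ⟨P, hP, hPo⟩ := Ideal.exists_maximal_ideal_liesOver_of_isIntegral (S := B) 𝔭.asIdeal
  exact ⟨⟨P, hP.isPrime, Ideal.ne_bot_of_liesOver_of_ne_bot 𝔭.ne_bot P⟩, hPo⟩

theorem valuation_natCast_eq_one {K E : Type*} [Field K] [NumberField K] [Field E] [NumberField E]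
    [Algebra K E] {𝔭 : HeightOneSpectrum (𝓞 K)} {𝔓 : HeightOneSpectrum (𝓞 E)}
    [𝔓.asIdeal.LiesOver 𝔭.asIdeal] {e : ℕ} (he : (e : 𝓞 K) ∉ 𝔭.asIdeal) :
    𝔓.valuation E (e : E) = 1 := by
  have h1 : (e : E) = algebraMap (𝓞 E) E (e : 𝓞 E) := by simp
  rw [h1, valuation_eq_one_iff_notMem]
  intro hmem
  apply he
  rw [Ideal.LiesOver.over (p := 𝔭.asIdeal) (P := 𝔓.asIdeal), Ideal.mem_comap, map_natCast]
  exact hmem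

theorem valuation_le_one_of_isIntegral {E : Type*} [Field E] [NumberField E]
    (𝔓 : HeightOneSpectrum (𝓞 E)) {x : E} (hx : IsIntegral ℤ x) : 𝔓.valuation E x ≤ 1 :=
  𝔓.valuation_le_one (⟨x, hx⟩ : 𝓞 E)

/-- Inertia above a prime not dividing `e` fixes the `e`-th roots of unity. -/
theorem inertia_fixes_adjoin_root_of_unity {K E : Type*} [Field K] [NumberField K] [Field E]
    [NumberField E] [Algebra K E] {𝔭 : HeightOneSpectrum (𝓞 K)} {𝔓 : HeightOneSpectrum (𝓞 E)}
    [𝔓.asIdeal.LiesOver 𝔭.asIdeal] {e : ℕ} (he0 : 0 < e) (he : (e : 𝓞 K) ∉ 𝔭.asIdeal)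
    {σ : Gal(E/K)} (hσ : σ ∈ 𝔓.asIdeal.inertia Gal(E/K)) {L : Type*} [Field L] [Algebra K L]
    [Algebra L E] [IsScalarTower K L E] {z : L} (hz : z ^ e = 1)
    (hL : IntermediateField.adjoin K {z} = ⊤) (x : L) :
    σ (algebraMap L E x) = algebraMap L E x := by
  have hx : x ∈ IntermediateField.adjoin K {z} := hL ▸ IntermediateField.mem_top
  induction hx using IntermediateField.adjoin_induction with
  | mem x hx =>
    obtain rfl : x = z := hx
    have hpow : (algebraMap L E x) ^ e = 1 := by rw [← map_pow, hz, map_one]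
    refine Valuation.inertia_fixes_of_pow (v := 𝔓.valuation E) (σ := (σ : E →+* E))
      (valuation_inertia_sub_lt hσ) (valuation_natCast_eq_one he) (y := 1) ?_ (map_one _) ?_
    · rw [hpow, map_one]
    · rw [map_one]
      refine ((pow_eq_one_iff_of_nonneg zero_le he0.ne').1 ?_).symm
      rw [← map_pow, hpow, map_one]
  | algebraMap x => rw [← IsScalarTower.algebraMap_apply, σ.commutes]
  | add x y _ _ hx hy => rw [map_add, map_add, hx, hy]
  | inv x _ hx => rw [map_inv₀, map_inv₀, hx]
  | mul x y _ _ hx hy => rw [map_mul, map_mul, hx, hy]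

/-- In an unramified Galois extension the valuations have the same value group. -/
theorem valuation_algebraMap_eq_of_isUnramifiedIn {K L : Type*} [Field K] [NumberField K] [Field L]
    [NumberField L] [Algebra K L] {𝔭 : HeightOneSpectrum (𝓞 K)} {𝔓 : HeightOneSpectrum (𝓞 L)}
    [𝔓.asIdeal.LiesOver 𝔭.asIdeal] (h : Algebra.IsUnramifiedIn (𝓞 L) 𝔭.asIdeal) (x : K) :
    𝔓.valuation L (algebraMap K L x) = 𝔭.valuation K x := by
  have h1 := h.ramificationIdx_eq_one (𝔓 := 𝔓.asIdeal) inferInstance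
  rw [← valuation_liesOver (K := K) L 𝔭 𝔓, Ideal.ramificationIdx'_eq_ramificationIdx _ _ 𝔭.ne_bot, h1, pow_one]

theorem Polynomial.Monic.exists_map_eq_prod_fin {R E : Type*} [CommRing R] [Field E] {P : R[X]}
    (hP : P.Monic) {f : R →+* E} (hs : (P.map f).Splits) :
    ∃ η : Fin P.natDegree → E, P.map f = ∏ i, (X - C (η i)) := by
  have h := hs.exists_eq_prod_fin (hP.map f)
  rwa [hP.natDegree_map] at h

theorem integralPolynomialHom_C {K : Type*} [Field K] (a : 𝓞 K) :
    integralPolynomialHom K (C a) = RatFunc.C (algebraMap (𝓞 K) K a) := by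
  simp [integralPolynomialHom, RatFunc.algebraMap_C]

theorem integralPolynomialHom_X {K : Type*} [Field K] :
    integralPolynomialHom K X = RatFunc.X := by
  simp [integralPolynomialHom, RatFunc.algebraMap_X]

/-- An embedding of `N` into `L((τ))` with `t = c⁻¹ τ ^ e` expands the conjugates of an integral
generator into power series. -/
theorem RegularGExtension.exists_expansion {K : Type u} [Field K] {G : Type v} [Group G]
    (N : RegularGExtension.{u, v, w} K G) {L : Type*} [Field L] [Algebra K L] {c : L} {e : ℕ}
    (φ : N.carrier →+* LaurentSeries L)
    (hφC : ∀ r, φ (algebraMap K N.carrier r) = HahnSeries.C (algebraMap K L r))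
    (hφt : φ N.t = HahnSeries.single (e : ℤ) c⁻¹) {y : N.carrier} {P : (𝓞 K)[X][X]}
    (hP : P.Monic) (hPy : P.map (integralPolynomialHom K) = minpoly (RatFunc K) y) :
    ∃ Y : Fin P.natDegree → PowerSeries L,
      (P.map (powerSubst (algebraMap (𝓞 K) L) c e)).map (coeToPowerSeries.ringHom (R := L)) =
        ∏ i, (X - C (Y i)) := by
  have hsp : (P.map ((algebraMap (RatFunc K) N.carrier).comp (integralPolynomialHom K))).Splits := by
    rw [← Polynomial.map_map, hPy]
    exact Normal.splits (F := RatFunc K) (K := N.carrier) inferInstance y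
  obtain ⟨η, hη⟩ := hP.exists_map_eq_prod_fin hsp
  have hcomp : φ.comp ((algebraMap (RatFunc K) N.carrier).comp (integralPolynomialHom K)) =
      (HahnSeries.ofPowerSeries ℤ L).comp ((coeToPowerSeries.ringHom (R := L)).comp
        (powerSubst (algebraMap (𝓞 K) L) c e)) := by
    refine ringHom_ext (fun a => ?_) ?_
    · simp only [RingHom.comp_apply, integralPolynomialHom_C, N.algebraMap_C, hφC, powerSubst,
        coe_eval₂RingHom, eval₂_C, coeToPowerSeries.ringHom_apply, coe_C, HahnSeries.ofPowerSeries_C]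
      rfl
    · simp only [RingHom.comp_apply, integralPolynomialHom_X, powerSubst,
        coe_eval₂RingHom, eval₂_X, coeToPowerSeries.ringHom_apply, coe_X, coe_C,
        map_mul, map_pow, HahnSeries.ofPowerSeries_C]
      refine hφt.trans ?_
      rw [← map_pow, LaurentSeries.ofPowerSeries_X_pow, HahnSeries.C_apply, HahnSeries.single_mul_single, zero_add, mul_one]
  have hint : ∀ i, ∃ Y : PowerSeries L, HahnSeries.ofPowerSeries ℤ L Y = φ (η i) := by
    intro i
    have h0 : (P.map ((coeToPowerSeries.ringHom (R := L)).comp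
        (powerSubst (algebraMap (𝓞 K) L) c e))).eval₂ (HahnSeries.ofPowerSeries ℤ L) (φ (η i)) = 0 := by
      rw [eval₂_map, ← hcomp, ← hom_eval₂, ← eval_map, hη, eval_prod,
        Finset.prod_eq_zero (Finset.mem_univ i) (by simp), map_zero]
    exact IsIntegrallyClosed.isIntegral_iff.1
      (show IsIntegral (PowerSeries L) (φ (η i)) from ⟨_, hP.map _, h0⟩)
  choose Y hY using hint
  refine ⟨Y, map_injective _ (HahnSeries.ofPowerSeries_injective (Γ := ℤ)) ?_⟩
  rw [Polynomial.map_map, Polynomial.map_map, RingHom.comp_assoc, ← hcomp, ← Polynomial.map_map, hη, Polynomial.map_prod,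
    Polynomial.map_prod]
  simp only [Polynomial.map_sub, map_X, map_C, hY]

/-- The local theorem at the point `0`: if `N/K(t)` has at `0` an inertia group of order `e` that is
its own centralizer, then specializations near `0` are unramified at the primes `𝔭 ∤ e` as soon as
the valuation of the specialized value lies in a certain class modulo `e`, which is trivial for
almost all `𝔭`. -/
theorem RegularGExtension.exists_unramified_splitting {K : Type u} [Field K] [NumberField K]
    {G : Type v} [Group G] [Finite G] (N : RegularGExtension.{u, v, w} K G) {e : ℕ} (he : 0 < e)
    {φ : N.PuiseuxEmbedding ((0 : AlgebraicClosure K) : OnePoint _) e} {z : AlgebraicClosure K}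
    (hz : IsPrimitiveRoot z e) {g : G} (hg : φ.Rotates z g) (hord : orderOf g = e)
    (hcent : Subgroup.centralizer (Subgroup.zpowers g : Set G) = Subgroup.zpowers g) :
    ∃ (P : (𝓞 K)[X][X]) (y : N.carrier) (D : 𝓞 K), P.Monic ∧
      IntermediateField.adjoin (RatFunc K) {y} = ⊤ ∧
      P.map (integralPolynomialHom K) = minpoly (RatFunc K) y ∧ D ≠ 0 ∧
      ∀ 𝔭 : HeightOneSpectrum (𝓞 K), (e : 𝓞 K) ∉ 𝔭.asIdeal →
        ∃ m : ℤ, (D ∉ 𝔭.asIdeal → m = 0) ∧ ∀ (u : K) (j : ℤ), u ≠ 0 →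
          𝔭.valuation K u < 𝔭.valuation K (algebraMap (𝓞 K) K D) →
          𝔭.valuation K u = WithZero.exp (m + e * j) →
          (P.map (eval₂RingHom (algebraMap (𝓞 K) K) u)).Separable ∧
          ∃ F : IntermediateField K (AlgebraicClosure K), ∃ _ : FiniteDimensional K F,
            Algebra.IsUnramifiedIn (𝓞 F) 𝔭.asIdeal ∧
            ((P.map (eval₂RingHom (algebraMap (𝓞 K) K) u)).map (algebraMap K F)).Splits := by
  set L := IntermediateField.adjoin K {z} with hL
  obtain ⟨c, hc, φ', hφC, hφt⟩ := hg.exists_rational he hz hord hcent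
  obtain ⟨y, P, A, B, d, hy, hP, hPy, hd, hAB⟩ := exists_integral_model (N := N.carrier)
    (integralPolynomialHom_injective K) (exists_integralPolynomialHom_mul_mem K)
  have hzint : IsIntegral K z := Algebra.IsIntegral.isIntegral z
  have : FiniteDimensional K L := IntermediateField.adjoin.finiteDimensional hzint
  have : NumberField L := NumberField.of_module_finite K L
  let zL : L := IntermediateField.AdjoinSimple.gen K z
  have hzL : IsPrimitiveRoot zL e := by
    refine IsPrimitiveRoot.of_map_of_injective (f := algebraMap L (AlgebraicClosure K)) ?_
      (FaithfulSMul.algebraMap_injective _ _)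
    rwa [IntermediateField.AdjoinSimple.algebraMap_gen]
  have : NeZero e := ⟨he.ne'⟩
  have : IsCyclotomicExtension {e} K L := hz.intermediateField_adjoin_isCyclotomicExtension K
  have : IsGalois K L := IsCyclotomicExtension.isGalois {e} K L
  have hLtop : IntermediateField.adjoin K {zL} = ⊤ := by
    rw [eq_top_iff, ← IntermediateField.toSubalgebra_le_toSubalgebra,
      IntermediateField.top_toSubalgebra, ← IsCyclotomicExtension.adjoin_primitive_root_eq_top hzL]
    exact IntermediateField.algebra_adjoin_le_adjoin K {zL}
  obtain ⟨Y, hY⟩ := N.exists_expansion φ' hφC hφt hP hPy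
  have hdeg : 0 < P.natDegree := by
    have h1 := minpoly.natDegree_pos (A := RatFunc K) (x := y) (Algebra.IsIntegral.isIntegral y)
    rwa [← hPy, hP.natDegree_map] at h1
  have : Nonempty (Fin P.natDegree) := ⟨⟨0, hdeg⟩⟩
  obtain ⟨D, hD, hDc, hDc', hbound⟩ := exists_bound_of_expansion hP hd hAB hc he Y hY
  refine ⟨P, y, D, hP, hy, hPy, hD, fun 𝔭 h𝔭 => ?_⟩
  obtain ⟨𝔔, h𝔔⟩ := HeightOneSpectrum.exists_liesOver (B := 𝓞 L) 𝔭
  have hLun : Algebra.IsUnramifiedIn (𝓞 L) 𝔭.asIdeal :=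
    isUnramifiedIn_of_inertia_fixes (F := L) (E := L) 𝔭 𝔔.asIdeal fun σ hσ x =>
      inertia_fixes_adjoin_root_of_unity he h𝔭 hσ (L := L) hzL.pow_eq_one hLtop x
  have hvc0 : 𝔔.valuation L c ≠ 0 := (Valuation.ne_zero_iff _).2 hc
  refine ⟨-WithZero.log (𝔔.valuation L c), ?_, ?_⟩
  · intro hDp
    have hvD : 𝔔.valuation L (algebraMap (𝓞 K) L D) = 1 := by
      rw [IsScalarTower.algebraMap_apply (𝓞 K) K L, valuation_algebraMap_eq_of_isUnramifiedIn hLun,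
        valuation_eq_one_iff_notMem]
      exact hDp
    have h1 := valuation_le_one_of_isIntegral 𝔔 hDc
    have h2 := valuation_le_one_of_isIntegral 𝔔 hDc'
    rw [map_mul, hvD, one_mul] at h1 h2
    rw [map_inv₀] at h2
    have h3 : 𝔔.valuation L c = 1 := le_antisymm h1 ((inv_le_one₀ (zero_lt_iff.2 hvc0)).1 h2)
    rw [h3]; simp
  · intro u j hu hub huv
    obtain ⟨x, hx⟩ := 𝔭.valuation_surjective K (WithZero.exp j)
    set Pu := P.map (eval₂RingHom (algebraMap (𝓞 K) K) u) with hPu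
    have hPum : Pu.Monic := hP.map _
    set F := IntermediateField.adjoin K (Pu.rootSet (AlgebraicClosure K)) with hF
    have hFs : IsSplittingField K F Pu := IntermediateField.adjoin_rootSet_isSplittingField
      (IsAlgClosed.splits _)
    have hFfin : FiniteDimensional K F := IsSplittingField.finiteDimensional F Pu
    have : Normal K F := Normal.of_isSplittingField Pu
    have : IsGalois K F := ⟨⟩
    have : NumberField F := NumberField.of_module_finite K F
    obtain ⟨τ, hτ⟩ := IsAlgClosed.exists_pow_nat_eq
      (algebraMap L (AlgebraicClosure K) (c * algebraMap K L u)) he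
    have : FiniteDimensional K (IntermediateField.adjoin K {τ}) :=
      IntermediateField.adjoin.finiteDimensional (Algebra.IsIntegral.isIntegral τ)
    set M : IntermediateField K (AlgebraicClosure K) := (L ⊔ IntermediateField.adjoin K {τ}) ⊔ F
      with hM
    have hMf : FiniteDimensional K M := inferInstance
    set E : IntermediateField K (AlgebraicClosure K) := IntermediateField.normalClosure K M
      (AlgebraicClosure K) with hE
    have hME : M ≤ E := IntermediateField.le_normalClosure M
    have hLE : L ≤ E := (le_sup_left.trans le_sup_left).trans hME
    have hFE : F ≤ E := le_sup_right.trans hME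
    have hτE : τ ∈ E := hME ((le_sup_right.trans le_sup_left :
      IntermediateField.adjoin K {τ} ≤ M) (IntermediateField.mem_adjoin_simple_self K τ))
    have : FiniteDimensional K E := inferInstance
    have : Normal K E := inferInstance
    have : IsGalois K E := ⟨⟩
    have : NumberField E := NumberField.of_module_finite K E
    let aL : Algebra L E := (IntermediateField.inclusion hLE).toRingHom.toAlgebra
    let aF : Algebra F E := (IntermediateField.inclusion hFE).toRingHom.toAlgebra
    have : IsScalarTower K L E := IsScalarTower.of_algebraMap_eq fun _ => rfl
    have : IsScalarTower K F E := IsScalarTower.of_algebraMap_eq fun _ => rfl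
    obtain ⟨𝔓, h𝔓⟩ := HeightOneSpectrum.exists_liesOver (B := 𝓞 E) 𝔔
    have : 𝔓.asIdeal.LiesOver 𝔭.asIdeal := Ideal.LiesOver.trans 𝔓.asIdeal 𝔔.asIdeal 𝔭.asIdeal
    set ρ := 𝔔.asIdeal.ramificationIdx' 𝔓.asIdeal with hρ
    have hval : ∀ a : L, 𝔓.valuation E (algebraMap L E a) = 𝔔.valuation L a ^ ρ := fun a =>
      (valuation_liesOver (K := L) E 𝔔 𝔓 a).symm
    have hvalK : ∀ a : K, 𝔓.valuation E (algebraMap L E (algebraMap K L a)) =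
        𝔭.valuation K a ^ ρ := fun a => by
      rw [hval, valuation_algebraMap_eq_of_isUnramifiedIn hLun]
    have hρ0 : ρ ≠ 0 := Ideal.IsDedekindDomain.ramificationIdx'_ne_zero_of_liesOver 𝔓.asIdeal 𝔔.ne_bot
    let τE : E := ⟨τ, hτE⟩
    have hτ' : τE ^ e = algebraMap L E (c * algebraMap K L u) := Subtype.ext hτ
    have hvτ : 𝔓.valuation E (algebraMap K E x) = 𝔓.valuation E τE := by
      refine (pow_left_inj₀ zero_le zero_le he.ne').1 ?_
      have h1 : 𝔔.valuation L c * WithZero.exp (-WithZero.log (𝔔.valuation L c) + e * j) =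
          WithZero.exp j ^ e := by
        conv_lhs => rw [← WithZero.exp_log hvc0]
        rw [← WithZero.exp_add, WithZero.log_exp, add_neg_cancel_left, ← WithZero.exp_nsmul,
          nsmul_eq_mul]
      rw [← (𝔓.valuation E).map_pow τE e, hτ', hval, map_mul,
        valuation_algebraMap_eq_of_isUnramifiedIn hLun, huv, h1, IsScalarTower.algebraMap_apply K L E,
        hvalK, hx, ← pow_mul, ← pow_mul, mul_comm]
    have hinertia : ∀ σ ∈ 𝔓.asIdeal.inertia Gal(E/K), _ := fun σ hσ => by
      have hσL : ∀ a : L, σ (algebraMap L E a) = algebraMap L E a := fun a =>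
        inertia_fixes_adjoin_root_of_unity he h𝔭 hσ hzL.pow_eq_one hLtop a
      have hστ : σ τE = τE := Valuation.inertia_fixes_of_pow (v := 𝔓.valuation E)
        (σ := (σ : E →+* E)) (valuation_inertia_sub_lt hσ) (valuation_natCast_eq_one h𝔭)
        (y := algebraMap K E x) (by rw [hτ']; exact hσL _) (σ.commutes x) hvτ
      exact hbound E (𝔓.valuation E) (fun a ha => valuation_le_one_of_isIntegral 𝔓 ha)
        (σ : E →+* E) (valuation_inertia hσ) hσL u τE hu hτ' hστ (by
          rw [hvalK, IsScalarTower.algebraMap_apply (𝓞 K) K L, hvalK]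
          exact pow_lt_pow_left₀ hub zero_le hρ0)
    have hdu := (hinertia 1 (one_mem _)).1
    have hsplit : (Pu.map (algebraMap K F)).Splits := hFs.splits
    refine ⟨?_, F, hFfin, ?_, hsplit⟩
    · refine ⟨A.map (eval₂RingHom (algebraMap (𝓞 K) K) u) * C (d.eval₂ (algebraMap (𝓞 K) K) u)⁻¹,
        B.map (eval₂RingHom (algebraMap (𝓞 K) K) u) * C (d.eval₂ (algebraMap (𝓞 K) K) u)⁻¹, ?_⟩
      have h1 := congrArg (Polynomial.map (eval₂RingHom (algebraMap (𝓞 K) K) u)) hAB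
      simp only [Polynomial.map_add, Polynomial.map_mul, map_C, ← derivative_map,
        coe_eval₂RingHom] at h1
      rw [mul_right_comm, mul_right_comm (B.map _), ← add_mul, h1, ← C_mul, mul_inv_cancel₀ hdu, C_1]
    · have hPE : (P.map (((algebraMap L E).comp (algebraMap K L)).comp
          (eval₂RingHom (algebraMap (𝓞 K) K) u))).Splits := by
        have h1 := hsplit.map (algebraMap F E)
        rw [hPu, Polynomial.map_map, Polynomial.map_map] at h1
        exact h1
      obtain ⟨η, hη⟩ := hP.exists_map_eq_prod_fin hPE
      refine isUnramifiedIn_of_inertia_fixes (E := E) 𝔭 𝔓.asIdeal fun σ hσ a => ?_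
      have hfix := (hinertia σ hσ).2 η hη
      obtain ⟨a, ha⟩ := a
      change σ ⟨a, hFE ha⟩ = ⟨a, hFE ha⟩
      induction ha using IntermediateField.adjoin_induction with
      | mem b hb =>
        have h0 : (Pu.map (algebraMap K E)).eval ⟨b, hFE (IntermediateField.subset_adjoin K _ hb)⟩ = 0 := by
          apply (algebraMap E (AlgebraicClosure K)).injective
          rw [eval_map, hom_eval₂, map_zero]
          exact (mem_rootSet.1 hb).2
        have h1 : Pu.map (algebraMap K E) = ∏ i, (X - C (η i)) := by
          rw [← hη, hPu, Polynomial.map_map]; rfl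
        rw [h1, eval_prod, Finset.prod_eq_zero_iff] at h0
        obtain ⟨i, -, hi⟩ := h0
        rw [eval_sub, eval_X, eval_C, sub_eq_zero] at hi
        rw [hi]
        exact hfix i
      | algebraMap b => exact σ.commutes b
      | add b b' hb hb' h h' =>
        exact (map_add σ ⟨b, hFE hb⟩ ⟨b', hFE hb'⟩).trans (congrArg₂ (· + ·) h h')
      | inv b hb h => exact (map_inv₀ σ ⟨b, hFE hb⟩).trans (congrArg (·⁻¹) h)
      | mul b b' hb hb' h h' =>
        exact (map_mul σ ⟨b, hFE hb⟩ ⟨b', hFE hb'⟩).trans (congrArg₂ (· * ·) h h')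

end UnramifiedSpecialization

/-! ### Places with prescribed residue field -/

section Places

open Polynomial IsDedekindDomain

/-- Hensel's lemma for power series, for polynomials that split into distinct linear factors modulo
the maximal ideal. -/
theorem PowerSeries.splits_map_ofPowerSeries {F : Type*} [Field F] {Q : (PowerSeries F)[X]}
    (hQ : Q.Monic) (hsep : (Q.map (PowerSeries.constantCoeff (R := F))).Separable)
    (hs : (Q.map (PowerSeries.constantCoeff (R := F))).Splits) :
    (Q.map (HahnSeries.ofPowerSeries ℤ F)).Splits := by
  classical
  set q := Q.map (PowerSeries.constantCoeff (R := F)) with hq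
  have hqm : q.Monic := hQ.map _
  have hlift : ∀ a ∈ q.roots, ∃ r : PowerSeries F, Q.eval r = 0 ∧ PowerSeries.constantCoeff r = a := by
    intro a ha
    have hcc : ∀ p : (PowerSeries F)[X], PowerSeries.constantCoeff (p.eval (PowerSeries.C a)) =
        (p.map (PowerSeries.constantCoeff (R := F))).eval a := by
      intro p
      rw [eval_map, ← eval₂_id, hom_eval₂, PowerSeries.constantCoeff_C, RingHom.comp_id]
    have h0 : q.eval a = 0 := (mem_roots hqm.ne_zero).1 ha
    have h1 : q.derivative.eval a ≠ 0 := hsep.eval₂_derivative_ne_zero (RingHom.id F) h0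
    obtain ⟨r, hr, hra⟩ := HenselianRing.is_henselian (I := Ideal.span {(PowerSeries.X : PowerSeries F)})
      Q hQ (PowerSeries.C a) (by
        rw [Ideal.mem_span_singleton, PowerSeries.X_dvd_iff, hcc, h0]) (by
        refine IsUnit.map _ (PowerSeries.isUnit_iff_constantCoeff.2 ?_)
        rw [hcc, ← derivative_map]
        exact h1.isUnit)
    refine ⟨r, hr, ?_⟩
    rw [Ideal.mem_span_singleton, PowerSeries.X_dvd_iff, map_sub, PowerSeries.constantCoeff_C,
      sub_eq_zero] at hra
    exact hra
  choose! r hr hra using hlift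
  have hQL := hQ.map (HahnSeries.ofPowerSeries ℤ F)
  rw [splits_iff_card_roots]
  refine le_antisymm (card_roots' _) ?_
  set s : Finset (LaurentSeries F) := q.roots.toFinset.image fun a => HahnSeries.ofPowerSeries ℤ F (r a)
    with hs'
  have hcard : s.card = q.natDegree := by
    rw [Finset.card_image_of_injOn, Multiset.toFinset_card_of_nodup (nodup_roots hsep),
      ← hs.natDegree_eq_card_roots]
    intro a ha b hb hab
    have := HahnSeries.ofPowerSeries_injective (Γ := ℤ) hab
    rw [← hra a (Multiset.mem_toFinset.1 ha), ← hra b (Multiset.mem_toFinset.1 hb), this]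
  rw [hQ.natDegree_map, ← hQ.natDegree_map (PowerSeries.constantCoeff (R := F)), ← hq, ← hcard]
  refine Multiset.card_le_card ((Multiset.le_iff_subset s.nodup).2 fun x hx => ?_)
  obtain ⟨a, ha, rfl⟩ := Finset.mem_image.1 hx
  rw [mem_roots hQL.ne_zero, IsRoot.def, eval_map, eval₂_at_apply,
    hr a (Multiset.mem_toFinset.1 ha), map_zero]

/-- Unramifiedness descends to subextensions. -/
theorem isUnramifiedIn_of_algebra {K R F : Type*} [Field K] [NumberField K] [Field R] [Field F]
    [NumberField F] [Algebra K R] [Algebra R F] [Algebra K F] [IsScalarTower K R F]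
    {𝔭 : HeightOneSpectrum (𝓞 K)} (h : Algebra.IsUnramifiedIn (𝓞 F) 𝔭.asIdeal) :
    Algebra.IsUnramifiedIn (𝓞 R) 𝔭.asIdeal := by
  have : CharZero R := charZero_of_injective_algebraMap (algebraMap K R).injective
  have : FiniteDimensional K F := Module.Finite.of_restrictScalars_finite ℚ K F
  have : FiniteDimensional K R := FiniteDimensional.left K R F
  have : NumberField R := NumberField.of_module_finite K R
  have := 𝔭.isPrime
  intro 𝔔 h𝔔 hl
  have h𝔔m : 𝔔.IsMaximal := h𝔔.isMaximal (Ideal.ne_bot_of_liesOver_of_ne_bot 𝔭.ne_bot 𝔔)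
  obtain ⟨𝔓, h𝔓m, hlo⟩ := Ideal.exists_maximal_ideal_liesOver_of_isIntegral (S := 𝓞 F) 𝔔
  have h𝔓 := h𝔓m.isPrime
  have : 𝔓.LiesOver 𝔭.asIdeal := Ideal.LiesOver.trans 𝔓 𝔔 𝔭.asIdeal
  have h1 := h 𝔓 h𝔓 this
  exact Algebra.IsUnramifiedAt.of_liesOver (𝓞 K) 𝔔 𝔓

namespace RegularGExtension

variable {K : Type u} [Field K] {G : Type v} [Group G] (N : RegularGExtension.{u, v, w} K G)

/-- If the fibre over `u` splits into distinct points over `F`, then `N` embeds into `F((x))` along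
every power series that takes the value `u`. -/
theorem exists_laurentSeries_ringHom {P : (𝓞 K)[X][X]} (hP : P.Monic) {y : N.carrier}
    (hy : IntermediateField.adjoin (RatFunc K) {y} = ⊤)
    (hPy : P.map (integralPolynomialHom K) = minpoly (RatFunc K) y) {u : K}
    (hsep : (P.map (eval₂RingHom (algebraMap (𝓞 K) K) u)).Separable) {F : Type*} [Field F] [Algebra K F]
    (hs : ((P.map (eval₂RingHom (algebraMap (𝓞 K) K) u)).map (algebraMap K F)).Splits)
    (T : PowerSeries F) (hT : PowerSeries.constantCoeff T = algebraMap K F u)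
    (E : RatFunc K →+* LaurentSeries F)
    (hEC : ∀ c, E (RatFunc.C c) = HahnSeries.C (algebraMap K F c))
    (hEX : E RatFunc.X = HahnSeries.ofPowerSeries ℤ F T) :
    ∃ φ : N.carrier →+* LaurentSeries F, ∀ a, φ (algebraMap (RatFunc K) N.carrier a) = E a := by
  refine exists_ringHom_extending hy E (minpoly.ne_zero (Algebra.IsIntegral.isIntegral y))
    (minpoly.aeval _ y) ?_
  set Θ : (𝓞 K)[X] →+* PowerSeries F :=
    eval₂RingHom (PowerSeries.C.comp ((algebraMap K F).comp (algebraMap (𝓞 K) K))) T with hΘ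
  have h1 : E.comp (integralPolynomialHom K) = (HahnSeries.ofPowerSeries ℤ F).comp Θ := by
    refine ringHom_ext (fun a => ?_) ?_
    · simp [hΘ, integralPolynomialHom_C, hEC]
    · simp [hΘ, integralPolynomialHom_X, hEX]
  have h2 : (PowerSeries.constantCoeff (R := F)).comp Θ =
      (algebraMap K F).comp (eval₂RingHom (algebraMap (𝓞 K) K) u) := by
    refine ringHom_ext (fun a => ?_) ?_
    · simp [hΘ]
    · simp [hΘ, hT]
  rw [← hPy, Polynomial.map_map, h1, ← Polynomial.map_map]
  have h3 : (P.map Θ).map (PowerSeries.constantCoeff (R := F)) =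
      (P.map (eval₂RingHom (algebraMap (𝓞 K) K) u)).map (algebraMap K F) := by
    rw [Polynomial.map_map, h2, Polynomial.map_map]
  exact PowerSeries.splits_map_ofPowerSeries (hP.map Θ) (h3 ▸ hsep.map) (h3 ▸ hs)

/-- The place of `N` given by an embedding `ψ` into `F((x))` with `t ↦ a + x` has its residue field
in `F`. -/
theorem not_ramifiesInSpecialization [NumberField K] {F : Type*} [Field F] [NumberField F] [Algebra K F]
    (ψ : N.carrier →+* LaurentSeries F)
    (hC : ∀ c, ψ (algebraMap K N.carrier c) = HahnSeries.C (algebraMap K F c)) {a : K}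
    (ht : ψ N.t = HahnSeries.C (algebraMap K F a) + HahnSeries.single 1 1)
    {𝔭 : HeightOneSpectrum (𝓞 K)} (h : Algebra.IsUnramifiedIn (𝓞 F) 𝔭.asIdeal) :
    ¬ N.RamifiesInSpecialization a 𝔭 := by
  let A : ValuationSubring N.carrier :=
    { (HahnSeries.ofPowerSeries ℤ F).range.comap ψ with
      mem_or_inv_mem' := by
        intro x
        by_cases hx : ψ x = 0
        · exact Or.inl ⟨0, by rw [map_zero, hx]⟩
        · obtain ⟨n, p, hp, hxp⟩ := LaurentSeries.exists_eq_single_mul hx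
          rcases le_total 0 n with hn | hn
          · lift n to ℕ using hn
            refine Or.inl ⟨PowerSeries.X ^ n * p, ?_⟩
            rw [map_mul, LaurentSeries.ofPowerSeries_X_pow, hxp]
          · obtain ⟨m, rfl⟩ := Int.exists_eq_neg_ofNat hn
            refine Or.inr ⟨PowerSeries.X ^ m * p⁻¹, ?_⟩
            rw [map_mul, LaurentSeries.ofPowerSeries_X_pow, map_inv₀, hxp, mul_inv,
              LaurentSeries.ofPowerSeries_inv hp, HahnSeries.inv_single, neg_neg, inv_one] }
  have hmemA : ∀ x, x ∈ A ↔ ψ x ∈ (HahnSeries.ofPowerSeries ℤ F).range := fun x => Iff.rfl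
  have hconst : ∀ c, algebraMap K N.carrier c ∈ A := fun c =>
    ⟨PowerSeries.C (algebraMap K F c), by rw [hC, HahnSeries.ofPowerSeries_C]⟩
  obtain ⟨p, hp⟩ := RingHom.exists_lift_of_range_le (ψ.comp A.subtype)
    (HahnSeries.ofPowerSeries_injective (Γ := ℤ) (R := F)) fun x => x.2
  let ev : A →+* F := (PowerSeries.constantCoeff (R := F)).comp p
  have hloc : IsLocalHom ev := ⟨fun x hx => by
    have h0 : PowerSeries.constantCoeff (p x) ≠ 0 := hx.ne_zero
    have hinv : (x : N.carrier)⁻¹ ∈ A := ⟨(p x)⁻¹, by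
      rw [LaurentSeries.ofPowerSeries_inv h0, hp, map_inv₀]; rfl⟩
    have hx0 : (x : N.carrier) ≠ 0 := by
      rintro hx0
      apply h0
      have : x = 0 := Subtype.ext hx0
      rw [this, map_zero, map_zero]
    exact IsUnit.of_mul_eq_one ⟨_, hinv⟩ (Subtype.ext (mul_inv_cancel₀ hx0))⟩
  have hsub : N.t - algebraMap K N.carrier a ∈ A.nonunits := by
    have hX : ψ (N.t - algebraMap K N.carrier a) = HahnSeries.ofPowerSeries ℤ F PowerSeries.X := by
      rw [map_sub, ht, hC, add_sub_cancel_left, HahnSeries.ofPowerSeries_X]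
    have hm : N.t - algebraMap K N.carrier a ∈ A := ⟨PowerSeries.X, hX.symm⟩
    rw [ValuationSubring.mem_nonunits_iff_exists_mem_maximalIdeal]
    refine ⟨hm, (IsLocalRing.mem_maximalIdeal _).2 fun hu => ?_⟩
    have h1 : IsUnit (ev ⟨_, hm⟩) := hu.map ev
    have h2 : p ⟨_, hm⟩ = PowerSeries.X := HahnSeries.ofPowerSeries_injective (Γ := ℤ) (by
      rw [hp]; exact hX)
    have h3 : ev ⟨_, hm⟩ = 0 := by
      change PowerSeries.constantCoeff (p _) = 0
      rw [h2, PowerSeries.constantCoeff_X]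
    exact h1.ne_zero h3
  let P : N.PlaceOver a := ⟨A, hconst, hsub⟩
  let alg : Algebra P.ResidueField F := (IsLocalRing.ResidueField.lift ev).toAlgebra
  have : IsScalarTower K P.ResidueField F := IsScalarTower.of_algebraMap_eq fun c => by
    change _ = IsLocalRing.ResidueField.lift ev (IsLocalRing.residue A ⟨_, hconst c⟩)
    rw [IsLocalRing.ResidueField.lift_residue_apply]
    change _ = PowerSeries.constantCoeff (p _)
    have h2 : p ⟨_, hconst c⟩ = PowerSeries.C (algebraMap K F c) :=
      HahnSeries.ofPowerSeries_injective (Γ := ℤ) (by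
        rw [hp, HahnSeries.ofPowerSeries_C]; exact hC c)
    rw [h2, PowerSeries.constantCoeff_C]
  exact fun hram => hram P (isUnramifiedIn_of_algebra (F := F) h)

/-- A point at which `N` embeds into `F((x))`, for `F` algebraic over `K`, is not a branch point. -/
theorem notMem_branchPoints_of_ringHom {F : IntermediateField K (AlgebraicClosure K)}
    (ψ : N.carrier →+* LaurentSeries F)
    (hC : ∀ c, ψ (algebraMap K N.carrier c) = HahnSeries.C (algebraMap K F c)) {a : K}
    (ht : ψ N.t = HahnSeries.C (algebraMap K F a) + HahnSeries.single 1 1) :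
    ((algebraMap K (AlgebraicClosure K) a : AlgebraicClosure K) :
      OnePoint (AlgebraicClosure K)) ∉ N.branchPoints := by
  have hφ : N.PuiseuxEmbedding ((algebraMap K (AlgebraicClosure K) a : AlgebraicClosure K) :
      OnePoint (AlgebraicClosure K)) 1 := by
    refine ⟨(LaurentSeries.twist (algebraMap F (AlgebraicClosure K)) 1).comp ψ, fun c => ?_, ?_⟩
    · rw [RingHom.comp_apply, hC, LaurentSeries.twist_C, ← IsScalarTower.algebraMap_apply]
    · rw [RingHom.comp_apply, ht, map_add, LaurentSeries.twist_C, LaurentSeries.twist_single,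
        puiseuxParameter_coe, ← IsScalarTower.algebraMap_apply]
      simp
  exact fun hb => hb (N.ramificationIndex_eq_one hφ)

/-- The expansion at `a` of a rational function without a pole at `a`. -/
theorem exists_expansion_at {F : Type*} [Field F] [Algebra K F] (a : K) :
    ∃ E : RatFunc K →+* LaurentSeries F, (∀ c, E (RatFunc.C c) = HahnSeries.C (algebraMap K F c)) ∧
      E RatFunc.X = HahnSeries.C (algebraMap K F a) + HahnSeries.single 1 1 ∧
      ∀ (g : RatFunc K) (p q : K[X]) (u : K), g * algebraMap K[X] (RatFunc K) q =
        algebraMap K[X] (RatFunc K) p → q.eval a ≠ 0 → u * q.eval a = p.eval a →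
        ∃ T : PowerSeries F, PowerSeries.constantCoeff T = algebraMap K F u ∧
          E g = HahnSeries.ofPowerSeries ℤ F T := by
  obtain ⟨E, hEC, hEX⟩ := RatFunc.exists_ringHom_laurentSeries (algebraMap K F)
    (θ := HahnSeries.C (algebraMap K F a) + HahnSeries.single 1 1) (by
      rintro ⟨c, hc⟩
      have := congrArg (fun x => HahnSeries.coeff x 1) hc
      simp at this)
  refine ⟨E, hEC, hEX, fun g p q u hg hq hu => ?_⟩
  set Θ : K[X] →+* PowerSeries F := eval₂RingHom (PowerSeries.C.comp (algebraMap K F))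
    (PowerSeries.C (algebraMap K F a) + PowerSeries.X) with hΘ
  have h1 : ∀ r : K[X], E (algebraMap K[X] (RatFunc K) r) = HahnSeries.ofPowerSeries ℤ F (Θ r) := by
    have : E.comp (algebraMap K[X] (RatFunc K)) = (HahnSeries.ofPowerSeries ℤ F).comp Θ := by
      refine ringHom_ext (fun a => ?_) ?_
      · simp [hΘ, RatFunc.algebraMap_C, hEC]
      · simp [hΘ, RatFunc.algebraMap_X, hEX]
    exact fun r => RingHom.congr_fun this r
  have h2 : ∀ r : K[X], PowerSeries.constantCoeff (Θ r) = algebraMap K F (r.eval a) := by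
    have : (PowerSeries.constantCoeff (R := F)).comp Θ = (algebraMap K F).comp (evalRingHom a) := by
      refine ringHom_ext (fun a => ?_) ?_
      · simp [hΘ]
      · simp [hΘ]
    exact fun r => RingHom.congr_fun this r
  have hq' : algebraMap K F (q.eval a) ≠ 0 := (_root_.map_ne_zero _).2 hq
  have hq0 : PowerSeries.constantCoeff (Θ q) ≠ 0 := by rwa [h2]
  refine ⟨Θ p * (Θ q)⁻¹, ?_, ?_⟩
  · rw [map_mul, PowerSeries.constantCoeff_inv, h2, h2, ← hu, map_mul, mul_assoc,
      mul_inv_cancel₀ hq', mul_one]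
  · have h3 := congrArg E hg
    rw [map_mul, h1, h1] at h3
    have h4 : HahnSeries.ofPowerSeries ℤ F (Θ q) ≠ 0 := by
      rw [Ne, map_eq_zero_iff _ HahnSeries.ofPowerSeries_injective]
      rintro h
      exact hq0 (by rw [h, map_zero])
    rw [map_mul, LaurentSeries.ofPowerSeries_inv hq0, ← h3, mul_assoc, mul_inv_cancel₀ h4, mul_one]

/-- Let `N'` be the pullback of `N` along `f`, and let `g = p / q` be a second description of the
parameter `f`, through an extension `N₀` that contains `N` with `t = r`. If the fibre of `N₀` over
`g(a)` splits into distinct points over a field `F` in which `𝔭` is unramified, then `𝔭` does not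
ramify in the specialization of `N'` at `a`. -/
theorem IsPullback.not_ramifiesInSpecialization [NumberField K] {N : RegularGExtension.{u, v, w} K G}
    {f : RatFunc K} {N' : RegularGExtension.{u, v, u} K G}
    {j : N.carrier →+* N'.carrier} (h : N.IsPullback f N' j) (hf : ¬ ∃ c, f = RatFunc.C c)
    {N₀ : RegularGExtension.{u, v, w} K G} (i : N.carrier →+* N₀.carrier)
    (hiC : ∀ c, i (algebraMap K N.carrier c) = algebraMap K N₀.carrier c) {r : RatFunc K}
    (hi : i N.t = algebraMap (RatFunc K) N₀.carrier r) {g : RatFunc K}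
    (hg : ¬ ∃ c, g = RatFunc.C c)
    (hr : ∀ θ : RatFunc K →+* RatFunc K, (∀ c, θ (RatFunc.C c) = RatFunc.C c) → θ RatFunc.X = g →
      θ r = f) {p q : K[X]} (hgpq : g * algebraMap K[X] (RatFunc K) q = algebraMap K[X] (RatFunc K) p)
    {a u : K} (hq : q.eval a ≠ 0) (hu : u * q.eval a = p.eval a)
    {P : (𝓞 K)[X][X]} (hP : P.Monic) {y : N₀.carrier}
    (hy : IntermediateField.adjoin (RatFunc K) {y} = ⊤)
    (hPy : P.map (integralPolynomialHom K) = minpoly (RatFunc K) y)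
    (hsep : (P.map (eval₂RingHom (algebraMap (𝓞 K) K) u)).Separable)
    {F : IntermediateField K (AlgebraicClosure K)} [FiniteDimensional K F]
    (hs : ((P.map (eval₂RingHom (algebraMap (𝓞 K) K) u)).map (algebraMap K F)).Splits)
    {𝔭 : HeightOneSpectrum (𝓞 K)} (hun : Algebra.IsUnramifiedIn (𝓞 F) 𝔭.asIdeal) :
    ((algebraMap K (AlgebraicClosure K) a : AlgebraicClosure K) :
      OnePoint (AlgebraicClosure K)) ∉ N'.branchPoints ∧ ¬ N'.RamifiesInSpecialization a 𝔭 := by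
  have : NumberField F := NumberField.of_module_finite K F
  obtain ⟨E₀, hE₀C, hE₀X, hE₀⟩ := exists_expansion_at (F := F) a
  obtain ⟨T, hT, hgT⟩ := hE₀ g p q u hgpq hq hu
  obtain ⟨θ, hθC, hθX⟩ := exists_ratFunc_subst hg
  obtain ⟨φ, hφ⟩ := N₀.exists_laurentSeries_ringHom hP hy hPy hsep hs T hT (E₀.comp θ)
    (fun c => by rw [RingHom.comp_apply, hθC, hE₀C]) (by rw [RingHom.comp_apply, hθX, hgT])
  obtain ⟨ψ, hψ⟩ := h.exists_ringHom hf E₀ (φ.comp i)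
    (fun c => by
      rw [RingHom.comp_apply, hiC, ← N₀.algebraMap_C, hφ, RingHom.comp_apply, hθC])
    (by rw [RingHom.comp_apply, hi, hφ, RingHom.comp_apply, hr θ hθC hθX])
  have hψC : ∀ c, ψ (algebraMap K N'.carrier c) = HahnSeries.C (algebraMap K F c) := fun c => by
    rw [← N'.algebraMap_C, hψ, hE₀C]
  have hψt : ψ N'.t = HahnSeries.C (algebraMap K F a) + HahnSeries.single 1 1 := by
    rw [← hE₀X]; exact hψ _
  exact ⟨N'.notMem_branchPoints_of_ringHom ψ hψC hψt,
    N'.not_ramifiesInSpecialization ψ hψC hψt hun⟩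

end RegularGExtension

end Places

/-! ### Orders of rational functions -/

section Orders

open Polynomial

theorem LaurentSeries.order_single_mul {k : Type*} [Field k] (n : ℤ) {q : PowerSeries k}
    (hq : PowerSeries.constantCoeff q ≠ 0) :
    (HahnSeries.single n 1 * HahnSeries.ofPowerSeries ℤ k q).order = n := by
  have h0 : HahnSeries.ofPowerSeries ℤ k q ≠ 0 := by
    rw [Ne, map_eq_zero_iff _ HahnSeries.ofPowerSeries_injective]
    rintro rfl
    exact hq (map_zero _)
  rw [HahnSeries.order_mul (HahnSeries.single_ne_zero one_ne_zero) h0,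
    HahnSeries.order_single one_ne_zero]
  have h1 : (HahnSeries.ofPowerSeries ℤ k q).order ≤ 0 := HahnSeries.order_le_of_coeff_ne_zero (by
    rw [PowerSeries.coeff_coe]; simpa using hq)
  have h2 : 0 ≤ (HahnSeries.ofPowerSeries ℤ k q).order := by
    by_contra hlt
    have h3 := mt HahnSeries.coeff_order_eq_zero.1 h0
    rw [PowerSeries.coeff_coe, if_pos (not_le.1 hlt)] at h3
    exact h3 rfl
  omega

theorem LaurentSeries.order_inv {k : Type*} [Field k] (x : LaurentSeries k) : x⁻¹.order = -x.order := by
  by_cases hx : x = 0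
  · simp [hx]
  · have h := HahnSeries.order_mul hx (inv_ne_zero hx)
    rw [mul_inv_cancel₀ hx, HahnSeries.order_one] at h
    omega

variable {K : Type u} [Field K]

theorem hasMultiplicity_iff {f : RatFunc K} {s₀ p : OnePoint (AlgebraicClosure K)} {n : ℕ} :
    HasMultiplicity f s₀ p n ↔ localParameterAt p (localExpansion s₀ f) ≠ 0 ∧
      (localParameterAt p (localExpansion s₀ f)).order = n := by
  constructor
  · rintro ⟨q, hq, h⟩
    rw [h]
    refine ⟨mul_ne_zero (HahnSeries.single_ne_zero one_ne_zero) ?_, LaurentSeries.order_single_mul _ hq⟩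
    rw [Ne, map_eq_zero_iff _ HahnSeries.ofPowerSeries_injective]
    rintro rfl
    exact hq (map_zero _)
  · rintro ⟨h0, hn⟩
    obtain ⟨m, q, hq, h⟩ := LaurentSeries.exists_eq_single_mul h0
    rw [h, LaurentSeries.order_single_mul _ hq] at hn
    exact ⟨q, hq, hn ▸ h⟩

/-- The order of vanishing of a rational function at a geometric point. -/
noncomputable def ordAt (s₀ : OnePoint (AlgebraicClosure K)) (f : RatFunc K) : ℤ :=
  (localExpansion s₀ f).order

variable {s₀ : OnePoint (AlgebraicClosure K)}

theorem ordAt_mul {f g : RatFunc K} (hf : f ≠ 0) (hg : g ≠ 0) :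
    ordAt s₀ (f * g) = ordAt s₀ f + ordAt s₀ g := by
  rw [ordAt, map_mul, HahnSeries.order_mul ((map_ne_zero_iff _ (localExpansion s₀).injective).2 hf)
    ((map_ne_zero_iff _ (localExpansion s₀).injective).2 hg)]
  rfl

theorem ordAt_inv (f : RatFunc K) : ordAt s₀ f⁻¹ = -ordAt s₀ f := by
  rw [ordAt, map_inv₀, LaurentSeries.order_inv]; rfl

theorem ordAt_div {f g : RatFunc K} (hf : f ≠ 0) (hg : g ≠ 0) :
    ordAt s₀ (f / g) = ordAt s₀ f - ordAt s₀ g := by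
  rw [div_eq_mul_inv, ordAt_mul hf (inv_ne_zero hg), ordAt_inv, sub_eq_add_neg]

theorem ordAt_pow {f : RatFunc K} (n : ℕ) : ordAt s₀ (f ^ n) = n * ordAt s₀ f := by
  rw [ordAt, map_pow, HahnSeries.order_pow, nsmul_eq_mul]; rfl

theorem ordAt_C (c : K) : ordAt s₀ (RatFunc.C c) = 0 := by
  rw [ordAt, localExpansion_C]
  exact HahnSeries.order_C

theorem hasMultiplicity_coe_iff {f : RatFunc K} {c : K} {n : ℕ} :
    HasMultiplicity f s₀ (algebraMap K (AlgebraicClosure K) c : AlgebraicClosure K) n ↔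
      f - RatFunc.C c ≠ 0 ∧ ordAt s₀ (f - RatFunc.C c) = n := by
  rw [hasMultiplicity_iff, ordAt, ← map_ne_zero_iff _ (localExpansion s₀).injective, map_sub,
    localExpansion_C]
  rfl

theorem hasMultiplicity_infty_iff {f : RatFunc K} {n : ℕ} :
    HasMultiplicity f s₀ OnePoint.infty n ↔ f⁻¹ ≠ 0 ∧ ordAt s₀ f⁻¹ = n := by
  rw [hasMultiplicity_iff, ordAt, ← map_ne_zero_iff _ (localExpansion s₀).injective, map_inv₀]
  rfl

theorem localExpansion_algebraMap (a : AlgebraicClosure K) (r : K[X]) :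
    ∃ T : PowerSeries (AlgebraicClosure K), PowerSeries.constantCoeff T = aeval a r ∧
      localExpansion (a : OnePoint (AlgebraicClosure K)) (algebraMap K[X] (RatFunc K) r) =
        HahnSeries.ofPowerSeries ℤ _ T := by
  set Θ : K[X] →+* PowerSeries (AlgebraicClosure K) :=
    eval₂RingHom (PowerSeries.C.comp (algebraMap K _)) (PowerSeries.C a + PowerSeries.X) with hΘ
  refine ⟨Θ r, ?_, ?_⟩
  · have : (PowerSeries.constantCoeff (R := AlgebraicClosure K)).comp Θ = (aeval a).toRingHom := by
      refine ringHom_ext (fun a => ?_) ?_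
      · simp [hΘ]
      · simp [hΘ]
    exact RingHom.congr_fun this r
  · have : (localExpansion (a : OnePoint (AlgebraicClosure K))).comp (algebraMap K[X] (RatFunc K)) =
        (HahnSeries.ofPowerSeries ℤ _).comp Θ := by
      refine ringHom_ext (fun a => ?_) ?_
      · simp [hΘ, RatFunc.algebraMap_C]
      · simp [hΘ, RatFunc.algebraMap_X, localExpansion_X, RegularGExtension.puiseuxParameter_coe]
    exact RingHom.congr_fun this r

theorem ordAt_algebraMap_nonneg (a : AlgebraicClosure K) (r : K[X]) :
    0 ≤ ordAt (a : OnePoint (AlgebraicClosure K)) (algebraMap K[X] (RatFunc K) r) := by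
  obtain ⟨T, -, hT⟩ := localExpansion_algebraMap a r
  rw [ordAt, hT]
  by_contra hlt
  have h0 : HahnSeries.ofPowerSeries ℤ (AlgebraicClosure K) T ≠ 0 := by
    rintro h
    exact hlt (by rw [h, HahnSeries.order_zero])
  have h3 := mt HahnSeries.coeff_order_eq_zero.1 h0
  rw [PowerSeries.coeff_coe, if_pos (not_le.1 hlt)] at h3
  exact h3 rfl

theorem ordAt_algebraMap_eq_zero {a : AlgebraicClosure K} {r : K[X]} (h : aeval a r ≠ 0) :
    ordAt (a : OnePoint (AlgebraicClosure K)) (algebraMap K[X] (RatFunc K) r) = 0 := by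
  obtain ⟨T, hT0, hT⟩ := localExpansion_algebraMap a r
  have := LaurentSeries.order_single_mul 0 (q := T) (by rwa [hT0])
  rwa [HahnSeries.single_zero_one, one_mul, ← hT] at this

theorem aeval_eq_zero_of_ordAt_pos {a : AlgebraicClosure K} {r : K[X]}
    (h : 0 < ordAt (a : OnePoint (AlgebraicClosure K)) (algebraMap K[X] (RatFunc K) r)) :
    aeval a r = 0 := by
  by_contra h0
  rw [ordAt_algebraMap_eq_zero h0] at h
  exact h.false

theorem ordAt_X_sub_C_self (c : K) :
    ordAt ((algebraMap K (AlgebraicClosure K) c : AlgebraicClosure K) : OnePoint (AlgebraicClosure K))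
      (RatFunc.X - RatFunc.C c) = 1 := by
  rw [ordAt, map_sub, localExpansion_C, localExpansion_X, RegularGExtension.puiseuxParameter_coe,
    add_sub_cancel_left, HahnSeries.order_single one_ne_zero, Nat.cast_one]

theorem ordAt_X_sub_C_of_ne {a : AlgebraicClosure K} {c : K} (h : a ≠ algebraMap K _ c) :
    ordAt (a : OnePoint (AlgebraicClosure K)) (RatFunc.X - RatFunc.C c) = 0 := by
  have h1 : (RatFunc.X - RatFunc.C c : RatFunc K) = algebraMap K[X] (RatFunc K) (X - C c) := by
    simp [RatFunc.algebraMap_X, RatFunc.algebraMap_C]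
  rw [h1]
  exact ordAt_algebraMap_eq_zero (by simpa [sub_eq_zero] using h)

theorem ordAt_infty_linear {α β : K} (hβ : β ≠ 0) :
    ordAt OnePoint.infty (RatFunc.C α + RatFunc.C β * RatFunc.X) = -1 := by
  have hβ' : algebraMap K (AlgebraicClosure K) β ≠ 0 := (_root_.map_ne_zero _).2 hβ
  rw [ordAt, map_add, map_mul, localExpansion_C, localExpansion_C, localExpansion_X,
    RegularGExtension.puiseuxParameter_infty]
  have := LaurentSeries.order_single_mul (-1) (q := PowerSeries.C (algebraMap K (AlgebraicClosure K) β) +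
    PowerSeries.C (algebraMap K (AlgebraicClosure K) α) * PowerSeries.X) (by simpa using hβ)
  rw [← this]
  congr 1
  simp only [map_add, map_mul, HahnSeries.ofPowerSeries_C, HahnSeries.ofPowerSeries_X, mul_add,
    Nat.cast_one]
  rw [mul_left_comm (HahnSeries.single (-1) 1), HahnSeries.single_mul_single, add_comm, mul_comm]
  congr 1
  simp

/-- A nonconstant rational function takes each value only finitely often. -/
theorem finite_setOf_hasMultiplicity {f : RatFunc K} (hf : ¬ ∃ c, f = RatFunc.C c)
    (p : OnePoint (AlgebraicClosure K)) : {s₀ | ∃ n, 0 < n ∧ HasMultiplicity f s₀ p n}.Finite := by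
  classical
  have hfin : ∀ R : (AlgebraicClosure K)[X], R ≠ 0 →
      (∀ a : AlgebraicClosure K, ∀ n, 0 < n → HasMultiplicity f a p n → R.eval a = 0) →
      {s₀ | ∃ n, 0 < n ∧ HasMultiplicity f s₀ p n}.Finite := by
    intro R hR h
    refine ((R.roots.toFinset.finite_toSet.image
      (OnePoint.some : AlgebraicClosure K → OnePoint (AlgebraicClosure K))).insert OnePoint.infty).subset ?_
    rintro s₀ ⟨n, hn, hs⟩
    induction s₀ using OnePoint.rec with
    | infty => exact Set.mem_insert _ _
    | coe a =>
      refine Set.mem_insert_of_mem _ ⟨a, ?_, rfl⟩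
      exact Multiset.mem_toFinset.2 ((mem_roots hR).2 (h a n hn hs))
  have hden : algebraMap K[X] (RatFunc K) f.denom ≠ 0 := RatFunc.algebraMap_ne_zero f.denom_ne_zero
  have hf0 : f ≠ 0 := fun h => hf ⟨0, by rw [h, map_zero]⟩
  have hfden : algebraMap K[X] (RatFunc K) f.num = f * algebraMap K[X] (RatFunc K) f.denom := by
    have h := RatFunc.num_div_denom f
    rwa [div_eq_iff hden] at h
  induction p using OnePoint.rec with
  | infty =>
    refine hfin (f.denom.map (algebraMap K _)) (Polynomial.map_ne_zero f.denom_ne_zero) ?_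
    intro a n hn h
    obtain ⟨-, h2⟩ := hasMultiplicity_infty_iff.1 h
    have hnum : algebraMap K[X] (RatFunc K) f.num ≠ 0 := hfden ▸ mul_ne_zero hf0 hden
    have h3 : algebraMap K[X] (RatFunc K) f.denom = f⁻¹ * algebraMap K[X] (RatFunc K) f.num := by
      rw [hfden, inv_mul_cancel_left₀ hf0]
    rw [eval_map_algebraMap]
    apply aeval_eq_zero_of_ordAt_pos
    rw [h3, ordAt_mul (inv_ne_zero hf0) hnum, h2]
    have := ordAt_algebraMap_nonneg a f.num
    omega
  | coe b =>
    refine hfin (f.num.map (algebraMap K _) - C b * f.denom.map (algebraMap K _)) ?_ ?_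
    · intro hR
      rw [sub_eq_zero] at hR
      have hlead := congrArg (fun q => q.coeff f.denom.natDegree) hR
      simp only [coeff_map, coeff_C_mul, coeff_natDegree, f.monic_denom.leadingCoeff, map_one,
        mul_one] at hlead
      rw [← hlead, ← map_C, ← Polynomial.map_mul] at hR
      have h1 := map_injective _ (algebraMap K (AlgebraicClosure K)).injective hR
      refine hf ⟨f.num.coeff f.denom.natDegree, ?_⟩
      have h2 := hfden
      rw [h1, map_mul, RatFunc.algebraMap_C] at h2
      exact (mul_right_cancel₀ hden h2).symm
    · intro a n hn h
      obtain ⟨h1, h2⟩ := hasMultiplicity_iff.1 h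
      obtain ⟨T, hT0, hT⟩ := localExpansion_algebraMap a f.num
      obtain ⟨T', hT0', hT'⟩ := localExpansion_algebraMap a f.denom
      rw [eval_sub, eval_mul, eval_C, eval_map_algebraMap, eval_map_algebraMap]
      by_contra hne
      have h3 := LaurentSeries.order_single_mul 0 (q := T - PowerSeries.C b * T') (by
        rwa [map_sub, map_mul, PowerSeries.constantCoeff_C, hT0, hT0'])
      have h4 : HahnSeries.ofPowerSeries ℤ _ (T - PowerSeries.C b * T') =
          localParameterAt (b : OnePoint (AlgebraicClosure K)) (localExpansion (a : OnePoint _) f) *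
            localExpansion (a : OnePoint _) (algebraMap K[X] (RatFunc K) f.denom) := by
        change _ = (localExpansion (a : OnePoint _) f - HahnSeries.C b) * _
        rw [sub_mul, ← map_mul, ← hfden, hT, hT', map_sub, map_mul, HahnSeries.ofPowerSeries_C]
      have h5 : localExpansion (a : OnePoint (AlgebraicClosure K))
          (algebraMap K[X] (RatFunc K) f.denom) ≠ 0 := (_root_.map_ne_zero _).2 hden
      rw [HahnSeries.single_zero_one, one_mul, h4, HahnSeries.order_mul h1 h5, h2] at h3
      have h6 : 0 ≤ (localExpansion (a : OnePoint (AlgebraicClosure K))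
        (algebraMap K[X] (RatFunc K) f.denom)).order := ordAt_algebraMap_nonneg a f.denom
      omega

end Orders

/-! ### Moving the two exceptional branch points to `0` and `∞` -/

section Moebius

open Polynomial

variable {K : Type u} [Field K]

theorem RatFunc.subfield_eq_top {S : Subfield (RatFunc K)} (hC : ∀ c, RatFunc.C c ∈ S)
    (hX : RatFunc.X ∈ S) : S = ⊤ := by
  have hpoly : ∀ r : K[X], algebraMap K[X] (RatFunc K) r ∈ S := by
    intro r
    induction r using Polynomial.induction_on' with
    | add p q hp hq => rw [map_add]; exact add_mem hp hq
    | monomial n a =>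
      rw [← C_mul_X_pow_eq_monomial, map_mul, map_pow, RatFunc.algebraMap_C, RatFunc.algebraMap_X]
      exact mul_mem (hC a) (pow_mem hX n)
  refine eq_top_iff.2 fun x _ => ?_
  rw [← RatFunc.num_div_denom x]
  exact div_mem (hpoly _) (hpoly _)

/-- A Möbius transformation that fixes `0` is a local parameter at `0`, without other
zeros. -/
theorem ordAt_numerator {γ δ : K} (hγ : γ ≠ 0) :
    (RatFunc.C γ * RatFunc.X / (1 + RatFunc.C δ * RatFunc.X) : RatFunc K) ≠ 0 ∧
    ordAt ((0 : AlgebraicClosure K) : OnePoint (AlgebraicClosure K))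
      (RatFunc.C γ * RatFunc.X / (1 + RatFunc.C δ * RatFunc.X)) = 1 ∧
    ∀ s₀ : OnePoint (AlgebraicClosure K), s₀ ≠ ((0 : AlgebraicClosure K) : OnePoint _) →
      ordAt s₀ (RatFunc.C γ * RatFunc.X / (1 + RatFunc.C δ * RatFunc.X)) ≤ 0 := by
  have hγ' : (RatFunc.C γ : RatFunc K) ≠ 0 := (map_ne_zero_iff _ RatFunc.C_injective).2 hγ
  have hℓ : (1 + RatFunc.C δ * RatFunc.X : RatFunc K) = algebraMap K[X] (RatFunc K) (1 + C δ * X) := by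
    simp [RatFunc.algebraMap_X, RatFunc.algebraMap_C]
  have hℓ0 : (1 + C δ * X : K[X]) ≠ 0 := by
    intro h
    have := congrArg (eval 0) h
    simp at this
  have hℓ0' : (1 + RatFunc.C δ * RatFunc.X : RatFunc K) ≠ 0 := hℓ ▸ RatFunc.algebraMap_ne_zero hℓ0
  have key : ∀ s₀ : OnePoint (AlgebraicClosure K),
      ordAt s₀ (RatFunc.C γ * RatFunc.X / (1 + RatFunc.C δ * RatFunc.X)) =
        ordAt s₀ (RatFunc.X : RatFunc K) - ordAt s₀ (1 + RatFunc.C δ * RatFunc.X : RatFunc K) := by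
    intro s₀
    rw [ordAt_div (mul_ne_zero hγ' RatFunc.X_ne_zero) hℓ0', ordAt_mul hγ' RatFunc.X_ne_zero,
      ordAt_C, zero_add]
  refine ⟨div_ne_zero (mul_ne_zero hγ' RatFunc.X_ne_zero) hℓ0', ?_, fun s₀ hs₀ => ?_⟩
  · rw [key]
    have h1 := ordAt_X_sub_C_self (0 : K)
    rw [map_zero, map_zero, sub_zero] at h1
    rw [h1, hℓ, ordAt_algebraMap_eq_zero (by simp), sub_zero]
  · rw [key]
    induction s₀ using OnePoint.rec with
    | infty =>
      have h1 := ordAt_infty_linear (α := (0 : K)) (β := 1) one_ne_zero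
      rw [map_zero, map_one, zero_add, one_mul] at h1
      rw [h1]
      by_cases hδ : δ = 0
      · rw [hδ, map_zero, zero_mul, add_zero, ← map_one (RatFunc.C (K := K)), ordAt_C]
        norm_num
      · have h2 := ordAt_infty_linear (α := (1 : K)) hδ
        rw [map_one] at h2
        rw [h2]
        norm_num
    | coe a =>
      have ha : a ≠ algebraMap K _ 0 := by
        rw [map_zero]; rintro rfl; exact hs₀ rfl
      have h1 := ordAt_X_sub_C_of_ne ha
      rw [map_zero, sub_zero] at h1
      have h2 := ordAt_algebraMap_nonneg a (1 + C δ * X : K[X])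
      rw [h1, hℓ]
      omega

/-- A Möbius transformation that maps `∞` to `0` is a local parameter at `∞`, without other zeros. -/
theorem ordAt_denominator {γ δ : K} (hγ : γ ≠ 0) :
    (RatFunc.C γ / (RatFunc.C δ + RatFunc.X) : RatFunc K) ≠ 0 ∧
    ordAt OnePoint.infty (RatFunc.C γ / (RatFunc.C δ + RatFunc.X)) = 1 ∧
    ∀ s₀ : OnePoint (AlgebraicClosure K), s₀ ≠ OnePoint.infty →
      ordAt s₀ (RatFunc.C γ / (RatFunc.C δ + RatFunc.X)) ≤ 0 := by
  have hγ' : (RatFunc.C γ : RatFunc K) ≠ 0 := (map_ne_zero_iff _ RatFunc.C_injective).2 hγ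
  have hℓ : (RatFunc.C δ + RatFunc.X : RatFunc K) = algebraMap K[X] (RatFunc K) (C δ + X) := by
    simp [RatFunc.algebraMap_X, RatFunc.algebraMap_C]
  have hℓ0' : (RatFunc.C δ + RatFunc.X : RatFunc K) ≠ 0 := by
    rw [hℓ, add_comm]; exact RatFunc.algebraMap_ne_zero (X_add_C_ne_zero δ)
  have key : ∀ s₀ : OnePoint (AlgebraicClosure K),
      ordAt s₀ (RatFunc.C γ / (RatFunc.C δ + RatFunc.X)) =
        - ordAt s₀ (RatFunc.C δ + RatFunc.X : RatFunc K) := by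
    intro s₀
    rw [ordAt_div hγ' hℓ0', ordAt_C, zero_sub]
  refine ⟨div_ne_zero hγ' hℓ0', ?_, fun s₀ hs₀ => ?_⟩
  · have h2 := ordAt_infty_linear (α := δ) (β := 1) one_ne_zero
    rw [map_one, one_mul] at h2
    rw [key, h2, neg_neg]
  · rw [key]
    induction s₀ using OnePoint.rec with
    | infty => exact absurd rfl hs₀
    | coe a =>
      have h2 := ordAt_algebraMap_nonneg a (C δ + X : K[X])
      rw [hℓ]
      omega

/-- A projective linear transformation that takes `0` and `∞` to two given rational points. -/
theorem exists_moebius {p₁ p₂ : OnePoint (AlgebraicClosure K)} (hne : p₁ ≠ p₂)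
    (h₁ : p₁ = OnePoint.infty ∨ ∃ a : K, p₁ = (algebraMap K (AlgebraicClosure K) a : AlgebraicClosure K))
    (h₂ : p₂ = OnePoint.infty ∨ ∃ a : K, p₂ = (algebraMap K (AlgebraicClosure K) a : AlgebraicClosure K)) :
    ∃ M : RatFunc K, (∀ S : Subfield (RatFunc K), (∀ c, RatFunc.C c ∈ S) → M ∈ S → S = ⊤) ∧
      (∀ s₀ n, 0 < n → HasMultiplicity M s₀ p₁ n →
        s₀ = ((0 : AlgebraicClosure K) : OnePoint (AlgebraicClosure K))) ∧
      (∀ s₀ n, 0 < n → HasMultiplicity M s₀ p₂ n → s₀ = OnePoint.infty) ∧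
      HasMultiplicity M ((0 : AlgebraicClosure K) : OnePoint (AlgebraicClosure K)) p₁ 1 ∧
      HasMultiplicity M OnePoint.infty p₂ 1 := by
  suffices ∃ M f₁ f₂ : RatFunc K, (∀ S : Subfield (RatFunc K), (∀ c, RatFunc.C c ∈ S) → M ∈ S →
        RatFunc.X ∈ S) ∧
      (∀ s₀ n, HasMultiplicity M s₀ p₁ n ↔ f₁ ≠ 0 ∧ ordAt s₀ f₁ = n) ∧
      (∀ s₀ n, HasMultiplicity M s₀ p₂ n ↔ f₂ ≠ 0 ∧ ordAt s₀ f₂ = n) ∧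
      (∃ γ δ : K, γ ≠ 0 ∧ f₁ = RatFunc.C γ * RatFunc.X / (1 + RatFunc.C δ * RatFunc.X)) ∧
      ∃ γ δ : K, γ ≠ 0 ∧ f₂ = RatFunc.C γ / (RatFunc.C δ + RatFunc.X) by
    obtain ⟨M, f₁, f₂, hX, h1, h2, ⟨γ, δ, hγ, hf₁⟩, ⟨γ', δ', hγ', hf₂⟩⟩ := this
    obtain ⟨a1, a2, a3⟩ := ordAt_numerator (γ := γ) (δ := δ) hγ
    obtain ⟨b1, b2, b3⟩ := ordAt_denominator (γ := γ') (δ := δ') hγ'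
    rw [← hf₁] at a1 a2 a3
    rw [← hf₂] at b1 b2 b3
    refine ⟨M, fun S hC hM => RatFunc.subfield_eq_top hC (hX S hC hM), fun s₀ n hn h => ?_,
      fun s₀ n hn h => ?_, (h1 _ _).2 ⟨a1, by rw [a2]; rfl⟩, (h2 _ _).2 ⟨b1, by rw [b2]; rfl⟩⟩
    · by_contra hs
      have := a3 s₀ hs
      have := ((h1 _ _).1 h).2
      omega
    · by_contra hs
      have := b3 s₀ hs
      have := ((h2 _ _).1 h).2
      omega
  have hXC : ∀ δ : K, (RatFunc.C δ + RatFunc.X : RatFunc K) ≠ 0 := fun δ =>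
    (ordAt_denominator (δ := δ) one_ne_zero).1 ∘ fun h => by rw [h, div_zero]
  have hXC' : ∀ δ : K, (1 + RatFunc.C δ * RatFunc.X : RatFunc K) ≠ 0 := fun δ =>
    (ordAt_numerator (δ := δ) one_ne_zero).1 ∘ fun h => by rw [h, div_zero]
  have hX0 : (RatFunc.X : RatFunc K) ≠ 0 := RatFunc.X_ne_zero
  rcases h₁ with rfl | ⟨a, rfl⟩
  · rcases h₂ with rfl | ⟨b, rfl⟩
    · exact absurd rfl hne
    · refine ⟨RatFunc.C b + RatFunc.X⁻¹, _, _, fun S hC hM => ?_,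
        fun s₀ n => hasMultiplicity_infty_iff, fun s₀ n => hasMultiplicity_coe_iff,
        ⟨1, b, one_ne_zero, ?_⟩, ⟨1, 0, one_ne_zero, ?_⟩⟩
      · have := inv_mem (sub_mem hM (hC b))
        rwa [add_sub_cancel_left, inv_inv] at this
      · have := hXC' b
        rw [map_one, one_mul, eq_div_iff this, inv_mul_eq_iff_eq_mul₀ (by
          intro h
          apply this
          have := congrArg (· * RatFunc.X) h
          simpa [add_mul, hX0, add_comm] using this)]
        field_simp
        ring
      · rw [map_one, map_zero, zero_add, add_sub_cancel_left, one_div]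
  · rcases h₂ with rfl | ⟨b, rfl⟩
    · refine ⟨RatFunc.C a + RatFunc.X, _, _, fun S hC hM => ?_,
        fun s₀ n => hasMultiplicity_coe_iff, fun s₀ n => hasMultiplicity_infty_iff,
        ⟨1, 0, one_ne_zero, ?_⟩, ⟨1, a, one_ne_zero, ?_⟩⟩
      · have := sub_mem hM (hC a)
        rwa [add_sub_cancel_left] at this
      · simp
      · rw [map_one, one_div]
    · have hab : a ≠ b := fun h => hne (by rw [h])
      have h1 := hXC 1
      rw [map_one] at h1
      refine ⟨(RatFunc.C a + RatFunc.C b * RatFunc.X) / (1 + RatFunc.X), _, _, fun S hC hM => ?_,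
        fun s₀ n => hasMultiplicity_coe_iff, fun s₀ n => hasMultiplicity_coe_iff,
        ⟨b - a, 1, sub_ne_zero.2 hab.symm, ?_⟩, ⟨a - b, 1, sub_ne_zero.2 hab, ?_⟩⟩
      · have h2 := div_mem (sub_mem hM (hC a)) (sub_mem (hC b) hM)
        have hab' : (RatFunc.C b - RatFunc.C a : RatFunc K) ≠ 0 := by
          rw [← map_sub]; exact (map_ne_zero_iff _ RatFunc.C_injective).2 (sub_ne_zero.2 hab.symm)
        convert h2 using 1
        rw [eq_div_iff]
        · field_simp
          ring
        · have : (RatFunc.C b - (RatFunc.C a + RatFunc.C b * RatFunc.X) / (1 + RatFunc.X) : RatFunc K) =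
            (RatFunc.C b - RatFunc.C a) / (1 + RatFunc.X) := by field_simp; ring
          rw [this]
          exact div_ne_zero hab' h1
      · rw [map_one, one_mul, map_sub]
        field_simp
        ring
      · rw [map_one, map_sub]
        field_simp
        ring

end Moebius

section MoebiusPullback

open Polynomial

namespace RegularGExtension

variable {K : Type u} [Field K] {G : Type v} [Group G]

/-- Pullback along a change of coordinate. -/
theorem exists_pullback_of_generator [CharZero K] (N : RegularGExtension.{u, v, w} K G) {M : RatFunc K}
    (hM : ∀ S : Subfield (RatFunc K), (∀ c, RatFunc.C c ∈ S) → M ∈ S → S = ⊤) :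
    (¬ ∃ c, M = RatFunc.C c) ∧ ∃ (N' : RegularGExtension.{u, v, u} K G) (j : N.carrier →+* N'.carrier),
      N.IsPullback M N' j := by
  have hMC : ¬ ∃ c, M = RatFunc.C c := by
    rintro ⟨c, hc⟩
    have h1 := hM (RatFunc.C (K := K)).fieldRange (fun c => ⟨c, rfl⟩) ⟨c, hc.symm⟩
    obtain ⟨d, hd⟩ : (RatFunc.X : RatFunc K) ∈ (RatFunc.C (K := K)).fieldRange := by
      rw [h1]; exact Subfield.mem_top _
    rw [← RatFunc.algebraMap_C, ← RatFunc.algebraMap_X] at hd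
    have h2 := congrArg natDegree (RatFunc.algebraMap_injective K hd)
    simp at h2
  refine ⟨hMC, N.exists_pullback hMC fun ι hιC hιt y hy => ?_⟩
  refine mem_range_of_mem_closure N.regular ι ?_
  set T := Set.range (ι.comp (algebraMap (RatFunc K) N.carrier)) ∪
    {α | ∃ p : K[X], p ≠ 0 ∧ p.eval₂ (ι.comp (algebraMap K N.carrier)) α = 0} with hT
  have hιK : ι.comp (algebraMap K N.carrier) = algebraMap K (AlgebraicClosure (RatFunc K)) :=
    RingHom.ext hιC
  have htop := hM ((Subfield.closure T).comap (algebraMap (RatFunc K) (AlgebraicClosure (RatFunc K))))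
    (fun c => by
      refine Subfield.subset_closure (Or.inl ⟨RatFunc.C c, ?_⟩)
      rw [RingHom.comp_apply, N.algebraMap_C, hιC, IsScalarTower.algebraMap_apply K (RatFunc K),
        RatFunc.algebraMap_eq_C])
    (Subfield.subset_closure (Or.inl ⟨RatFunc.X, hιt⟩))
  generalize ι y = x at hy
  induction hy using IntermediateField.adjoin_induction with
  | mem x hx =>
    obtain ⟨p, hp, hpx⟩ := hx
    exact Subfield.subset_closure (Or.inr ⟨p, hp, by rw [hιK]; exact hpx⟩)
  | algebraMap x =>
    have : x ∈ (Subfield.closure T).comap (algebraMap (RatFunc K) (AlgebraicClosure (RatFunc K))) := by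
      rw [htop]; exact Subfield.mem_top _
    exact this
  | add x y _ _ hx hy => exact add_mem hx hy
  | inv x _ hx => exact inv_mem hx
  | mul x y _ _ hx hy => exact mul_mem hx hy

theorem IsPullback.nonempty_puiseuxEmbedding_of_hasMultiplicity [CharZero K]
    {N : RegularGExtension.{u, v, w} K G} {f : RatFunc K} {N' : RegularGExtension.{u, v, u} K G}
    {j : N.carrier →+* N'.carrier} (h : N.IsPullback f N' j) (hf : ¬ ∃ c, f = RatFunc.C c)
    {s₀ p : OnePoint (AlgebraicClosure K)} {n e : ℕ} (hn : 0 < n) (he : 0 < e)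
    (hmult : HasMultiplicity f s₀ p n) (φ : N.PuiseuxEmbedding p e) :
    Nonempty (N'.PuiseuxEmbedding s₀ e) :=
  h.nonempty_puiseuxEmbedding hf hmult hn he he (mul_comm _ _) φ

theorem mem_branchPoints_iff (N : RegularGExtension.{u, v, w} K G) {p : OnePoint (AlgebraicClosure K)} :
    p ∈ N.branchPoints ↔ IsEmpty (N.PuiseuxEmbedding p 1) := by
  rw [← not_iff_not, not_isEmpty_iff]
  constructor
  · intro h
    have h1 : N.ramificationIndex p = 1 := not_not.1 h
    have h2 := Nat.sInf_mem (Nat.nonempty_of_sInf_eq_succ h1)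
    change 0 < N.ramificationIndex p ∧ Nonempty (N.PuiseuxEmbedding p (N.ramificationIndex p)) at h2
    rw [h1] at h2
    exact h2.2
  · rintro ⟨φ⟩ h
    exact h (N.ramificationIndex_eq_one φ)

theorem IsPullback.finite_branchPoints [CharZero K]
    {N : RegularGExtension.{u, v, w} K G} {f : RatFunc K} {N' : RegularGExtension.{u, v, u} K G}
    {j : N.carrier →+* N'.carrier} (h : N.IsPullback f N' j) (hf : ¬ ∃ c, f = RatFunc.C c)
    (hfin : N.branchPoints.Finite) : N'.branchPoints.Finite := by
  refine (hfin.biUnion fun p _ => finite_setOf_hasMultiplicity hf p).subset fun s₀ hs₀ => ?_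
  obtain ⟨p, n, hn, hmult⟩ := exists_hasMultiplicity hf s₀
  refine Set.mem_biUnion (N.mem_branchPoints_iff.2 ⟨fun φ => ?_⟩) ⟨n, hn, hmult⟩
  obtain ⟨ψ⟩ := h.nonempty_puiseuxEmbedding_of_hasMultiplicity hf hn one_pos hmult φ
  exact (N'.mem_branchPoints_iff.1 hs₀).false ψ

/-- A change of coordinate moves two rational points to `0` and `∞`. -/
theorem exists_moebius_pullback [CharZero K] (N : RegularGExtension.{u, v, w} K G)
    {p₁ p₂ : OnePoint (AlgebraicClosure K)} (hne : p₁ ≠ p₂)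
    (h₁ : p₁ = OnePoint.infty ∨ ∃ a : K, p₁ = (algebraMap K (AlgebraicClosure K) a : AlgebraicClosure K))
    (h₂ : p₂ = OnePoint.infty ∨ ∃ a : K, p₂ = (algebraMap K (AlgebraicClosure K) a : AlgebraicClosure K))
    {m : ℕ} (hram : ∀ p, p ≠ p₁ → p ≠ p₂ → ∃ e, 0 < e ∧ e ∣ m ∧ Nonempty (N.PuiseuxEmbedding p e))
    (hfin : N.branchPoints.Finite) {e₁ e₂ : ℕ} (he₁ : 0 < e₁) (he₂ : 0 < e₂)
    {φ₁ : N.PuiseuxEmbedding p₁ e₁} {φ₂ : N.PuiseuxEmbedding p₂ e₂} {z₁ z₂ : AlgebraicClosure K}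
    (hz₁ : z₁ ^ e₁ = 1) (hz₂ : z₂ ^ e₂ = 1) {g₁ g₂ : G} (hg₁ : φ₁.Rotates z₁ g₁)
    (hg₂ : φ₂.Rotates z₂ g₂) :
    ∃ N' : RegularGExtension.{u, v, u} K G,
      (∃ ψ : N'.PuiseuxEmbedding ((0 : AlgebraicClosure K) : OnePoint (AlgebraicClosure K)) e₁,
        ψ.Rotates z₁ g₁) ∧
      (∃ ψ : N'.PuiseuxEmbedding OnePoint.infty e₂, ψ.Rotates z₂ g₂) ∧
      (∀ p, p ≠ ((0 : AlgebraicClosure K) : OnePoint (AlgebraicClosure K)) → p ≠ OnePoint.infty →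
        ∃ e, 0 < e ∧ e ∣ m ∧ Nonempty (N'.PuiseuxEmbedding p e)) ∧
      N'.branchPoints.Finite := by
  obtain ⟨M, hM, hM1, hM2, hM0, hMi⟩ := exists_moebius hne h₁ h₂
  obtain ⟨hMC, N', j, h⟩ := N.exists_pullback_of_generator hM
  refine ⟨N', h.exists_rotates hMC hM0 he₁ φ₁ hz₁ hg₁, h.exists_rotates hMC hMi he₂ φ₂ hz₂ hg₂,
    fun s₀ hs hs' => ?_, h.finite_branchPoints hMC hfin⟩
  obtain ⟨p, n, hn, hmult⟩ := exists_hasMultiplicity hMC s₀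
  obtain ⟨e, he, hem, ⟨φ⟩⟩ := hram p (fun hp => hs (hM1 s₀ n hn (hp ▸ hmult)))
    (fun hp => hs' (hM2 s₀ n hn (hp ▸ hmult)))
  exact ⟨e, he, hem, h.nonempty_puiseuxEmbedding_of_hasMultiplicity hMC hn he hmult φ⟩

/-- The coordinate change `t ↦ 1 / t`. -/
theorem exists_inversion_pullback [CharZero K] (N : RegularGExtension.{u, v, w} K G) {e : ℕ} (he : 0 < e)
    {φ : N.PuiseuxEmbedding OnePoint.infty e} {z : AlgebraicClosure K} (hz : z ^ e = 1) {g : G}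
    (hg : φ.Rotates z g) :
    ∃ (N' : RegularGExtension.{u, v, u} K G) (j : N.carrier →+* N'.carrier),
      N.IsPullback RatFunc.X⁻¹ N' j ∧
      ∃ ψ : N'.PuiseuxEmbedding ((0 : AlgebraicClosure K) : OnePoint (AlgebraicClosure K)) e,
        ψ.Rotates z g := by
  obtain ⟨hMC, N', j, h⟩ := N.exists_pullback_of_generator (M := RatFunc.X⁻¹) fun S hC hX =>
    RatFunc.subfield_eq_top hC (by have := inv_mem hX; rwa [inv_inv] at this)
  refine ⟨N', j, h, h.exists_rotates hMC (hasMultiplicity_infty_iff.2 ⟨?_, ?_⟩) he φ hz hg⟩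
  · rw [inv_inv]; exact RatFunc.X_ne_zero
  · have h1 := ordAt_X_sub_C_self (0 : K)
    rw [map_zero, map_zero, sub_zero] at h1
    rw [inv_inv, h1, Nat.cast_one]

/-- The ramification index is invariant under the automorphisms of `K̄ / K`. -/
theorem ramificationIndex_algEquiv (N : RegularGExtension.{u, v, w} K G)
    (σ : AlgebraicClosure K ≃ₐ[K] AlgebraicClosure K) (a : AlgebraicClosure K) :
    N.ramificationIndex ((σ a : AlgebraicClosure K) : OnePoint (AlgebraicClosure K)) =
      N.ramificationIndex (a : OnePoint (AlgebraicClosure K)) := by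
  have key : ∀ (τ : AlgebraicClosure K ≃ₐ[K] AlgebraicClosure K) (b : AlgebraicClosure K) (e : ℕ),
      Nonempty (N.PuiseuxEmbedding (b : OnePoint (AlgebraicClosure K)) e) →
      Nonempty (N.PuiseuxEmbedding ((τ b : AlgebraicClosure K) : OnePoint (AlgebraicClosure K)) e) := by
    rintro τ b e ⟨φ⟩
    refine ⟨(LaurentSeries.twist (τ : AlgebraicClosure K →+* AlgebraicClosure K) 1).comp φ.1,
      fun c => ?_, ?_⟩
    · rw [RingHom.comp_apply, φ.2.1, LaurentSeries.twist_C]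
      exact congrArg _ (τ.commutes c)
    · rw [RingHom.comp_apply, φ.2.2, puiseuxParameter_coe, map_add, LaurentSeries.twist_C,
        LaurentSeries.twist_single, puiseuxParameter_coe]
      simp
  unfold ramificationIndex
  congr 1
  ext e
  refine and_congr_right fun _ => ⟨fun h => ?_, key σ a e⟩
  have := key σ.symm _ e h
  rwa [σ.symm_apply_apply] at this

/-- A point that is characterized by its ramification index is rational. -/
theorem eq_algebraMap_of_ramificationIndex [CharZero K] (N : RegularGExtension.{u, v, w} K G)
    {p : OnePoint (AlgebraicClosure K)}
    (h : ∀ q, N.ramificationIndex q = N.ramificationIndex p → q = p) :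
    p = OnePoint.infty ∨ ∃ a : K, p = (algebraMap K (AlgebraicClosure K) a : AlgebraicClosure K) := by
  induction p using OnePoint.rec with
  | infty => exact Or.inl rfl
  | coe b =>
    refine Or.inr ?_
    obtain ⟨a, ha⟩ := (InfiniteGalois.mem_range_algebraMap_iff_fixed (k := K) b).2 fun σ =>
      OnePoint.coe_injective (h _ (N.ramificationIndex_algEquiv σ b))
    exact ⟨a, by rw [ha]⟩

end RegularGExtension

end MoebiusPullback

/-! ### The choice of the specialization points -/

section SpecializationPoints

open IsDedekindDomain WithZero

theorem exists_pos_mul_eq_add {a b : ℕ} (ha : 0 < a) (hab : a.Coprime b) (m : ℤ) :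
    ∃ n : ℕ, 0 < n ∧ ∃ j : ℤ, (b : ℤ) * n = m + a * j := by
  have hbez : (1 : ℤ) = a * a.gcdA b + b * a.gcdB b := by
    rw [← Nat.gcd_eq_gcd_ab, hab.gcd_eq_one, Nat.cast_one]
  have ha' : (0 : ℤ) < a := by exact_mod_cast ha
  refine ⟨((a.gcdB b * m) % a + a).toNat, ?_, -(a.gcdA b * m) - b * ((a.gcdB b * m) / a) + b, ?_⟩
  · have := Int.emod_nonneg (a.gcdB b * m) ha'.ne'
    omega
  · rw [Int.toNat_of_nonneg (by have := Int.emod_nonneg (a.gcdB b * m) ha'.ne'; omega),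
      Int.emod_def]
    linear_combination -m * hbez

variable {K : Type*} [Field K] (v : Valuation K (WithZero (Multiplicative ℤ))) {s μ ν π : K}

theorem valuation_powerQuotient {a b c : ℕ} {α β γ ω : ℤ} (hα : v s = exp α) (hβ : v (s - 1) = exp β)
    (hγ : v (s - μ) = exp γ) (hω : v ν = exp ω) :
    v (ν * s ^ a * (s - 1) ^ b / (s - μ) ^ c) = exp (ω + a * α + b * β - c * γ) := by
  simp only [map_div₀, map_mul, map_pow, hα, hβ, hγ, hω, ← exp_nsmul, nsmul_eq_mul, ← exp_add,
    ← exp_sub]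

/-- A point `s` near `0`: the value at `s` is small and its valuation lies in the class of `m` modulo
`e₁`, by the choice of the valuation `n` of `μ`. -/
theorem exists_point_near_zero {e₁ e₂ n : ℕ} (he₁ : 0 < e₁) {w m j₀ : ℤ} (δ : ℤ) (hπ : v π = exp (-1))
    (hμ : v μ = exp (-(n : ℤ))) (hν : v ν = exp (-(e₁ * e₂ * w)))
    (hm : (e₂ : ℤ) * n = m + e₁ * j₀) (b : ℕ) :
    ∃ s : K, s ≠ 0 ∧ s - 1 ≠ 0 ∧ s - μ ≠ 0 ∧ v (ν * s ^ e₁ * (s - 1) ^ b / (s - μ) ^ e₂) < exp δ ∧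
      ∃ j : ℤ, v (ν * s ^ e₁ * (s - 1) ^ b / (s - μ) ^ e₂) = exp (m + e₁ * j) := by
  obtain ⟨k, hk⟩ : ∃ k : ℕ, (n : ℤ) < k ∧ (e₂ * n - e₁ * e₂ * w - δ : ℤ) < k :=
    ⟨(max (n : ℤ) (e₂ * n - e₁ * e₂ * w - δ)).toNat + 1, by omega, by omega⟩
  have hα : v (π ^ k) = exp (-(k : ℤ)) := by
    rw [map_pow, hπ, ← exp_nsmul, nsmul_eq_mul, mul_neg, mul_one]
  have hβ : v (π ^ k - 1) = exp 0 := by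
    rw [exp_zero, ← map_one v]
    exact v.map_sub_eq_of_lt_right (by rw [hα, map_one, ← exp_zero, exp_lt_exp]; omega)
  have hγ : v (π ^ k - μ) = exp (-(n : ℤ)) := by
    rw [← hμ]
    exact v.map_sub_eq_of_lt_right (by rw [hα, hμ, exp_lt_exp]; omega)
  have hne : ∀ {x : K} {i : ℤ}, v x = exp i → x ≠ 0 := fun h h0 => by
    rw [h0, map_zero] at h; exact exp_ne_zero h.symm
  have hval := valuation_powerQuotient v (a := e₁) (b := b) (c := e₂) hα hβ hγ hν
  refine ⟨π ^ k, hne hα, hne hβ, hne hγ, ?_, j₀ - e₂ * w - k, ?_⟩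
  · rw [hval, exp_lt_exp]
    have : (k : ℤ) ≤ e₁ * k := by nlinarith
    nlinarith
  · rw [hval]
    congr 1
    linear_combination hm

/-- A point `s` near `1`: it serves where `m = 0` but the valuation of `μ` is not under control. -/
theorem exists_point_near_one {e₁ e₂ n b b' : ℕ} (hb : b = e₁ * b') (hb0 : 0 < b) {w : ℤ} (δ : ℤ)
    (hπ : v π = exp (-1)) (hn : 0 < n)
    (hμ : v μ = exp (-(n : ℤ))) (hν : v ν = exp (-(e₁ * e₂ * w))) :
    ∃ s : K, s ≠ 0 ∧ s - 1 ≠ 0 ∧ s - μ ≠ 0 ∧ v (ν * s ^ e₁ * (s - 1) ^ b / (s - μ) ^ e₂) < exp δ ∧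
      ∃ j : ℤ, v (ν * s ^ e₁ * (s - 1) ^ b / (s - μ) ^ e₂) = exp (0 + e₁ * j) := by
  obtain ⟨k, hk⟩ : ∃ k : ℕ, (0 : ℤ) < k ∧ (- (e₁ * e₂ * w) - δ : ℤ) < k :=
    ⟨(max (0 : ℤ) (- (e₁ * e₂ * w) - δ)).toNat + 1, by omega, by omega⟩
  have hβ' : v (π ^ k) = exp (-(k : ℤ)) := by
    rw [map_pow, hπ, ← exp_nsmul, nsmul_eq_mul, mul_neg, mul_one]
  have hβ : v (1 + π ^ k - 1) = exp (-(k : ℤ)) := by rw [add_sub_cancel_left, hβ']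
  have hα : v (1 + π ^ k) = exp 0 := by
    rw [exp_zero, ← map_one v]
    exact v.map_add_eq_of_lt_left (by rw [hβ', map_one, ← exp_zero, exp_lt_exp]; omega)
  have hγ : v (1 + π ^ k - μ) = exp 0 := by
    rw [← hα]
    exact v.map_sub_eq_of_lt_left (by rw [hα, hμ, exp_lt_exp]; omega)
  have hne : ∀ {x : K} {i : ℤ}, v x = exp i → x ≠ 0 := fun h h0 => by
    rw [h0, map_zero] at h; exact exp_ne_zero h.symm
  have hval := valuation_powerQuotient v (a := e₁) (b := b) (c := e₂) hα hβ hγ hν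
  refine ⟨1 + π ^ k, hne hα, hne hβ, hne hγ, ?_, - (e₂ * w) - b' * k, ?_⟩
  · rw [hval, exp_lt_exp]
    have : (k : ℤ) ≤ b * k := by nlinarith
    nlinarith
  · rw [hval, hb]
    congr 1
    push_cast
    ring

/-- A point `s` near `μ`: the inverse of the value at `s` is small and its valuation lies in the class
of `m` modulo `e₂`, by the choice of the valuation `n` of `μ`. -/
theorem exists_point_near_pole {e₁ e₂ n : ℕ} (he₂ : 0 < e₂) {w m j₀ : ℤ} (δ : ℤ) (hπ : v π = exp (-1))
    (hn : 0 < n) (hμ : v μ = exp (-(n : ℤ))) (hν : v ν = exp (-(e₁ * e₂ * w)))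
    (hm : (e₁ : ℤ) * n = m + e₂ * j₀) (b : ℕ) :
    ∃ s : K, s ≠ 0 ∧ s - 1 ≠ 0 ∧ s - μ ≠ 0 ∧ v (ν * s ^ e₁ * (s - 1) ^ b / (s - μ) ^ e₂)⁻¹ < exp δ ∧
      ∃ j : ℤ, v (ν * s ^ e₁ * (s - 1) ^ b / (s - μ) ^ e₂)⁻¹ = exp (m + e₂ * j) := by
  obtain ⟨k, hk⟩ : ∃ k : ℕ, (n : ℤ) < k ∧ (e₁ * n + e₁ * e₂ * w - δ : ℤ) < k :=
    ⟨(max (n : ℤ) (e₁ * n + e₁ * e₂ * w - δ)).toNat + 1, by omega, by omega⟩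
  have hγ' : v (π ^ k) = exp (-(k : ℤ)) := by
    rw [map_pow, hπ, ← exp_nsmul, nsmul_eq_mul, mul_neg, mul_one]
  have hγ : v (μ + π ^ k - μ) = exp (-(k : ℤ)) := by rw [add_sub_cancel_left, hγ']
  have hα : v (μ + π ^ k) = exp (-(n : ℤ)) := by
    rw [← hμ]
    exact v.map_add_eq_of_lt_left (by rw [hγ', hμ, exp_lt_exp]; omega)
  have hβ : v (μ + π ^ k - 1) = exp 0 := by
    rw [exp_zero, ← map_one v]
    exact v.map_sub_eq_of_lt_right (by rw [hα, map_one, ← exp_zero, exp_lt_exp]; omega)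
  have hne : ∀ {x : K} {i : ℤ}, v x = exp i → x ≠ 0 := fun h h0 => by
    rw [h0, map_zero] at h; exact exp_ne_zero h.symm
  have hval := valuation_powerQuotient v (a := e₁) (b := b) (c := e₂) hα hβ hγ hν
  refine ⟨μ + π ^ k, hne hα, hne hβ, hne hγ, ?_, j₀ + e₁ * w - k, ?_⟩
  · rw [map_inv₀, hval, ← exp_neg, exp_lt_exp]
    have : (k : ℤ) ≤ e₂ * k := by nlinarith
    nlinarith
  · rw [map_inv₀, hval, ← exp_neg]
    congr 1
    linear_combination hm

/-- Weak approximation: integers with prescribed valuations at finitely many primes. -/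
theorem exists_valuation_eq {R : Type*} [CommRing R] [IsDedekindDomain R]
    (S : Finset (HeightOneSpectrum R)) (n : HeightOneSpectrum R → ℕ) :
    ∃ y : R, ∀ 𝔭 ∈ S, 𝔭.intValuation y = exp (-(n 𝔭 : ℤ)) := by
  choose π hπ using fun 𝔭 : HeightOneSpectrum R => 𝔭.intValuation_exists_uniformizer
  obtain ⟨y, hy⟩ := IsDedekindDomain.exists_forall_sub_mem_ideal (s := S)
    (fun 𝔭 : HeightOneSpectrum R => 𝔭.asIdeal) (fun 𝔭 => n 𝔭 + 1) (fun 𝔭 _ => 𝔭.prime)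
    (fun 𝔭 _ 𝔮 _ h h' => h (HeightOneSpectrum.ext h')) (fun 𝔭 => π 𝔭 ^ n 𝔭)
  refine ⟨y, fun 𝔭 h𝔭 => ?_⟩
  have h1 := (𝔭.intValuation_le_pow_iff_mem _ _).2 (hy 𝔭 h𝔭)
  have h2 : 𝔭.intValuation (π 𝔭 ^ n 𝔭) = exp (-(n 𝔭 : ℤ)) := by
    rw [map_pow, hπ, ← exp_nsmul, nsmul_eq_mul, mul_neg, mul_one]
  rw [← h2, ← sub_add_cancel y (π 𝔭 ^ n 𝔭)]
  refine 𝔭.intValuation.map_add_eq_of_lt_right (lt_of_le_of_lt h1 ?_)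
  rw [h2, exp_lt_exp]
  push_cast
  omega

theorem finite_setOf_mem {K : Type*} [Field K] [NumberField K] {D : 𝓞 K} (hD : D ≠ 0) :
    {𝔭 : HeightOneSpectrum (𝓞 K) | D ∈ 𝔭.asIdeal}.Finite := by
  refine (HeightOneSpectrum.Support.finite (𝓞 K) (algebraMap (𝓞 K) K D)⁻¹).subset fun 𝔭 h𝔭 => ?_
  have h1 : 𝔭.valuation K (algebraMap (𝓞 K) K D) < 1 := (𝔭.valuation_lt_one_iff_mem D).2 h𝔭
  have h2 : 𝔭.valuation K (algebraMap (𝓞 K) K D) ≠ 0 := (Valuation.ne_zero_iff _).2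
    ((map_ne_zero_iff _ (FaithfulSMul.algebraMap_injective (𝓞 K) K)).2 hD)
  change 1 < 𝔭.valuation K _
  rw [map_inv₀]
  exact (one_lt_inv₀ (zero_lt_iff.2 h2)).2 h1

end SpecializationPoints

/-! ### The pullback without universally ramified primes -/

section Pullback

open Polynomial IsDedekindDomain WithZero EulerOperator

section

variable {K : Type u} [Field K] {a b c : ℕ} {μ ν : K}

theorem powerQuotient_ne_zero (hν : ν ≠ 0) : powerQuotient a b c μ ν ≠ 0 := by
  have h1 : (RatFunc.X - 1 : RatFunc K) ≠ 0 := by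
    have := RatFunc.X_sub_C_ne_zero (μ := (1 : K))
    rwa [map_one] at this
  exact div_ne_zero (mul_ne_zero (mul_ne_zero ((map_ne_zero_iff _ RatFunc.C_injective).2 hν)
    (pow_ne_zero _ RatFunc.X_ne_zero)) (pow_ne_zero _ h1)) (pow_ne_zero _ RatFunc.X_sub_C_ne_zero)

theorem ordAt_powerQuotient (hν : ν ≠ 0) (s₀ : OnePoint (AlgebraicClosure K)) :
    ordAt s₀ (powerQuotient a b c μ ν) = a * ordAt s₀ (RatFunc.X - RatFunc.C (0 : K)) +
      b * ordAt s₀ (RatFunc.X - RatFunc.C (1 : K)) - c * ordAt s₀ (RatFunc.X - RatFunc.C μ) := by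
  have hν' : (RatFunc.C ν : RatFunc K) ≠ 0 := (map_ne_zero_iff _ RatFunc.C_injective).2 hν
  have h0 := RatFunc.X_sub_C_ne_zero (μ := (0 : K))
  have h1 := RatFunc.X_sub_C_ne_zero (μ := (1 : K))
  have h : powerQuotient a b c μ ν = RatFunc.C ν * (RatFunc.X - RatFunc.C (0 : K)) ^ a *
      (RatFunc.X - RatFunc.C (1 : K)) ^ b / (RatFunc.X - RatFunc.C μ) ^ c := by
    rw [map_zero, map_one, sub_zero]; rfl
  rw [h, ordAt_div (mul_ne_zero (mul_ne_zero hν' (pow_ne_zero _ h0)) (pow_ne_zero _ h1))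
    (pow_ne_zero _ RatFunc.X_sub_C_ne_zero),
    ordAt_mul (mul_ne_zero hν' (pow_ne_zero _ h0)) (pow_ne_zero _ h1),
    ordAt_mul hν' (pow_ne_zero _ h0), ordAt_C, ordAt_pow, ordAt_pow, ordAt_pow, zero_add]

theorem ordAt_infty_X_sub_C (c : K) : ordAt OnePoint.infty (RatFunc.X - RatFunc.C c) = -1 := by
  have h := ordAt_infty_linear (α := -c) (β := 1) one_ne_zero
  rwa [map_neg, map_one, one_mul, neg_add_eq_sub] at h

/-- The zeros and poles of `powerQuotient`. -/
theorem hasMultiplicity_powerQuotient (hμ0 : μ ≠ 0) (hμ1 : μ ≠ 1) (hν : ν ≠ 0) (habc : c < a + b)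
    {s₀ p : OnePoint (AlgebraicClosure K)} {n : ℕ} (hn : 0 < n)
    (h : HasMultiplicity (powerQuotient a b c μ ν) s₀ p n)
    (hp : p = ((0 : AlgebraicClosure K) : OnePoint _) ∨ p = OnePoint.infty) :
    p = ((0 : AlgebraicClosure K) : OnePoint _) ∧ (n = a ∨ n = b) ∨
      p = OnePoint.infty ∧ (n = c ∨ n + c = a + b) := by
  have hord := ordAt_powerQuotient (a := a) (b := b) (c := c) (μ := μ) hν s₀
  have hp' : p = ((0 : AlgebraicClosure K) : OnePoint _) ∧
      ordAt s₀ (powerQuotient a b c μ ν) = n ∨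
      p = OnePoint.infty ∧ ordAt s₀ (powerQuotient a b c μ ν) = -n := by
    rcases hp with rfl | rfl
    · rw [← map_zero (algebraMap K (AlgebraicClosure K)), hasMultiplicity_coe_iff, map_zero,
        sub_zero] at h
      exact Or.inl ⟨rfl, h.2⟩
    · rw [hasMultiplicity_infty_iff, ordAt_inv] at h
      exact Or.inr ⟨rfl, by omega⟩
  have hval : ordAt s₀ (powerQuotient a b c μ ν) = 0 ∨ ordAt s₀ (powerQuotient a b c μ ν) = a ∨
      ordAt s₀ (powerQuotient a b c μ ν) = b ∨ ordAt s₀ (powerQuotient a b c μ ν) = -c ∨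
      ordAt s₀ (powerQuotient a b c μ ν) = c - a - b := by
    have hinj := (algebraMap K (AlgebraicClosure K)).injective
    induction s₀ using OnePoint.rec with
    | infty =>
      rw [ordAt_infty_X_sub_C, ordAt_infty_X_sub_C, ordAt_infty_X_sub_C] at hord
      omega
    | coe x =>
      by_cases h0 : x = algebraMap K _ 0
      · have h01 : x ≠ algebraMap K _ 1 := h0 ▸ hinj.ne zero_ne_one
        have h0μ : x ≠ algebraMap K _ μ := h0 ▸ hinj.ne hμ0.symm
        rw [ordAt_X_sub_C_of_ne h01, ordAt_X_sub_C_of_ne h0μ, h0, ordAt_X_sub_C_self] at hord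
        rw [h0]
        omega
      · by_cases h1 : x = algebraMap K _ 1
        · have h1μ : x ≠ algebraMap K _ μ := h1 ▸ hinj.ne hμ1.symm
          rw [ordAt_X_sub_C_of_ne h0, ordAt_X_sub_C_of_ne h1μ, h1, ordAt_X_sub_C_self] at hord
          rw [h1]
          omega
        · by_cases hμ : x = algebraMap K _ μ
          · rw [ordAt_X_sub_C_of_ne h0, ordAt_X_sub_C_of_ne h1, hμ, ordAt_X_sub_C_self] at hord
            rw [hμ]
            omega
          · rw [ordAt_X_sub_C_of_ne h0, ordAt_X_sub_C_of_ne h1, ordAt_X_sub_C_of_ne hμ] at hord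
            omega
  clear hord
  rcases hp' with ⟨h1, h2⟩ | ⟨h1, h2⟩
  · exact Or.inl ⟨h1, by omega⟩
  · exact Or.inr ⟨h1, by omega⟩

end

namespace RegularGExtension

variable {K : Type u} [Field K] [NumberField K] {G : Type v} [Group G]

/-- The factor `ν` can be chosen such that the critical values of `powerQuotient` avoid the branch
points. -/
theorem exists_pow_avoiding_branchPoints (N : RegularGExtension.{u, v, w} K G)
    (hfin : N.branchPoints.Finite) {a b c d : ℕ} (ha : 0 < a) (hb : 0 < b) (hd : 0 < d) {μ : K}
    (hμ0 : μ ≠ 0) (hμ1 : μ ≠ 1) :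
    ∃ k : ℕ, 0 < k ∧ ∀ x f₀ : AlgebraicClosure K,
      (logNum a b c (algebraMap K _ μ)).eval x = 0 →
      f₀ * (x - algebraMap K _ μ) ^ c = algebraMap K _ ((k : K) ^ d) * x ^ a * (x - 1) ^ b →
      Nonempty (N.PuiseuxEmbedding (f₀ : OnePoint (AlgebraicClosure K)) 1) := by
  set μ' := algebraMap K (AlgebraicClosure K) μ with hμ'
  have hμ0' : μ' ≠ 0 := (_root_.map_ne_zero _).2 hμ0
  have hμ1' : μ' ≠ 1 := fun h => hμ1 ((algebraMap K (AlgebraicClosure K)).injective (by rw [map_one]; exact h))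
  have he0 : (logNum a b c μ').eval 0 ≠ 0 := by
    rw [logNum_eval_zero]
    exact mul_ne_zero (Nat.cast_ne_zero.2 ha.ne') hμ0'
  have he1 : (logNum a b c μ').eval 1 ≠ 0 := by
    rw [logNum_eval_one]
    exact mul_ne_zero (Nat.cast_ne_zero.2 hb.ne') (sub_ne_zero.2 hμ1'.symm)
  have hL : logNum a b c μ' ≠ 0 := fun h => he0 (by rw [h, eval_zero])
  have hroots : {x | (logNum a b c μ').eval x = 0}.Finite := by
    have := (logNum a b c μ').rootSet_finite (AlgebraicClosure K)
    refine this.subset fun x hx => ?_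
    exact (mem_rootSet.2 ⟨hL, by simpa using hx⟩)
  have hbad := hroots.biUnion fun x hx =>
    (hfin.preimage (OnePoint.coe_injective.injOn)).biUnion fun f₀ _ =>
      (Set.Subsingleton.finite (s := {k : ℕ | f₀ * (x - μ') ^ c =
        algebraMap K _ ((k : K) ^ d) * x ^ a * (x - 1) ^ b}) (by
      intro k hk l hl
      have hx0 : x ≠ 0 := by rintro rfl; exact he0 hx
      have hx1 : x - 1 ≠ 0 := fun h => he1 (sub_eq_zero.1 h ▸ hx)
      have h1 := (hk : f₀ * (x - μ') ^ c = _).symm.trans hl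
      have h2 := mul_right_cancel₀ (pow_ne_zero _ hx0) (mul_right_cancel₀ (pow_ne_zero _ hx1) h1)
      have h3 := (algebraMap K (AlgebraicClosure K)).injective h2
      exact Nat.pow_left_injective hd.ne' (by exact_mod_cast h3)))
  obtain ⟨k, hk⟩ := (hbad.insert 0).exists_notMem
  rw [Set.mem_insert_iff, not_or] at hk
  refine ⟨k, Nat.pos_of_ne_zero hk.1, fun x f₀ hx hf => ?_⟩
  by_contra hemp
  refine hk.2 (Set.mem_biUnion hx (Set.mem_biUnion (x := f₀) ?_ hf))
  exact N.mem_branchPoints_iff.2 (not_nonempty_iff.1 hemp)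

/-- With suitable parameters, the pullback along `powerQuotient` has unramified specializations at
every prime. -/
theorem exists_powerQuotient [Finite G] (N : RegularGExtension.{u, v, u} K G)
    (hfin : N.branchPoints.Finite) {e₁ e₂ : ℕ} (he₁ : 1 < e₁) (he₂ : 1 < e₂) (hcop : e₁.Coprime e₂)
    {φ₁ : N.PuiseuxEmbedding ((0 : AlgebraicClosure K) : OnePoint (AlgebraicClosure K)) e₁}
    {φ₂ : N.PuiseuxEmbedding OnePoint.infty e₂} {z₁ z₂ : AlgebraicClosure K}
    (hz₁ : IsPrimitiveRoot z₁ e₁) (hz₂ : IsPrimitiveRoot z₂ e₂) {g₁ g₂ : G} (hg₁ : φ₁.Rotates z₁ g₁)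
    (hg₂ : φ₂.Rotates z₂ g₂) (hord₁ : orderOf g₁ = e₁) (hord₂ : orderOf g₂ = e₂)
    (hcent₁ : Subgroup.centralizer (Subgroup.zpowers g₁ : Set G) = Subgroup.zpowers g₁)
    (hcent₂ : Subgroup.centralizer (Subgroup.zpowers g₂ : Set G) = Subgroup.zpowers g₂) :
    ∃ μ ν : K, μ ≠ 0 ∧ μ ≠ 1 ∧ ν ≠ 0 ∧
      (∀ x f₀ : AlgebraicClosure K,
        (logNum e₁ (e₁ * (e₂ - 1)) e₂ (algebraMap K _ μ)).eval x = 0 →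
        f₀ * (x - algebraMap K _ μ) ^ e₂ =
          algebraMap K _ ν * x ^ e₁ * (x - 1) ^ (e₁ * (e₂ - 1)) →
        Nonempty (N.PuiseuxEmbedding (f₀ : OnePoint (AlgebraicClosure K)) 1)) ∧
      ∀ (N' : RegularGExtension.{u, v, u} K G) (j : N.carrier →+* N'.carrier),
        N.IsPullback (powerQuotient e₁ (e₁ * (e₂ - 1)) e₂ μ ν) N' j →
        N'.universallyRamifiedPrimes = ∅ := by
  classical
  have he₁0 : 0 < e₁ := by omega
  have he₂0 : 0 < e₂ := by omega
  set b := e₁ * (e₂ - 1) with hb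
  have hb0 : 0 < b := Nat.mul_pos he₁0 (by omega)
  obtain ⟨P₁, y₁, D₁, hP₁, hy₁, hPy₁, hD₁, H₁⟩ :=
    N.exists_unramified_splitting he₁0 hz₁ hg₁ hord₁ hcent₁
  obtain ⟨N₀, i, hi, φ₀, hg₀⟩ := N.exists_inversion_pullback he₂0 hz₂.pow_eq_one hg₂
  obtain ⟨P₂, y₂, D₂, hP₂, hy₂, hPy₂, hD₂, H₂⟩ :=
    N₀.exists_unramified_splitting he₂0 hz₂ hg₀ hord₂ hcent₂
  choose! m₁ hm₁ hsp₁ using H₁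
  choose! m₂ hm₂ hsp₂ using H₂
  -- the valuations of the pole `μ` at the exceptional primes
  have hn : ∀ 𝔭 : HeightOneSpectrum (𝓞 K), ∃ n : ℕ, 0 < n ∧
      ((e₁ : 𝓞 K) ∉ 𝔭.asIdeal → ∃ j : ℤ, (e₂ : ℤ) * n = m₁ 𝔭 + e₁ * j) ∧
      ((e₁ : 𝓞 K) ∈ 𝔭.asIdeal → ∃ j : ℤ, (e₁ : ℤ) * n = m₂ 𝔭 + e₂ * j) := by
    intro 𝔭
    by_cases h : (e₁ : 𝓞 K) ∈ 𝔭.asIdeal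
    · obtain ⟨n, hn, hj⟩ := exists_pos_mul_eq_add he₂0 hcop.symm (m₂ 𝔭)
      exact ⟨n, hn, fun h' => absurd h h', fun _ => hj⟩
    · obtain ⟨n, hn, hj⟩ := exists_pos_mul_eq_add he₁0 hcop (m₁ 𝔭)
      exact ⟨n, hn, fun _ => hj, fun h' => absurd h' h⟩
  choose n hn0 hn₁ hn₂ using hn
  have hE : D₁ * (e₁ : 𝓞 K) ≠ 0 := mul_ne_zero hD₁ (Nat.cast_ne_zero.2 he₁0.ne')
  set S := (finite_setOf_mem hE).toFinset with hS
  have hSmem : ∀ 𝔭, 𝔭 ∈ S ↔ D₁ * (e₁ : 𝓞 K) ∈ 𝔭.asIdeal := fun 𝔭 => by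
    rw [hS, Set.Finite.mem_toFinset]; rfl
  obtain ⟨μ₀, hμ₀0, hμ₀1, hμ₀⟩ : ∃ y : 𝓞 K, y ≠ 0 ∧ y ≠ 1 ∧
      ∀ 𝔭 ∈ S, 𝔭.intValuation y = exp (-(n 𝔭 : ℤ)) := by
    rcases S.eq_empty_or_nonempty with h | ⟨𝔮, h𝔮⟩
    · exact ⟨2, two_ne_zero, OfNat.ofNat_ne_one 2, fun 𝔭 h𝔭 => by simp [h] at h𝔭⟩
    · obtain ⟨y, hy⟩ := exists_valuation_eq S n
      refine ⟨y, ?_, ?_, hy⟩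
      · rintro rfl
        have := hy 𝔮 h𝔮
        rw [map_zero] at this
        exact exp_ne_zero this.symm
      · rintro rfl
        have := hy 𝔮 h𝔮
        rw [map_one, ← exp_zero, exp_inj] at this
        have := hn0 𝔮
        omega
  have hinj := FaithfulSMul.algebraMap_injective (𝓞 K) K
  set μ := algebraMap (𝓞 K) K μ₀ with hμdef
  have hμ0 : μ ≠ 0 := (map_ne_zero_iff _ hinj).2 hμ₀0
  have hμ1 : μ ≠ 1 := fun h => hμ₀1 (hinj (h.trans (map_one _).symm))
  have hμ : ∀ 𝔭 ∈ S, 𝔭.valuation K μ = exp (-(n 𝔭 : ℤ)) := fun 𝔭 h𝔭 => by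
    rw [hμdef, HeightOneSpectrum.valuation_of_algebraMap, hμ₀ 𝔭 h𝔭]
  obtain ⟨k, hk, hbr⟩ := N.exists_pow_avoiding_branchPoints hfin (a := e₁) (b := b) (c := e₂)
    (d := e₁ * e₂) he₁0 hb0 (Nat.mul_pos he₁0 he₂0) hμ0 hμ1
  have hk0 : (k : K) ≠ 0 := Nat.cast_ne_zero.2 hk.ne'
  set ν := (k : K) ^ (e₁ * e₂) with hνdef
  have hν : ν ≠ 0 := pow_ne_zero _ hk0
  refine ⟨μ, ν, hμ0, hμ1, hν, hbr, fun N' j h => ?_⟩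
  have hf := powerQuotient_ne_C (a := e₁) (b := b) (c := e₂) he₁0 hμ0 hν
  set f := powerQuotient e₁ b e₂ μ ν with hfdef
  rw [Set.eq_empty_iff_forall_notMem]
  intro 𝔭 hram
  obtain ⟨π, hπ⟩ := 𝔭.valuation_exists_uniformizer K
  have hνv : 𝔭.valuation K ν = exp (-(e₁ * e₂ * -log (𝔭.valuation K (k : K)))) := by
    have h0 : 𝔭.valuation K (k : K) ≠ 0 := (Valuation.ne_zero_iff _).2 hk0
    rw [hνdef, map_pow]
    conv_lhs => rw [← exp_log h0]
    rw [← exp_nsmul, nsmul_eq_mul]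
    congr 1
    push_cast
    ring
  have hDv : ∀ D : 𝓞 K, D ≠ 0 → exp (log (𝔭.valuation K (algebraMap (𝓞 K) K D))) =
      𝔭.valuation K (algebraMap (𝓞 K) K D) := fun D hD =>
    exp_log ((Valuation.ne_zero_iff _).2 ((map_ne_zero_iff _ hinj).2 hD))
  have hfmul : f * algebraMap K[X] (RatFunc K) ((X - C μ) ^ e₂) =
      algebraMap K[X] (RatFunc K) (C ν * X ^ e₁ * (X - 1) ^ b) := by
    simp only [map_pow, map_mul, map_sub, map_one, RatFunc.algebraMap_X, RatFunc.algebraMap_C]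
    exact powerQuotient_mul
  have hfinish : ∀ s : K,
      ((algebraMap K (AlgebraicClosure K) s : AlgebraicClosure K) :
        OnePoint (AlgebraicClosure K)) ∉ N'.branchPoints ∧ ¬ N'.RamifiesInSpecialization s 𝔭 →
      False := fun s hs => hs.2 (hram s hs.1)
  by_cases h𝔭 : (e₁ : 𝓞 K) ∈ 𝔭.asIdeal
  · -- specialize close to the pole `μ`
    have h𝔭₂ : (e₂ : 𝓞 K) ∉ 𝔭.asIdeal := by
      intro h2
      obtain ⟨x, y, hxy⟩ := (Nat.isCoprime_iff_coprime.2 hcop).map (Int.castRingHom (𝓞 K))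
      simp only [eq_intCast, Int.cast_natCast] at hxy
      refine 𝔭.isPrime.ne_top ((Ideal.eq_top_iff_one _).2 (hxy ▸ ?_))
      exact add_mem (Ideal.mul_mem_left _ _ h𝔭) (Ideal.mul_mem_left _ _ h2)
    have h𝔭S : 𝔭 ∈ S := (hSmem 𝔭).2 (Ideal.mul_mem_left _ _ h𝔭)
    obtain ⟨j₀, hj₀⟩ := hn₂ 𝔭 h𝔭
    obtain ⟨s, hs0, hs1, hsμ, hlt, j', hj'⟩ := exists_point_near_pole (𝔭.valuation K) he₂0
      (log (𝔭.valuation K (algebraMap (𝓞 K) K D₂))) hπ (hn0 𝔭) (hμ 𝔭 h𝔭S) hνv hj₀ b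
    rw [hDv D₂ hD₂] at hlt
    have hu0 : (ν * s ^ e₁ * (s - 1) ^ b / (s - μ) ^ e₂)⁻¹ ≠ 0 :=
      inv_ne_zero (div_ne_zero (mul_ne_zero (mul_ne_zero hν (pow_ne_zero _ hs0)) (pow_ne_zero _ hs1))
        (pow_ne_zero _ hsμ))
    obtain ⟨hsep, F, hF, hun, hsplit⟩ := hsp₂ 𝔭 h𝔭₂ _ j' hu0 hlt hj'
    have hf0 : f ≠ 0 := powerQuotient_ne_zero hν
    refine hfinish s (h.not_ramifiesInSpecialization hf i hi.map_const hi.map_t (g := f⁻¹)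
      ?_ ?_ (p := (X - C μ) ^ e₂) (q := C ν * X ^ e₁ * (X - 1) ^ b) ?_ ?_ ?_ hP₂ hy₂ hPy₂ hsep
      hsplit hun)
    · rintro ⟨c, hc⟩
      exact hf ⟨c⁻¹, by rw [map_inv₀, ← hc, inv_inv]⟩
    · intro θ _ hθ
      rw [map_inv₀, hθ, inv_inv]
    · rw [← hfmul, inv_mul_cancel_left₀ hf0]
    · simpa using ⟨⟨hν, fun h => absurd h hs0⟩, fun h => absurd h hs1⟩
    · simp only [eval_mul, eval_pow, eval_sub, eval_C, eval_X, eval_one]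
      field_simp
  · -- specialize close to one of the zeros `0` and `1`
    obtain ⟨s, hs0, hs1, hsμ, hlt, j', hj'⟩ : ∃ s : K, s ≠ 0 ∧ s - 1 ≠ 0 ∧ s - μ ≠ 0 ∧
        𝔭.valuation K (ν * s ^ e₁ * (s - 1) ^ b / (s - μ) ^ e₂) <
          exp (log (𝔭.valuation K (algebraMap (𝓞 K) K D₁))) ∧
        ∃ j : ℤ, 𝔭.valuation K (ν * s ^ e₁ * (s - 1) ^ b / (s - μ) ^ e₂) =
          exp (m₁ 𝔭 + e₁ * j) := by
      by_cases h𝔭S : 𝔭 ∈ S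
      · obtain ⟨j₀, hj₀⟩ := hn₁ 𝔭 h𝔭
        exact exists_point_near_zero (𝔭.valuation K) he₁0 _ hπ (hμ 𝔭 h𝔭S) hνv hj₀ b
      · have hm0 : m₁ 𝔭 = 0 := hm₁ 𝔭 h𝔭 fun hD => h𝔭S ((hSmem 𝔭).2 (Ideal.mul_mem_right _ _ hD))
        have hμv0 : 𝔭.valuation K μ ≠ 0 := (Valuation.ne_zero_iff _).2 hμ0
        have hμv1 : 𝔭.valuation K μ ≤ 1 := 𝔭.valuation_le_one μ₀
        obtain ⟨l, hl⟩ : ∃ l : ℕ, 𝔭.valuation K μ = exp (-(l : ℤ)) := by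
          rw [← exp_log hμv0, ← exp_zero, exp_le_exp] at hμv1
          refine ⟨(-log (𝔭.valuation K μ)).toNat, ?_⟩
          rw [Int.toNat_of_nonneg (by omega), neg_neg, exp_log hμv0]
        rw [hm0]
        rcases Nat.eq_zero_or_pos l with rfl | hl0
        · exact exists_point_near_zero (𝔭.valuation K) he₁0 (j₀ := 0) _ hπ hl hνv (by simp) b
        · exact exists_point_near_one (𝔭.valuation K) hb hb0 _ hπ hl0 hl hνv
    rw [hDv D₁ hD₁] at hlt
    have hu0 : ν * s ^ e₁ * (s - 1) ^ b / (s - μ) ^ e₂ ≠ 0 :=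
      div_ne_zero (mul_ne_zero (mul_ne_zero hν (pow_ne_zero _ hs0)) (pow_ne_zero _ hs1))
        (pow_ne_zero _ hsμ)
    obtain ⟨hsep, F, hF, hun, hsplit⟩ := hsp₁ 𝔭 h𝔭 _ j' hu0 hlt hj'
    refine hfinish s (h.not_ramifiesInSpecialization hf (RingHom.id N.carrier) (fun _ => rfl)
      (r := RatFunc.X) rfl hf (fun θ _ hθ => hθ) hfmul ?_ ?_ hP₁ hy₁ hPy₁ hsep hsplit hun)
    · simpa using fun h => absurd h hsμ
    · simp only [eval_mul, eval_pow, eval_sub, eval_C, eval_X, eval_one]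
      exact div_mul_cancel₀ _ (pow_ne_zero _ hsμ)

end RegularGExtension

end Pullback

theorem theorem4p5 {K : Type u} [Field K] [NumberField K] {G : Type v} [Group G] [Finite G]
    (ζ : ℕ → AlgebraicClosure K) (hζ : ∀ n : ℕ, 0 < n → IsPrimitiveRoot (ζ n) n)
    (N : RegularGExtension.{u, v, w} K G) {r : ℕ} (C : Fin r → ConjClasses G)
    (hC : N.HasRamificationType ζ C)
    (g : Fin r → G) (hg : ∀ i, ConjClasses.mk (g i) = C i)
    (i₁ i₂ : Fin r) (h_ne : i₁ ≠ i₂)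
    (h_only : ∀ i, ¬ orderOf (g i) ∣ generatorExponent G ↔ i = i₁ ∨ i = i₂)
    (h_coprime : Nat.Coprime (orderOf (g i₁)) (orderOf (g i₂)))
    (h_cent₁ : Subgroup.centralizer (Subgroup.zpowers (g i₁) : Set G) = Subgroup.zpowers (g i₁))
    (h_cent₂ : Subgroup.centralizer (Subgroup.zpowers (g i₂) : Set G) = Subgroup.zpowers (g i₂)) :
    ∃ (N' : RegularGExtension.{u, v, u} K G) (s : ℕ) (C' : Fin s → ConjClasses G),
      N'.HasRamificationType ζ C' ∧
      (∀ i, ∀ x ∈ (C' i).carrier, Nat.card (Subgroup.zpowers x) ∣ generatorExponent G) ∧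
      N'.universallyRamifiedPrimes = ∅ := by
  obtain ⟨p, hpinj, hprange, hpC⟩ := hC
  have hmem : ∀ i, g i ∈ N.inertiaClass ζ (p i) := fun i => by
    rw [← hpC, ConjClasses.mem_carrier_iff_mk_eq, hg]
  have hidx : ∀ i, 0 < N.ramificationIndex (p i) ∧ orderOf (g i) = N.ramificationIndex (p i) :=
    fun i => N.orderOf_of_mem_inertiaClass hζ (hmem i)
  have hgt : ∀ i, i = i₁ ∨ i = i₂ → 1 < orderOf (g i) := by
    intro i hi
    have h1 := (h_only i).2 hi
    have h2 : orderOf (g i) ≠ 1 := fun h => h1 (by rw [h]; exact one_dvd _)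
    have h3 := orderOf_pos (g i)
    omega
  have he₁ := hgt i₁ (Or.inl rfl)
  have he₂ := hgt i₂ (Or.inr rfl)
  have hbranch : N.branchPoints.Finite := hprange ▸ Set.finite_range p
  have hindex : ∀ q, (∃ i, q = p i) ∨ N.ramificationIndex q = 1 := by
    intro q
    by_cases hq : q ∈ N.branchPoints
    · rw [← hprange] at hq
      obtain ⟨i, rfl⟩ := hq
      exact Or.inl ⟨i, rfl⟩
    · exact Or.inr (not_not.1 hq)
  -- the two exceptional points are determined by their ramification indices, hence rational
  have hrat : ∀ i, i = i₁ ∨ i = i₂ → p i = OnePoint.infty ∨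
      ∃ a : K, p i = (algebraMap K (AlgebraicClosure K) a : AlgebraicClosure K) := by
    intro i hi
    refine N.eq_algebraMap_of_ramificationIndex fun q hq => ?_
    rw [← (hidx i).2] at hq
    rcases hindex q with ⟨k, rfl⟩ | h1
    · rw [← (hidx k).2] at hq
      have hk := (h_only k).1 (by rw [hq]; exact (h_only i).2 hi)
      congr 1
      rcases hi with rfl | rfl <;> rcases hk with rfl | rfl
      · rfl
      · rw [hq, Nat.coprime_self] at h_coprime; omega
      · rw [hq, Nat.coprime_self] at h_coprime; omega
      · rfl
    · have := hgt i hi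
      omega
  have hnonempty : ∀ q, ∃ e, 0 < e ∧ N.ramificationIndex q = e ∧ Nonempty (N.PuiseuxEmbedding q e) := by
    intro q
    rcases hindex q with ⟨k, rfl⟩ | h1
    · obtain ⟨φ, -⟩ := hmem k
      exact ⟨_, (hidx k).1, rfl, ⟨φ⟩⟩
    · refine ⟨1, one_pos, h1, ?_⟩
      rw [← not_isEmpty_iff, ← N.mem_branchPoints_iff]
      exact fun h => h h1
  have hram : ∀ q, q ≠ p i₁ → q ≠ p i₂ →
      ∃ e, 0 < e ∧ e ∣ generatorExponent G ∧ Nonempty (N.PuiseuxEmbedding q e) := by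
    intro q hq₁ hq₂
    obtain ⟨e, he, hqe, hφ⟩ := hnonempty q
    refine ⟨e, he, ?_, hφ⟩
    rw [← hqe]
    rcases hindex q with ⟨k, rfl⟩ | h1
    · rw [← (hidx k).2]
      by_contra hdvd
      rcases (h_only k).1 hdvd with rfl | rfl
      · exact hq₁ rfl
      · exact hq₂ rfl
    · rw [h1]; exact one_dvd _
  have hrot : ∀ i, ∃ φ : N.PuiseuxEmbedding (p i) (orderOf (g i)),
      φ.Rotates (ζ (orderOf (g i))) (g i) := by
    intro i
    rw [(hidx i).2]
    exact hmem i
  obtain ⟨φ₁, hφ₁⟩ := hrot i₁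
  obtain ⟨φ₂, hφ₂⟩ := hrot i₂
  have hz₁ := hζ _ (orderOf_pos (g i₁))
  have hz₂ := hζ _ (orderOf_pos (g i₂))
  obtain ⟨N₁, ⟨ψ₁, hψ₁⟩, ⟨ψ₂, hψ₂⟩, hram₁, hfin₁⟩ := N.exists_moebius_pullback (hpinj.ne h_ne)
    (hrat i₁ (Or.inl rfl)) (hrat i₂ (Or.inr rfl)) hram hbranch (orderOf_pos _) (orderOf_pos _)
    hz₁.pow_eq_one hz₂.pow_eq_one hφ₁ hφ₂
  generalize he₁' : orderOf (g i₁) = e₁ at *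
  generalize he₂' : orderOf (g i₂) = e₂ at *
  obtain ⟨μ, ν, hμ0, hμ1, hν, hbr, hU⟩ := N₁.exists_powerQuotient hfin₁ he₁ he₂ h_coprime hz₁ hz₂
    hψ₁ hψ₂ he₁' he₂' h_cent₁ h_cent₂
  obtain ⟨d₁, rfl⟩ : ∃ d, e₁ = d + 1 := ⟨e₁ - 1, by omega⟩
  obtain ⟨d₂, rfl⟩ : ∃ d, e₂ = d + 1 := ⟨e₂ - 1, by omega⟩
  rw [Nat.add_sub_cancel] at hbr hU
  have hd₁ : 0 < d₁ := by omega
  have hd₂ : 0 < d₂ := by omega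
  have hdeg : d₂ + 1 < d₁ + 1 + (d₁ + 1) * d₂ := by nlinarith
  have hf := powerQuotient_ne_C (a := d₁ + 1) (b := (d₁ + 1) * d₂) (c := d₂ + 1) d₁.succ_pos hμ0 hν
  obtain ⟨N', j, h⟩ := N₁.exists_pullback hf (N₁.mem_range_of_powerQuotient d₁.succ_pos
    (Nat.mul_pos d₁.succ_pos hd₂) d₂.succ_pos h_coprime hdeg hμ0 hμ1 hν hbr)
  have hemb : ∀ s₀, ∃ e, 0 < e ∧ e ∣ generatorExponent G ∧ Nonempty (N'.PuiseuxEmbedding s₀ e) := by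
    intro s₀
    obtain ⟨q, n, hn, hmult⟩ := exists_hasMultiplicity hf s₀
    have hzero := hasMultiplicity_powerQuotient hμ0 hμ1 hν hdeg hn hmult
    by_cases hq0 : q = ((0 : AlgebraicClosure K) : OnePoint (AlgebraicClosure K))
    · -- over `0` the multiplicity of the pullback map is a multiple of the ramification index
      subst hq0
      obtain ⟨k, hk, hnk⟩ : ∃ k, 0 < k ∧ n * 1 = (d₁ + 1) * k := by
        rcases hzero (Or.inl rfl) with ⟨-, hn | hn⟩ | ⟨hcon, -⟩
        · exact ⟨1, one_pos, by omega⟩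
        · exact ⟨d₂, hd₂, by omega⟩
        · exact absurd hcon (OnePoint.coe_ne_infty _)
      exact ⟨1, one_pos, one_dvd _,
        h.nonempty_puiseuxEmbedding hf hmult hk one_pos d₁.succ_pos hnk ψ₁⟩
    · by_cases hqi : q = OnePoint.infty
      · subst hqi
        obtain ⟨k, hk, hnk⟩ : ∃ k, 0 < k ∧ n * 1 = (d₂ + 1) * k := by
          rcases hzero (Or.inr rfl) with ⟨hcon, -⟩ | ⟨-, hn | hn⟩
          · exact absurd hcon.symm (OnePoint.coe_ne_infty _)
          · exact ⟨1, one_pos, by omega⟩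
          · exact ⟨d₁, hd₁, by linarith⟩
        exact ⟨1, one_pos, one_dvd _,
          h.nonempty_puiseuxEmbedding hf hmult hk one_pos d₂.succ_pos hnk ψ₂⟩
      · obtain ⟨e, he, hem, ⟨φ⟩⟩ := hram₁ q hq0 hqi
        exact ⟨e, he, hem, h.nonempty_puiseuxEmbedding_of_hasMultiplicity hf hn he hmult φ⟩
  obtain ⟨s, C', hC', hdvd⟩ := N'.exists_hasRamificationType hζ (h.finite_branchPoints hf hfin₁) hemb
  exact ⟨N', s, C', hC', fun i x hx => by rw [Nat.card_zpowers]; exact hdvd i x hx, hU N' j h⟩
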